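/- **Model.** Fix an integer $p\ge 1$ and constants $c_0>0$, $C_0$, $\delta>0$, $K$. For an integer $W\ge1$ let $N=2pW$, and let $H=(H_{ij})_{1\le i,j\le N}$ be a random real symmetric matrix whose entries $(H_{ij})_{i\le j}$ are independent and centered. Write $|i-j|$ for the distance on $\{1,\dots,N\}$ with periodic boundary condition mod $N$, and assume that $H_{ij}=0$ if $|i-j|>2W$, that $\mathbb E(H_{ij}^2)\ge c_0/W$ if $|i-j|<2W$, that $\mathbb E(H_{ij}^2)\le C_0/W$ if $|i-j|\le 2W$, and that $\mathbb E\big(e^{\delta W H_{ij}^2}\big)\le K$ for all $i,j$. For $\mathbf g\in\mathbb R^N$ decompose $$H^{\mathbf g}=H-\operatorname{diag}(g_1,\dots,g_N)=\begin{pmatrix}A^{\mathbf g}&B^*\\ B&D^{\mathbf g}\end{pmatrix},$$ where $A^{\mathbf g}$ is $W\times W$. Let $\|\cdot\|$ be the Euclidean norm. **Proposition 3.1.** There exists $\mu>0$, depending only on $p,c_0,C_0,\delta,K$, such that for all $c>0$ and $D>0$ there is $N_0$, depending only on $p,c_0,C_0,\delta,K,c,D$, such that for all $N=2pW\ge N_0$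 and every matrix $H$ as above, $$\mathbb P\Big(\exists e\in\mathbb R,\ \exists \mathbf u\in\mathbb R^{N-W},\ \exists\mathbf g\in\mathbb R^N:\ \|\mathbf g\|_\infty\le N^{-c},\ \|\mathbf u\|=1,\ \|(D^{\mathbf g}-e)\mathbf u\|\le\mu,\ \sum_{1\le i\le W}|u_i|^2\le\mu^2\Big)\le N^{-D},$$ $$\mathbb P\Big(\exists e\in\mathbb R,\ \exists\mathbf g\in\mathbb R^N:\ \|\mathbf g\|_\infty\le N^{-c},\ e\notin\sigma(D^{\mathbf g}),\ B^*\frac{\mu^2}{(D^{\mathbf g}-e)^2}B\ \ge\ \Big(B^*\frac1{D^{\mathbf g}-e}B\Big)^2+1\Big)\le N^{-D},$$ where $\ge$ is the order of symmetric matrices. The last bound holds even when the inequality is only asked for in one direction: $$\mathbb P\Big(\exists e\in\mathbb R,\ \exists\mathbf g\in\mathbb R^N,\ \exists\mathbf w\in\mathbb R^{W}:\ \|\mathbf g\|_\infty\le N^{-c},\ e\notin\sigma(D^{\mathbf g}),\ \|\mathbf w\|=1,\ \mu^2\Big\|\frac1{D^{\mathbf g}-e}B\mathbf w\Big\|^2\ge\Big\|B^*\frac1{D^{\mathbf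 g}-e}B\mathbf w\Big\|^2+1\Big)\le N^{-D}.$$ -/

import Mathlib

open MeasureTheory ProbabilityTheory Matrix

namespace BandMatrix

/-- The distance between `i` and `j` on `{0, …, N - 1}` with periodic boundary condition mod `N`. -/
def periodicDist {N : ℕ} (i j : Fin N) : ℕ :=
  min ((i : ℤ) - (j : ℤ)).natAbs (N - ((i : ℤ) - (j : ℤ)).natAbs)

/-- `H` is a random real symmetric band matrix of size `N = 2 * p * W`: the entries are independent
up to the symmetry, centered, vanish at periodic distance larger than `2 * W`, have variance of
order `1 / W` within the band, and are uniformly sub-Gaussian at scale `W ^ (-1/2)`.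
The lower bound on the variance is asked for at distance `< 2 * W`, i.e. on the `4 * W - 1`
central diagonals; at distance exactly `2 * W` the entry may vanish or not. -/
structure IsBandMatrix {Ω : Type*} [MeasurableSpace Ω] (P : Measure Ω) (p W : ℕ)
    (c₀ C₀ δ K : ℝ) (H : Ω → Matrix (Fin (2 * p * W)) (Fin (2 * p * W)) ℝ) : Prop where
  symm : ∀ ω, (H ω).IsSymm
  measurable : ∀ i j, Measurable fun ω => H ω i j
  indep : iIndepFun (fun (x : {x : Fin (2 * p * W) × Fin (2 * p * W) // x.1 ≤ x.2}) ω =>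
    H ω x.1.1 x.1.2) P
  centered : ∀ i j, ∫ ω, H ω i j ∂P = 0
  band : ∀ i j, 2 * W < periodicDist i j → ∀ ω, H ω i j = 0
  variance_lower : ∀ i j, periodicDist i j < 2 * W → c₀ / W ≤ ∫ ω, (H ω i j) ^ 2 ∂P
  variance_upper : ∀ i j, periodicDist i j ≤ 2 * W → ∫ ω, (H ω i j) ^ 2 ∂P ≤ C₀ / W
  subgaussian : ∀ i j, Integrable (fun ω => Real.exp (δ * W * (H ω i j) ^ 2)) P ∧
    ∫ ω, Real.exp (δ * W * (H ω i j) ^ 2) ∂P ≤ K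

/-- The indices of the first `W` coordinates. -/
abbrev Head (N W : ℕ) : Type := {i : Fin N // (i : ℕ) < W}

/-- The indices of the last `N - W` coordinates. -/
abbrev Tail (N W : ℕ) : Type := {i : Fin N // W ≤ (i : ℕ)}

/-- `H - ∑ j, g j • e_j e_j^*`. -/
def perturb {N : ℕ} (H : Matrix (Fin N) (Fin N) ℝ) (g : Fin N → ℝ) : Matrix (Fin N) (Fin N) ℝ :=
  H - Matrix.diagonal g

/-- The lower left block `B` in `H = [[A, Bᵀ], [B, D]]`, where `A` is the upper left `W × W` block. -/
def blockB {N : ℕ} (W : ℕ) (H : Matrix (Fin N) (Fin N) ℝ) : Matrix (Tail N W) (Head N W) ℝ :=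
  H.toBlock (fun i => W ≤ (i : ℕ)) (fun i => (i : ℕ) < W)

/-- The lower right block `D` in `H = [[A, Bᵀ], [B, D]]`, where `A` is the upper left `W × W` block. -/
def blockD {N : ℕ} (W : ℕ) (H : Matrix (Fin N) (Fin N) ℝ) : Matrix (Tail N W) (Tail N W) ℝ :=
  H.toSquareBlockProp (fun i => W ≤ (i : ℕ))

/-- `D^g - e`, with `D^g` the lower right block of `H - diag g`. -/
def shiftedD {N : ℕ} (W : ℕ) (H : Matrix (Fin N) (Fin N) ℝ) (g : Fin N → ℝ) (e : ℝ) :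
    Matrix (Tail N W) (Tail N W) ℝ :=
  blockD W (perturb H g) - e • (1 : Matrix (Tail N W) (Tail N W) ℝ)

end BandMatrix

/-!
The three events reduce to one statement. Let `k ≥ 1`, and let `u` be a unit vector of length
`N = 2 p W` vanishing on its first `k` blocks of `W` coordinates. Outside an event of exponentially
small probability, for every real `e` the vector `(H - e) u`, restricted to all rows but those of the
first `k - 1` blocks, has norm at least a constant (`exists_approxEigenvector_unlikely`). For `k = 2`
this excludes approximate eigenvectors of `D^g` with little mass on the second block. For `k = 1` it
says that the columns of `D^g - e` and of `Bᵀ` have no small singular value jointly, and is applied to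
`(D^g - e)⁻¹ B w`. The perturbation `g` is small in operator norm and is absorbed by the constants.

There is one more block of rows than of columns, which is what makes an `ε`-net argument work, but it
has to be run at the right scale, since `u` may be concentrated on few blocks, or on few coordinates.
For `t > 0` a block is active if more than `η W` coordinates of `u` on it have size at least `t / √W`.

* If no block is active at some level, then `u` is nearly sparse. The points of the lattice of mesh
  `t / √W` which approximate such vectors number at most `exp (o(1) W)` as `η → 0`, and each of them
  has a small residual with probability at most `exp (-c W)` (`exists_sparse_unlikely`).
* Otherwise refine the level. The set of active blocks can only grow, hence it takes the same value
  `A` at a level `t` and at the next, much smaller, level `t'`. The relevant lattice points of mesh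
  `t' / √W` number about `t' ^ (-|A| W)`. The rows of the blocks in `A` and of the block preceding
  `min A` all see a block on which `u` is spread, so that each lattice point has a residual of order
  `t'` with probability at most about `t' ^ ((|A| + 1) W)` (`IsBandMatrix.measure_stable_active_le`).

The dependence created by the symmetry of `H` is removed by reserving a small set of columns in the
active blocks, removing the corresponding rows, and using only the entries in the remaining rows and
the reserved columns; all other entries are frozen (`IsBandMatrix.measure_residual_le`). The small
ball estimate for a row bounds `E exp (-(v / 2) (S + a) ^ 2)` by a Gaussian average of the
characteristic function of `S` (`integral_exp_neg_sq_le_of_charFun_le`); this form tensorizes. Only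
blocks at distance at most one are used, so the entries at distance between `W` and `2 W` and the
periodicity of the band play no role.
-/

namespace BandMatrix

/-! ### Counting lattice points -/

lemma exists_int_trunc {h : ℝ} (hh : 0 < h) (x : ℝ) :
    ∃ k : ℤ, |x - h * k| ≤ h ∧ |h * k| ≤ |x| := by
  rcases le_total 0 x with hx | hx
  · refine ⟨⌊x / h⌋, ?_⟩
    have h1 : h * ⌊x / h⌋ ≤ x := by
      have := Int.floor_le (x / h)
      rw [le_div_iff₀ hh] at this; linarith
    have h2 : x < h * ⌊x / h⌋ + h := by
      have := Int.lt_floor_add_one (x / h)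
      rw [div_lt_iff₀ hh] at this; linarith
    have h3 : (0 : ℝ) ≤ ⌊x / h⌋ := by exact_mod_cast Int.floor_nonneg.2 (by positivity)
    rw [abs_of_nonneg hx, abs_of_nonneg (by linarith : 0 ≤ x - h * ⌊x / h⌋),
      abs_of_nonneg (mul_nonneg hh.le h3)]
    exact ⟨by linarith, h1⟩
  · refine ⟨⌈x / h⌉, ?_⟩
    have h1 : x ≤ h * ⌈x / h⌉ := by
      have := Int.le_ceil (x / h)
      rw [div_le_iff₀ hh] at this; linarith
    have h2 : h * ⌈x / h⌉ < x + h := by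
      have := Int.ceil_lt_add_one (x / h)
      have h4 : x / h * h = x := by field_simp
      nlinarith
    have h3 : (⌈x / h⌉ : ℝ) ≤ 0 := by
      exact_mod_cast Int.ceil_le.2 (by simpa using div_nonpos_of_nonpos_of_nonneg hx hh.le)
    rw [abs_of_nonpos hx, abs_of_nonpos (mul_nonpos_of_nonneg_of_nonpos hh.le h3),
      abs_of_nonpos (by linarith)]
    exact ⟨by linarith, by linarith⟩

/-- The weight of an integer used to count lattice vectors: it penalises both the size of the
support and the `ℓ¹` norm. -/
noncomputable def latticeWeight (t z : ℝ) (k : ℤ) : ℝ :=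
  if k = 0 then 1 else z * Real.exp (-t * |(k : ℝ)|)

lemma latticeWeight_nonneg {t z : ℝ} (hz : 0 < z) (k : ℤ) : 0 ≤ latticeWeight t z k := by
  unfold latticeWeight; split_ifs <;> positivity

lemma sum_latticeWeight_le {t z : ℝ} (ht : 0 < t) (hz : 0 < z) (T : Finset ℤ) :
    ∑ k ∈ T, latticeWeight t z k ≤ 1 + 2 * z / t := by
  have hy1 : Real.exp (-t) < 1 := by simpa using ht
  have hy0 := Real.exp_pos (-t)
  have hg : HasSum (fun n : ℕ => z * Real.exp (-t) * Real.exp (-t) ^ n)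
      (z * Real.exp (-t) * (1 - Real.exp (-t))⁻¹) :=
    (hasSum_geometric_of_lt_one hy0.le hy1).mul_left _
  have hle : z * Real.exp (-t) * (1 - Real.exp (-t))⁻¹ ≤ z / t := by
    rw [← div_eq_mul_inv, div_le_div_iff₀ (by linarith) ht]
    have h1 : Real.exp (-t) * (t + 1) ≤ 1 := by
      have := mul_le_mul_of_nonneg_left (Real.add_one_le_exp t) hy0.le
      rwa [← Real.exp_add, neg_add_cancel, Real.exp_zero] at this
    nlinarith
  have e1 : ∀ n : ℕ, latticeWeight t z ((n : ℤ) + 1) =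
      z * Real.exp (-t) * Real.exp (-t) ^ n := by
    intro n
    have : ((n : ℤ) + 1) ≠ 0 := by omega
    rw [latticeWeight, if_neg this, mul_assoc, ← Real.exp_nat_mul, ← Real.exp_add]
    congr 2
    have h4 : |(((n : ℤ) + 1 : ℤ) : ℝ)| = n + 1 := by
      push_cast; exact abs_of_nonneg (by positivity)
    rw [h4]; ring
  have e2 : ∀ n : ℕ, latticeWeight t z (-((n : ℤ) + 1)) =
      z * Real.exp (-t) * Real.exp (-t) ^ n := by
    intro n
    rw [← e1 n]
    have : ((n : ℤ) + 1) ≠ 0 := by omega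
    have h' : -((n : ℤ) + 1) ≠ 0 := by omega
    rw [latticeWeight, latticeWeight, if_neg this, if_neg h']
    congr 3
    push_cast; rw [← abs_neg]; congr 1; ring
  have hpos : HasSum (fun n : ℕ => latticeWeight t z (n : ℤ))
      (1 + z * Real.exp (-t) * (1 - Real.exp (-t))⁻¹) := by
    have : HasSum (fun n : ℕ => latticeWeight t z ((n + 1 : ℕ) : ℤ))
        (z * Real.exp (-t) * (1 - Real.exp (-t))⁻¹) := by
      simpa [e1] using hg
    have := (hasSum_nat_add_iff' (f := fun n : ℕ => latticeWeight t z (n : ℤ)) 1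
      (g := 1 + z * Real.exp (-t) * (1 - Real.exp (-t))⁻¹)).1
      (by simpa [latticeWeight] using this)
    exact this
  have hneg : HasSum (fun n : ℕ => latticeWeight t z (-((n : ℤ) + 1)))
      (z * Real.exp (-t) * (1 - Real.exp (-t))⁻¹) := by
    simp_rw [e2]; exact hg
  have hall := HasSum.of_nat_of_neg_add_one hpos hneg
  refine (sum_le_hasSum T (fun k _ => latticeWeight_nonneg hz k) hall).trans ?_
  have : 2 * z / t = z / t + z / t := by ring
  linarith

/-- An exponential-weight bound on the number of integer vectors with few nonzero coordinates
and bounded `ℓ¹` norm. With `z = t` it is of order `t ^ (-n₀)`, the power of `t` expected from the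
dimension; with `z` small it also captures that very sparse vectors are few. -/
lemma card_lattice_le {ι : Type*} [Fintype ι] [DecidableEq ι] {t z : ℝ} (ht : 0 < t) (hz : 0 < z)
    (hz1 : z ≤ 1) (n₀ M : ℝ) (S : Finset (ι → ℤ))
    (hsupp : ∀ k ∈ S, ((Finset.univ.filter fun i => k i ≠ 0).card : ℝ) ≤ n₀)
    (hl1 : ∀ k ∈ S, ∑ i, |(k i : ℝ)| ≤ M) :
    (S.card : ℝ) ≤ z ^ (-n₀) * Real.exp (t * M) * (1 + 2 * z / t) ^ Fintype.card ι := by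
  have key : ∀ k ∈ S, (1 : ℝ) ≤ z ^ (-n₀) * Real.exp (t * M) * ∏ i, latticeWeight t z (k i) := by
    intro k hk
    have e1 : ∏ i, latticeWeight t z (k i) =
        z ^ ((Finset.univ.filter fun i => k i ≠ 0).card : ℝ) *
          Real.exp (-t * ∑ i, |(k i : ℝ)|) := by
      rw [Real.rpow_natCast, Finset.mul_sum, Real.exp_sum, Finset.card_eq_sum_ones,
        Finset.sum_filter, ← Finset.prod_pow_eq_pow_sum, ← Finset.prod_mul_distrib]
      refine Finset.prod_congr rfl fun i _ => ?_
      by_cases h : k i = 0 <;> simp [latticeWeight, h]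
    rw [e1]
    have e2 : z ^ (-n₀) * Real.exp (t * M) *
        (z ^ ((Finset.univ.filter fun i => k i ≠ 0).card : ℝ) *
          Real.exp (-t * ∑ i, |(k i : ℝ)|)) =
        z ^ (-n₀ + ((Finset.univ.filter fun i => k i ≠ 0).card : ℝ)) *
          Real.exp (t * (M - ∑ i, |(k i : ℝ)|)) := by
      rw [Real.rpow_add hz, show t * (M - ∑ i, |(k i : ℝ)|) = t * M + -t * ∑ i, |(k i : ℝ)| by ring,
        Real.exp_add]
      ring
    rw [e2]
    refine one_le_mul_of_one_le_of_one_le ?_ ?_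
    · exact Real.one_le_rpow_of_pos_of_le_one_of_nonpos hz hz1 (by linarith [hsupp k hk])
    · exact Real.one_le_exp (mul_nonneg ht.le (by linarith [hl1 k hk]))
  calc (S.card : ℝ) = ∑ k ∈ S, (1 : ℝ) := by simp
    _ ≤ ∑ k ∈ S, z ^ (-n₀) * Real.exp (t * M) * ∏ i, latticeWeight t z (k i) :=
        Finset.sum_le_sum key
    _ = z ^ (-n₀) * Real.exp (t * M) * ∑ k ∈ S, ∏ i, latticeWeight t z (k i) := by
        rw [Finset.mul_sum]
    _ ≤ z ^ (-n₀) * Real.exp (t * M) *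
        ∑ k ∈ Fintype.piFinset (fun i => S.image (fun k => k i)), ∏ i, latticeWeight t z (k i) := by
        refine mul_le_mul_of_nonneg_left ?_ (by positivity)
        refine Finset.sum_le_sum_of_subset_of_nonneg ?_ ?_
        · intro k hk
          rw [Fintype.mem_piFinset]
          exact fun i => Finset.mem_image_of_mem (fun k : ι → ℤ => k i) hk
        · exact fun k _ _ => Finset.prod_nonneg fun i _ => latticeWeight_nonneg hz _
    _ = z ^ (-n₀) * Real.exp (t * M) *
        ∏ i, ∑ k ∈ S.image (fun k => k i), latticeWeight t z k := by
        rw [Finset.prod_univ_sum]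
    _ ≤ z ^ (-n₀) * Real.exp (t * M) * ∏ _i : ι, (1 + 2 * z / t) := by
        refine mul_le_mul_of_nonneg_left ?_ (by positivity)
        exact Finset.prod_le_prod
          (fun i _ => Finset.sum_nonneg fun k _ => latticeWeight_nonneg hz k)
          (fun i _ => sum_latticeWeight_le ht hz _)
    _ = _ := by simp

/-! ### Small ball estimates from characteristic functions -/

lemma integral_exp_neg_mul_sq_gaussianReal {v : NNReal} (hv : v ≠ 0) {b : ℝ}
    (hb : 0 < 1 + 2 * b * v) :
    ∫ x, Real.exp (-b * x ^ 2) ∂(gaussianReal 0 v) = (√(1 + 2 * b * v))⁻¹ := by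
  have hv' : (0 : ℝ) < v := by positivity
  rw [integral_gaussianReal_eq_integral_smul hv]
  have e : ∀ x : ℝ, gaussianPDFReal 0 v x • Real.exp (-b * x ^ 2) =
      (√(2 * Real.pi * v))⁻¹ * Real.exp (-(b + 1 / (2 * v)) * x ^ 2) := by
    intro x
    rw [gaussianPDFReal, smul_eq_mul, mul_assoc, ← Real.exp_add]
    congr 2
    field_simp; ring
  simp_rw [e]
  rw [integral_const_mul, integral_gaussian, ← Real.sqrt_inv, ← Real.sqrt_inv,
    ← Real.sqrt_mul (by positivity)]
  congr 1
  have : b + 1 / (2 * v) ≠ 0 := by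
    have : (b + 1 / (2 * v)) * (2 * v) = 1 + 2 * b * v := by field_simp; ring
    intro h; rw [h] at this; linarith
  have hp := Real.pi_ne_zero
  have h2 : (1 + 2 * b * v) = (b + 1 / (2 * v)) * (2 * v) := by field_simp; ring
  rw [h2]; field_simp

lemma integrable_exp_neg_mul_sq_gaussianReal {v : NNReal} (hv : v ≠ 0) {b : ℝ}
    (hb : 0 < 1 + 2 * b * v) :
    Integrable (fun x => Real.exp (-b * x ^ 2)) (gaussianReal 0 v) := by
  by_contra h
  have h1 := integral_exp_neg_mul_sq_gaussianReal hv hb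
  rw [integral_undef h] at h1
  have : 0 < (√(1 + 2 * b * v))⁻¹ := by positivity
  linarith

/-- The smoothed small ball probability of `S` at scale `v ^ (-1/2)` is the Gaussian average of its
characteristic function: `exp (-(v / 2) x ^ 2)` is the characteristic function of a centered
Gaussian variable of variance `v`. -/
lemma integral_exp_neg_sq_le_integral_charFun {Ω : Type*} [MeasurableSpace Ω] {P : Measure Ω}
    [IsProbabilityMeasure P] {S : Ω → ℝ} (hS : Measurable S) (a : ℝ) (v : NNReal) :
    ∫ ω, Real.exp (-(v / 2) * (S ω + a) ^ 2) ∂P ≤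
      ∫ g, ‖charFun (P.map S) g‖ ∂(gaussianReal 0 v) := by
  have e1 : ∀ x : ℝ, ((Real.exp (-(v / 2) * x ^ 2) : ℝ) : ℂ) =
      ∫ g, Complex.exp (x * g * Complex.I) ∂(gaussianReal 0 v) := by
    intro x
    rw [← charFun_apply_real, charFun_gaussianReal]
    push_cast; congr 1; ring
  have e2 : ((∫ ω, Real.exp (-(v / 2) * (S ω + a) ^ 2) ∂P : ℝ) : ℂ) =
      ∫ g, Complex.exp (a * g * Complex.I) * charFun (P.map S) g ∂(gaussianReal 0 v) := by
    rw [← integral_complex_ofReal]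
    simp_rw [e1]
    rw [integral_integral_swap]
    · refine integral_congr_ae (ae_of_all _ fun g => ?_)
      simp only
      rw [charFun_apply_real, integral_map hS.aemeasurable
        (by fun_prop : AEStronglyMeasurable _ _), ← integral_const_mul]
      refine integral_congr_ae (ae_of_all _ fun ω => ?_)
      simp only
      rw [← Complex.exp_add]; congr 1; push_cast; ring
    · refine Integrable.of_bound (C := 1) ?_ (ae_of_all _ ?_)
      · simp only [Function.uncurry_def]
        have : Measurable fun q : Ω × ℝ =>
            Complex.exp (((S q.1 + a : ℝ) : ℂ) * q.2 * Complex.I) := by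
          fun_prop
        exact this.aestronglyMeasurable
      · rintro ⟨ω, g⟩
        simp only [Function.uncurry]
        rw [← Complex.ofReal_mul, Complex.norm_exp_ofReal_mul_I]
  have h0 : 0 ≤ ∫ ω, Real.exp (-(v / 2) * (S ω + a) ^ 2) ∂P :=
    integral_nonneg fun _ => (Real.exp_pos _).le
  have e3 : ∫ ω, Real.exp (-(v / 2) * (S ω + a) ^ 2) ∂P =
      ‖((∫ ω, Real.exp (-(v / 2) * (S ω + a) ^ 2) ∂P : ℝ) : ℂ)‖ := by
    rw [Complex.norm_real, Real.norm_of_nonneg h0]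
  rw [e3, e2]
  refine (norm_integral_le_integral_norm _).trans (le_of_eq ?_)
  refine integral_congr_ae (ae_of_all _ fun g => ?_)
  simp only [norm_mul]
  rw [← Complex.ofReal_mul, Complex.norm_exp_ofReal_mul_I, one_mul]

lemma integral_exp_neg_sq_le_of_charFun_le {Ω : Type*} [MeasurableSpace Ω] {P : Measure Ω}
    [IsProbabilityMeasure P] {S : Ω → ℝ} (hS : Measurable S) (a : ℝ) {v : NNReal} (hv : v ≠ 0)
    {b r : ℝ} (hb : 0 ≤ b) (hr : 0 < r)
    (hφ : ∀ g, |g| ≤ r → ‖charFun (P.map S) g‖ ≤ Real.exp (-b * g ^ 2)) :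
    ∫ ω, Real.exp (-(v / 2) * (S ω + a) ^ 2) ∂P ≤
      (√(1 + 2 * b * v))⁻¹ + 64 * v ^ 2 / r ^ 4 := by
  have hv' : (0 : ℝ) < v := by positivity
  have : IsProbabilityMeasure (P.map S) := Measure.isProbabilityMeasure_map hS.aemeasurable
  have hc : 0 < 1 + 2 * (-(1 / (4 * v)) : ℝ) * v := by field_simp; norm_num
  have hI1 := integrable_exp_neg_mul_sq_gaussianReal hv (b := b) (by positivity)
  have hI2 := integrable_exp_neg_mul_sq_gaussianReal hv hc
  refine (integral_exp_neg_sq_le_integral_charFun hS a v).trans ?_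
  have hpt : ∀ g, ‖charFun (P.map S) g‖ ≤ Real.exp (-b * g ^ 2) +
      32 * v ^ 2 / r ^ 4 * Real.exp (-(-(1 / (4 * v)) : ℝ) * g ^ 2) := by
    intro g
    rcases le_or_gt |g| r with hg | hg
    · exact (hφ g hg).trans (le_add_of_nonneg_right (by positivity))
    · refine (norm_charFun_le_one g).trans (le_add_of_nonneg_of_le (Real.exp_pos _).le ?_)
      have h1 : (g ^ 2 / (4 * v)) ^ 2 ≤ 2 * Real.exp (g ^ 2 / (4 * v)) := by
        have := Real.quadratic_le_exp_of_nonneg (x := g ^ 2 / (4 * v)) (by positivity)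
        have h0 : 0 ≤ g ^ 2 / (4 * v) := by positivity
        nlinarith
      have h2 : r ^ 4 ≤ g ^ 4 := by
        have := pow_le_pow_left₀ hr.le hg.le 4
        rwa [show |g| ^ 4 = g ^ 4 by rw [← abs_pow]; exact abs_of_nonneg (by positivity)] at this
      have h3 : (g ^ 2 / (4 * v)) ^ 2 = g ^ 4 / (16 * v ^ 2) := by field_simp; ring
      rw [h3, div_le_iff₀ (by positivity)] at h1
      rw [show -(-(1 / (4 * v)) : ℝ) * g ^ 2 = g ^ 2 / (4 * v) by ring, div_mul_eq_mul_div,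
        le_div_iff₀ (by positivity)]
      linarith
  refine (integral_mono ?_ (hI1.add (hI2.const_mul _)) hpt).trans ?_
  · exact Integrable.of_bound (C := 1) stronglyMeasurable_charFun.norm.aestronglyMeasurable
      (ae_of_all _ fun g => by simpa using norm_charFun_le_one g)
  · simp only [Pi.add_apply]
    rw [integral_add hI1 (hI2.const_mul _), integral_const_mul,
      integral_exp_neg_mul_sq_gaussianReal hv (by positivity),
      integral_exp_neg_mul_sq_gaussianReal hv hc]
    have h4 : (√(1 + 2 * (-(1 / (4 * v)) : ℝ) * v))⁻¹ ≤ 2 := by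
      rw [show 1 + 2 * (-(1 / (4 * v)) : ℝ) * v = 1 / 2 by field_simp; norm_num]
      rw [inv_le_comm₀ (by positivity) (by norm_num)]
      refine Real.le_sqrt_of_sq_le (by norm_num)
    have h5 : 0 ≤ 32 * (v : ℝ) ^ 2 / r ^ 4 := by positivity
    have := mul_le_mul_of_nonneg_left h4 h5
    have h6 : 64 * (v : ℝ) ^ 2 / r ^ 4 = 32 * (v : ℝ) ^ 2 / r ^ 4 * 2 := by ring
    linarith

lemma norm_exp_sub_taylor_two_le (x : ℝ) :
    ‖Complex.exp (x * Complex.I) - (1 + x * Complex.I - x ^ 2 / 2)‖ ≤ 4 * |x| ^ 3 := by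
  have hx : ‖(x : ℂ) * Complex.I‖ = |x| := by simp
  rcases le_or_gt |x| 1 with h | h
  · have := Complex.exp_bound (x := x * Complex.I) (by rwa [hx]) (n := 3) (by norm_num)
    rw [hx] at this
    have e : ∑ m ∈ Finset.range 3, ((x : ℂ) * Complex.I) ^ m / (m.factorial : ℂ) =
        1 + x * Complex.I - x ^ 2 / 2 := by
      simp [Finset.sum_range_succ, mul_pow, Nat.factorial]; ring
    rw [e] at this
    refine this.trans ?_
    have h3 : 0 ≤ |x| ^ 3 := by positivity
    norm_num [Nat.factorial]
    nlinarith
  · have h1 : ‖Complex.exp (x * Complex.I) - (1 + x * Complex.I - x ^ 2 / 2)‖ ≤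
        1 + (1 + |x| + |x| ^ 2 / 2) := by
      refine (norm_sub_le _ _).trans (add_le_add (Complex.norm_exp_ofReal_mul_I x).le ?_)
      refine (norm_sub_le _ _).trans (add_le_add ((norm_add_le _ _).trans ?_) ?_)
      · simp
      · simp
    refine h1.trans ?_
    nlinarith [mul_pos (sub_pos.2 h) (sub_pos.2 h), mul_pos (sub_pos.2 h) (by positivity : 0 < |x|),
      mul_pos (sub_pos.2 h) (by positivity : 0 < |x| ^ 2)]

/-- A centered sub-Gaussian variable at scale `w ^ (-1/2)` with variance at least `c₀ / w` has a
characteristic function with Gaussian decay on an interval of length of order `√w`. -/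
lemma norm_charFun_le_exp {Ω : Type*} [MeasurableSpace Ω] {P : Measure Ω}
    [IsProbabilityMeasure P] {X : Ω → ℝ} (hX : Measurable X) (h0 : ∫ ω, X ω ∂P = 0)
    {δ K c₀ w κ : ℝ} (hδ : 0 < δ) (hw : 0 < w)
    (hint : Integrable (fun ω => Real.exp (δ * w * X ω ^ 2)) P)
    (hK : ∫ ω, Real.exp (δ * w * X ω ^ 2) ∂P ≤ K) (hvar : c₀ / w ≤ ∫ ω, X ω ^ 2 ∂P)
    (hκ1 : κ ^ 2 * K ≤ 2 * δ) (hκ2 : 48 * K * κ ≤ c₀ * (δ * √δ)) {ξ : ℝ} (hξ : |ξ| ≤ κ * √w) :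
    ‖charFun (P.map X) ξ‖ ≤ Real.exp (-(c₀ / (4 * w)) * ξ ^ 2) := by
  have hK0 : 0 ≤ K := (integral_nonneg fun _ => (Real.exp_pos _).le).trans hK
  have hs3 : (√(δ * w)) ^ 3 = δ * √δ * (w * √w) := by
    rw [Real.sqrt_mul hδ.le, mul_pow]
    have h1 : √δ ^ 3 = δ * √δ := by rw [pow_succ, Real.sq_sqrt hδ.le]
    have h2 : √w ^ 3 = w * √w := by rw [pow_succ, Real.sq_sqrt hw.le]
    rw [h1, h2]
  have hX2pt : ∀ ω, X ω ^ 2 ≤ (δ * w)⁻¹ * Real.exp (δ * w * X ω ^ 2) := by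
    intro ω
    rw [inv_mul_eq_div, le_div_iff₀ (by positivity)]
    have := Real.add_one_le_exp (δ * w * X ω ^ 2)
    linarith
  have hX3pt : ∀ ω, |X ω| ^ 3 ≤ 3 / (δ * √δ * (w * √w)) * Real.exp (δ * w * X ω ^ 2) := by
    intro ω
    rw [div_mul_eq_mul_div, le_div_iff₀ (by positivity), ← hs3, ← mul_pow]
    set y := |X ω| * √(δ * w) with hy
    have hy0 : 0 ≤ y := by positivity
    have hy2 : δ * w * X ω ^ 2 = y ^ 2 := by
      rw [hy, mul_pow, sq_abs, Real.sq_sqrt (by positivity)]; ring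
    rw [hy2]
    have h1 := Real.quadratic_le_exp_of_nonneg (x := y ^ 2) (by positivity)
    have h2 : y ^ 3 ≤ 1 + y ^ 4 := by
      rcases le_total y 1 with h | h
      · have : y ^ 3 ≤ 1 := pow_le_one₀ hy0 h
        have : 0 ≤ y ^ 4 := by positivity
        linarith
      · have : y ^ 3 ≤ y ^ 4 := pow_le_pow_right₀ h (by norm_num)
        linarith
    nlinarith [sq_nonneg y]
  have hX2int : Integrable (fun ω => X ω ^ 2) P :=
    (hint.const_mul (δ * w)⁻¹).mono' (by fun_prop)
      (ae_of_all _ fun ω => by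
        rw [Real.norm_of_nonneg (sq_nonneg _)]; exact hX2pt ω)
  have hX3int : Integrable (fun ω => |X ω| ^ 3) P :=
    (hint.const_mul (3 / (δ * √δ * (w * √w)))).mono' (by fun_prop)
      (ae_of_all _ fun ω => by
        rw [Real.norm_of_nonneg (by positivity)]; exact hX3pt ω)
  have hX1int : Integrable X P := by
    refine ((integrable_const (1 : ℝ)).add hX2int).mono' hX.aestronglyMeasurable
      (ae_of_all _ fun ω => ?_)
    simp only [Pi.add_apply, Real.norm_eq_abs]
    nlinarith [sq_nonneg (|X ω| - 1), sq_abs (X ω)]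
  have hX2le : ∫ ω, X ω ^ 2 ∂P ≤ K / (δ * w) := by
    refine (integral_mono hX2int (hint.const_mul _) hX2pt).trans ?_
    rw [integral_const_mul, inv_mul_eq_div]
    gcongr
  have hX3le : ∫ ω, |X ω| ^ 3 ∂P ≤ 3 / (δ * √δ * (w * √w)) * K := by
    refine (integral_mono hX3int (hint.const_mul _) hX3pt).trans ?_
    rw [integral_const_mul]
    gcongr
  set σ := ∫ ω, X ω ^ 2 ∂P with hσ
  have hξ2 : ξ ^ 2 ≤ κ ^ 2 * w := by
    have := pow_le_pow_left₀ (abs_nonneg ξ) hξ 2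
    rwa [sq_abs, mul_pow, Real.sq_sqrt hw.le] at this
  have hsmall : ξ ^ 2 * σ ≤ 2 := by
    calc ξ ^ 2 * σ ≤ κ ^ 2 * w * (K / (δ * w)) := by gcongr
      _ = κ ^ 2 * K / δ := by field_simp
      _ ≤ 2 := by rw [div_le_iff₀ hδ]; exact hκ1
  have hE : charFun (P.map X) ξ = ∫ ω, Complex.exp (((ξ * X ω : ℝ) : ℂ) * Complex.I) ∂P := by
    rw [charFun_apply_real, integral_map hX.aemeasurable (by fun_prop)]
    push_cast; rfl
  have hTint : Integrable (fun ω => (1 : ℂ) + ((ξ * X ω : ℝ) : ℂ) * Complex.I -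
      ((ξ * X ω : ℝ) : ℂ) ^ 2 / 2) P := by
    refine ((integrable_const _).add ?_).sub ?_
    · exact ((hX1int.const_mul ξ).ofReal).mul_const _
    · have : Integrable (fun ω => (((ξ ^ 2 * X ω ^ 2 / 2 : ℝ)) : ℂ)) P :=
        ((hX2int.const_mul (ξ ^ 2)).div_const 2).ofReal
      refine this.congr (ae_of_all _ fun ω => ?_)
      push_cast; ring
  have hT : ∫ ω, ((1 : ℂ) + ((ξ * X ω : ℝ) : ℂ) * Complex.I - ((ξ * X ω : ℝ) : ℂ) ^ 2 / 2) ∂P =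
      ((1 - ξ ^ 2 * σ / 2 : ℝ) : ℂ) := by
    have e : ∀ ω, ((1 : ℂ) + ((ξ * X ω : ℝ) : ℂ) * Complex.I - ((ξ * X ω : ℝ) : ℂ) ^ 2 / 2) =
        ((1 - ξ ^ 2 / 2 * X ω ^ 2 : ℝ) : ℂ) + ((ξ * X ω : ℝ) : ℂ) * Complex.I := by
      intro ω; push_cast; ring
    simp_rw [e]
    rw [integral_add, integral_mul_const, integral_complex_ofReal, integral_complex_ofReal,
      integral_const_mul, h0, integral_sub (integrable_const _) (hX2int.const_mul _),
      integral_const_mul]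
    · simp [hσ]; ring
    · exact ((integrable_const (1 : ℝ)).sub (hX2int.const_mul _)).ofReal
    · exact ((hX1int.const_mul ξ).ofReal).mul_const _
  have hexpint : Integrable (fun ω => Complex.exp (((ξ * X ω : ℝ) : ℂ) * Complex.I)) P := by
    refine Integrable.of_bound (C := 1) ?_ (ae_of_all _ fun ω => ?_)
    · have : Measurable fun ω => Complex.exp (((ξ * X ω : ℝ) : ℂ) * Complex.I) := by fun_prop
      exact this.aestronglyMeasurable
    · rw [Complex.norm_exp_ofReal_mul_I]
  have hdiff : ‖charFun (P.map X) ξ - ((1 - ξ ^ 2 * σ / 2 : ℝ) : ℂ)‖ ≤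
      4 * |ξ| ^ 3 * (3 / (δ * √δ * (w * √w)) * K) := by
    rw [hE, ← hT, ← integral_sub hexpint hTint]
    refine (norm_integral_le_integral_norm _).trans ?_
    have : ∀ ω, ‖Complex.exp (((ξ * X ω : ℝ) : ℂ) * Complex.I) - ((1 : ℂ) +
        ((ξ * X ω : ℝ) : ℂ) * Complex.I - ((ξ * X ω : ℝ) : ℂ) ^ 2 / 2)‖ ≤
        4 * |ξ| ^ 3 * |X ω| ^ 3 := by
      intro ω
      refine (norm_exp_sub_taylor_two_le (ξ * X ω)).trans (le_of_eq ?_)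
      rw [abs_mul, mul_pow]; ring
    refine (integral_mono (hexpint.sub hTint).norm (hX3int.const_mul _) this).trans ?_
    rw [integral_const_mul]
    gcongr
  have hthird : 4 * |ξ| ^ 3 * (3 / (δ * √δ * (w * √w)) * K) ≤ ξ ^ 2 * (c₀ / (4 * w)) := by
    have h1 : |ξ| ^ 3 ≤ ξ ^ 2 * (κ * √w) := by
      rw [pow_succ, sq_abs]; gcongr
    have h2 : 4 * |ξ| ^ 3 * (3 / (δ * √δ * (w * √w)) * K) ≤
        4 * (ξ ^ 2 * (κ * √w)) * (3 / (δ * √δ * (w * √w)) * K) := by gcongr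
    refine h2.trans ?_
    have h3 : 4 * (ξ ^ 2 * (κ * √w)) * (3 / (δ * √δ * (w * √w)) * K) =
        ξ ^ 2 * (48 * K * κ / (4 * (δ * √δ) * w)) := by
      field_simp; ring
    rw [h3]
    refine mul_le_mul_of_nonneg_left ?_ (sq_nonneg _)
    rw [div_le_div_iff₀ (by positivity) (by positivity)]
    nlinarith [mul_le_mul_of_nonneg_right hκ2 (by positivity : 0 ≤ 4 * w)]
  have hmain : ‖charFun (P.map X) ξ‖ ≤ 1 - c₀ / (4 * w) * ξ ^ 2 := by
    have h1 : ‖charFun (P.map X) ξ‖ ≤ ‖charFun (P.map X) ξ - ((1 - ξ ^ 2 * σ / 2 : ℝ) : ℂ)‖ +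
        ‖((1 - ξ ^ 2 * σ / 2 : ℝ) : ℂ)‖ := by
      have := norm_add_le (charFun (P.map X) ξ - ((1 - ξ ^ 2 * σ / 2 : ℝ) : ℂ))
        ((1 - ξ ^ 2 * σ / 2 : ℝ) : ℂ)
      rwa [sub_add_cancel] at this
    rw [Complex.norm_real, Real.norm_of_nonneg (by linarith)] at h1
    have h2 := mul_le_mul_of_nonneg_left hvar (sq_nonneg ξ)
    have h3 : c₀ / w = 4 * (c₀ / (4 * w)) := by field_simp
    rw [h3] at h2
    nlinarith
  refine hmain.trans ?_
  have := Real.add_one_le_exp (-(c₀ / (4 * w)) * ξ ^ 2)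
  linarith

/-! ### Tensorization over the rows -/

/-- One independent linear form can be integrated out: `S` is independent of `Y`. -/
lemma lintegral_mul_comp_le {Ω β : Type*} [MeasurableSpace Ω] [MeasurableSpace β] {P : Measure Ω}
    [IsProbabilityMeasure P] {S : Ω → ℝ} {Y : Ω → β} (hS : Measurable S) (hY : Measurable Y)
    (hSY : IndepFun S Y P) {F : β → ENNReal} (hF : Measurable F) {a : β → ℝ} (ha : Measurable a)
    {f : ℝ → ENNReal} (hf : Measurable f) {q : ENNReal} (hq : ∀ x, ∫⁻ ω, f (S ω + x) ∂P ≤ q) :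
    ∫⁻ ω, F (Y ω) * f (S ω + a (Y ω)) ∂P ≤ (∫⁻ ω, F (Y ω) ∂P) * q := by
  have hprod := (indepFun_iff_map_prod_eq_prod_map_map hS.aemeasurable hY.aemeasurable).1 hSY
  have : IsProbabilityMeasure (P.map S) := Measure.isProbabilityMeasure_map hS.aemeasurable
  have : IsProbabilityMeasure (P.map Y) := Measure.isProbabilityMeasure_map hY.aemeasurable
  have hG : Measurable fun x : ℝ × β => F x.2 * f (x.1 + a x.2) := by fun_prop
  calc ∫⁻ ω, F (Y ω) * f (S ω + a (Y ω)) ∂P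
      = ∫⁻ x, F x.2 * f (x.1 + a x.2) ∂(P.map fun ω => (S ω, Y ω)) := by
        rw [lintegral_map hG (by fun_prop)]
    _ = ∫⁻ y, ∫⁻ s, F y * f (s + a y) ∂(P.map S) ∂(P.map Y) := by
        rw [hprod, lintegral_prod_symm _ hG.aemeasurable]
    _ ≤ ∫⁻ y, F y * q ∂(P.map Y) := by
        refine lintegral_mono fun y => ?_
        rw [lintegral_const_mul _ (by fun_prop), lintegral_map (by fun_prop) hS]
        gcongr
        exact hq _
    _ = (∫⁻ ω, F (Y ω) ∂P) * q := by
        rw [lintegral_mul_const _ hF, lintegral_map hF hY]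

/-- Tensorization: if each of the affine forms `i ∈ I` involves a group `G i` of variables which the
other forms do not involve, then the factors can be integrated out one after the other. -/
lemma lintegral_prod_linear_le {Ω ι τ : Type*} [MeasurableSpace Ω] [Fintype τ] [DecidableEq τ]
    [DecidableEq ι] {P : Measure Ω} [IsProbabilityMeasure P] {X : τ → Ω → ℝ}
    (hX : ∀ k, Measurable (X k)) (hind : iIndepFun X P) (c : ι → τ → ℝ) (d : ι → ℝ)
    (G : ι → Finset τ) {f : ℝ → ENNReal} (hf : Measurable f) {q : ENNReal} (I : Finset ι)
    (hdisj : ∀ i ∈ I, ∀ i' ∈ I, i' ≠ i → ∀ k ∈ G i, c i' k = 0)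
    (hrow : ∀ i ∈ I, ∀ x, ∫⁻ ω, f (∑ k ∈ G i, c i k * X k ω + x) ∂P ≤ q) :
    ∫⁻ ω, ∏ i ∈ I, f (∑ k, c i k * X k ω + d i) ∂P ≤ q ^ I.card := by
  induction I using Finset.induction_on with
  | empty => simp
  | insert i I hi ih =>
    have ih' := ih
      (fun j hj j' hj' => hdisj j (Finset.mem_insert_of_mem hj) j' (Finset.mem_insert_of_mem hj'))
      (fun j hj => hrow j (Finset.mem_insert_of_mem hj))
    set S : Ω → ℝ := fun ω => ∑ k ∈ G i, c i k * X k ω with hSdef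
    set Y : Ω → ((G i)ᶜ : Finset τ) → ℝ := fun ω k => X k ω with hYdef
    have hSm : Measurable S := Finset.measurable_sum _ fun k _ => (hX k).const_mul _
    have hYm : Measurable Y := measurable_pi_lambda _ fun k => hX k
    have hSY : IndepFun S Y P := by
      have h := hind.indepFun_finset (G i) (G i)ᶜ disjoint_compl_right hX
      have hφ : Measurable fun y : (G i) → ℝ => ∑ k : G i, c i k * y k := by fun_prop
      have := h.comp hφ measurable_id
      have e : S = (fun y : (G i) → ℝ => ∑ k : G i, c i k * y k) ∘ fun ω k => X k ω := by
        funext ω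
        simp only [hSdef, Function.comp]
        exact (Finset.sum_coe_sort (G i) fun k => c i k * X k ω).symm
      rw [e]; exact this
    have hsplit : ∀ j ω, ∑ k, c j k * X k ω =
        ∑ k ∈ G i, c j k * X k ω + ∑ k : ((G i)ᶜ : Finset τ), c j k * Y ω k := by
      intro j ω
      rw [← Finset.sum_add_sum_compl (G i)]
      congr 1
      exact (Finset.sum_coe_sort ((G i)ᶜ) fun k => c j k * X k ω).symm
    have hrest : ∀ j ∈ I, ∀ ω, ∑ k, c j k * X k ω =
        ∑ k : ((G i)ᶜ : Finset τ), c j k * Y ω k := by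
      intro j hj ω
      rw [hsplit, Finset.sum_eq_zero, zero_add]
      intro k hk
      rw [hdisj i (Finset.mem_insert_self _ _) j (Finset.mem_insert_of_mem hj)
        (fun h => hi (h ▸ hj)) k hk, zero_mul]
    have hFm : Measurable fun y : ((G i)ᶜ : Finset τ) → ℝ =>
        ∏ j ∈ I, f (∑ k : ((G i)ᶜ : Finset τ), c j k * y k + d j) := by
      refine Finset.measurable_prod _ fun j _ => hf.comp ?_
      fun_prop
    have key := lintegral_mul_comp_le hSm hYm hSY hFm
      (a := fun y => ∑ k : ((G i)ᶜ : Finset τ), c i k * y k + d i) (by fun_prop) hf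
      (hrow i (Finset.mem_insert_self _ _))
    have e1 : ∀ ω, ∏ j ∈ I, f (∑ k, c j k * X k ω + d j) =
        ∏ j ∈ I, f (∑ k : ((G i)ᶜ : Finset τ), c j k * Y ω k + d j) := fun ω =>
      Finset.prod_congr rfl fun j hj => by rw [hrest j hj]
    calc ∫⁻ ω, ∏ j ∈ insert i I, f (∑ k, c j k * X k ω + d j) ∂P
        = ∫⁻ ω, (∏ j ∈ I, f (∑ k : ((G i)ᶜ : Finset τ), c j k * Y ω k + d j)) *
            f (S ω + (∑ k : ((G i)ᶜ : Finset τ), c i k * Y ω k + d i)) ∂P := by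
          refine lintegral_congr fun ω => ?_
          rw [Finset.prod_insert hi, mul_comm, e1, hsplit i ω, add_assoc]
      _ ≤ _ := key
      _ ≤ q ^ I.card * q := by
          gcongr
          exact (lintegral_congr fun ω => (e1 ω).symm).trans_le ih'
      _ = q ^ (insert i I).card := by rw [Finset.card_insert_of_notMem hi, pow_succ]

/-- The unordered pair `{i, j}`, as an index of the upper triangular part. -/
def sortedPair {N : ℕ} (i j : Fin N) : {x : Fin N × Fin N // x.1 ≤ x.2} :=
  ⟨(min i j, max i j), min_le_max⟩

lemma sortedPair_eq_iff {N : ℕ} {i j i' j' : Fin N} :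
    sortedPair i j = sortedPair i' j' ↔ (i = i' ∧ j = j') ∨ (i = j' ∧ j = i') := by
  simp only [sortedPair, Subtype.mk.injEq, Prod.mk.injEq]
  constructor
  · rintro ⟨h1, h2⟩
    rcases le_total i j with h | h <;> rcases le_total i' j' with h' | h' <;>
      simp_all
  · rintro (⟨rfl, rfl⟩ | ⟨rfl, rfl⟩)
    · simp
    · simp [min_comm, max_comm]

section

variable {Ω : Type*} [MeasurableSpace Ω] {P : Measure Ω} {p W : ℕ}
  {c₀ C₀ δ K : ℝ} {H : Ω → Matrix (Fin (2 * p * W)) (Fin (2 * p * W)) ℝ}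

lemma IsBandMatrix.apply_sortedPair (hH : IsBandMatrix P p W c₀ C₀ δ K H)
    (i j : Fin (2 * p * W)) (ω : Ω) :
    H ω (sortedPair i j).1.1 (sortedPair i j).1.2 = H ω i j := by
  rcases le_total i j with h | h
  · simp [sortedPair, h]
  · simp only [sortedPair, min_eq_right h, max_eq_left h]
    exact (hH.symm ω).apply i j

variable [IsProbabilityMeasure P]

lemma IsBandMatrix.norm_charFun_row_le (hH : IsBandMatrix P p W c₀ C₀ δ K H) (hW : 0 < W)
    (hδ : 0 < δ) {κ : ℝ} (hκ1 : κ ^ 2 * K ≤ 2 * δ)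
    (hκ2 : 48 * K * κ ≤ c₀ * (δ * √δ)) (u : Fin (2 * p * W) → ℝ) (i : Fin (2 * p * W))
    (J : Finset (Fin (2 * p * W))) (hdist : ∀ j ∈ J, periodicDist i j < 2 * W)
    {T : ℝ} (hT : 0 < T) (hu : ∀ j ∈ J, |u j| ≤ T / √W) {g : ℝ} (hg : |g| ≤ κ * W / T) :
    ‖charFun (P.map fun ω => ∑ j ∈ J, u j * H ω i j) g‖ ≤
      Real.exp (-(c₀ / (4 * W) * ∑ j ∈ J, u j ^ 2) * g ^ 2) := by
  have hW' : (0 : ℝ) < W := by exact_mod_cast hW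
  have hind : iIndepFun (J.restrict fun j ω => u j * H ω i j) P := by
    have hinj : Function.Injective fun j : J => sortedPair i j.1 := by
      intro j j' h
      rcases sortedPair_eq_iff.1 h with h | h
      · exact Subtype.ext h.2
      · exact Subtype.ext (h.2.trans h.1)
    have h1 := hH.indep.precomp hinj
    have h2 := h1.comp (fun j x => u j.1 * x) (fun j => measurable_const_mul _)
    convert h2 using 1
    funext j ω
    simp only [Finset.restrict, Function.comp, hH.apply_sortedPair]
  rw [hind.charFun_map_fun_finsetSum_eq_prod fun j _ =>
    ((hH.measurable i j).const_mul _).aemeasurable, Finset.prod_apply, norm_prod]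
  have : Real.exp (-(c₀ / (4 * W) * ∑ j ∈ J, u j ^ 2) * g ^ 2) =
      ∏ j ∈ J, Real.exp (-(c₀ / (4 * W)) * (u j * g) ^ 2) := by
    rw [← Real.exp_sum]
    congr 1
    rw [← Finset.mul_sum]
    simp_rw [mul_pow]
    rw [← Finset.sum_mul]; ring
  rw [this]
  refine Finset.prod_le_prod (fun _ _ => norm_nonneg _) fun j hj => ?_
  have e : charFun (P.map fun ω => u j * H ω i j) g =
      charFun (P.map fun ω => H ω i j) (u j * g) := by
    rw [charFun_apply_real, charFun_apply_real, integral_map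
      ((hH.measurable i j).const_mul _).aemeasurable (by fun_prop),
      integral_map (hH.measurable i j).aemeasurable (by fun_prop)]
    refine integral_congr_ae (ae_of_all _ fun ω => ?_)
    simp only
    congr 1; push_cast; ring
  rw [e]
  refine norm_charFun_le_exp (hH.measurable i j) (hH.centered i j) hδ hW'
    (hH.subgaussian i j).1 (hH.subgaussian i j).2 (hH.variance_lower i j (hdist j hj)) hκ1 hκ2 ?_
  rw [abs_mul]
  calc |u j| * |g| ≤ T / √W * (κ * W / T) := by
        exact mul_le_mul (hu j hj) hg (abs_nonneg _) (by positivity)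
    _ = κ * (W / √W) := by field_simp
    _ = κ * √W := by rw [Real.div_sqrt]

/-- Small ball estimate for a fixed vector `u`: the rows `i ∈ I` use the fresh randomness of the
entries `H i j`, `j ∈ J i`, while everything else is frozen. -/
lemma IsBandMatrix.measure_residual_le (hH : IsBandMatrix P p W c₀ C₀ δ K H) (hW : 0 < W)
    (hδ : 0 < δ) (hc₀ : 0 < c₀) {κ : ℝ} (hκ : 0 < κ) (hκ1 : κ ^ 2 * K ≤ 2 * δ)
    (hκ2 : 48 * K * κ ≤ c₀ * (δ * √δ)) (u d : Fin (2 * p * W) → ℝ)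
    (I : Finset (Fin (2 * p * W))) (J : Fin (2 * p * W) → Finset (Fin (2 * p * W)))
    (hIJ : ∀ i ∈ I, ∀ j ∈ J i, j ∉ I)
    (hdist : ∀ i ∈ I, ∀ j ∈ J i, periodicDist i j < 2 * W)
    {T m s : ℝ} (hT : 0 < T) (hs : 0 < s) (hm : 0 ≤ m)
    (hu : ∀ i ∈ I, ∀ j ∈ J i, |u j| ≤ T / √W) (hmass : ∀ i ∈ I, m ≤ ∑ j ∈ J i, u j ^ 2)
    (ρ : ℝ) :
    P {ω | ∑ i ∈ I, (∑ j, H ω i j * u j + d i) ^ 2 ≤ ρ} ≤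
      ENNReal.ofReal (Real.exp (W * ρ / (2 * s ^ 2)) *
        ((√(1 + c₀ * m / (2 * s ^ 2)))⁻¹ + 64 * T ^ 4 / (κ ^ 4 * s ^ 4 * W ^ 2)) ^ I.card) := by
  have hW' : (0 : ℝ) < W := by exact_mod_cast hW
  set v : NNReal := ⟨W / s ^ 2, by positivity⟩ with hv
  have hvv : (v : ℝ) = W / s ^ 2 := rfl
  have hv0 : v ≠ 0 := by
    rw [← NNReal.coe_ne_zero, hvv]; positivity
  set q : ℝ := (√(1 + c₀ * m / (2 * s ^ 2)))⁻¹ + 64 * T ^ 4 / (κ ^ 4 * s ^ 4 * W ^ 2) with hq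
  have hq0 : 0 ≤ q := by positivity
  set f : ℝ → ENNReal := fun x => ENNReal.ofReal (Real.exp (-(v / 2) * x ^ 2)) with hfdef
  have hf : Measurable f := by fun_prop
  set X : {x : Fin (2 * p * W) × Fin (2 * p * W) // x.1 ≤ x.2} → Ω → ℝ :=
    fun x ω => H ω x.1.1 x.1.2 with hXdef
  have hX : ∀ k, Measurable (X k) := fun k => hH.measurable _ _
  set c : Fin (2 * p * W) → {x : Fin (2 * p * W) × Fin (2 * p * W) // x.1 ≤ x.2} → ℝ :=
    fun i k => ∑ j, if sortedPair i j = k then u j else 0 with hc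
  set G : Fin (2 * p * W) → Finset {x : Fin (2 * p * W) × Fin (2 * p * W) // x.1 ≤ x.2} :=
    fun i => (J i).image (sortedPair i) with hG
  have hlin : ∀ i ω, ∑ k, c i k * X k ω = ∑ j, H ω i j * u j := by
    intro i ω
    simp only [hc, Finset.sum_mul]
    rw [Finset.sum_comm]
    refine Finset.sum_congr rfl fun j _ => ?_
    simp only [ite_mul, zero_mul, Finset.sum_ite_eq, Finset.mem_univ, if_true]
    rw [hXdef]
    simp only [hH.apply_sortedPair]
    ring
  have hcG : ∀ i ∈ I, ∀ j ∈ J i, c i (sortedPair i j) = u j := by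
    intro i hi j hj
    simp only [hc]
    rw [Finset.sum_eq_single j]
    · simp
    · intro j' _ hne
      rw [if_neg]
      rw [sortedPair_eq_iff]
      rintro (h | h)
      · exact hne h.2
      · exact hIJ i hi j hj (h.1 ▸ hi)
    · simp
  have hrowlin : ∀ i ∈ I, ∀ ω, ∑ k ∈ G i, c i k * X k ω = ∑ j ∈ J i, u j * H ω i j := by
    intro i hi ω
    simp only [hG]
    rw [Finset.sum_image]
    · refine Finset.sum_congr rfl fun j hj => ?_
      rw [hcG i hi j hj, hXdef]
      simp only [hH.apply_sortedPair]
    · intro j _ j' _ h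
      rcases sortedPair_eq_iff.1 h with h | h
      · exact h.2
      · exact h.2.trans h.1
  have hmain := lintegral_prod_linear_le hX hH.indep c d G hf (q := ENNReal.ofReal q) I
    (by
      intro i hi i' hi' hne k hk
      simp only [hG, Finset.mem_image] at hk
      obtain ⟨j, hj, rfl⟩ := hk
      simp only [hc]
      refine Finset.sum_eq_zero fun j' _ => ?_
      rw [if_neg]
      rw [sortedPair_eq_iff]
      rintro (h | h)
      · exact hne h.1
      · exact hIJ i hi j hj (h.1 ▸ hi'))
    (by
      intro i hi x
      simp_rw [hrowlin i hi]
      have hSm : Measurable fun ω => ∑ j ∈ J i, u j * H ω i j :=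
        Finset.measurable_sum _ fun j _ => (hH.measurable i j).const_mul _
      have hr : 0 < κ * W / T := by positivity
      have hb : 0 ≤ c₀ / (4 * W) * m := by positivity
      have := integral_exp_neg_sq_le_of_charFun_le hSm x hv0 hb hr (fun g hg =>
        (hH.norm_charFun_row_le hW hδ hκ1 hκ2 u i (J i) (hdist i hi) hT (hu i hi) hg).trans
          (Real.exp_le_exp.2 (by
            rw [neg_mul, neg_mul, neg_le_neg_iff]
            gcongr
            exact hmass i hi)))
      simp only [hfdef]
      rw [← ofReal_integral_eq_lintegral_ofReal]
      · refine ENNReal.ofReal_le_ofReal (this.trans (le_of_eq ?_))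
        rw [hq, hvv]
        congr 1
        · congr 3; field_simp; ring
        · field_simp
      · refine Integrable.of_bound (C := 1) ?_ (ae_of_all _ fun ω => ?_)
        · have : Measurable fun ω =>
            Real.exp (-(v / 2) * (∑ j ∈ J i, u j * H ω i j + x) ^ 2) := by fun_prop
          exact this.aestronglyMeasurable
        · rw [Real.norm_of_nonneg (Real.exp_pos _).le, Real.exp_le_one_iff, neg_mul]
          exact neg_nonpos.2 (by positivity)
      · exact ae_of_all _ fun ω => (Real.exp_pos _).le)
  simp_rw [hlin] at hmain
  have hmeas : Measurable fun ω => ∏ i ∈ I, f (∑ j, H ω i j * u j + d i) := by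
    refine Finset.measurable_prod _ fun i _ => hf.comp ?_
    exact (Finset.measurable_sum _ fun j _ => (hH.measurable i j).mul_const _).add_const _
  set ε : ENNReal := ENNReal.ofReal (Real.exp (-(W * ρ / (2 * s ^ 2)))) with hε
  have hε0 : ε ≠ 0 := by rw [hε, Ne, ENNReal.ofReal_eq_zero, not_le]; positivity
  have hmk := meas_ge_le_lintegral_div hmeas.aemeasurable (μ := P) hε0 ENNReal.ofReal_ne_top
  have hsub : {ω | ∑ i ∈ I, (∑ j, H ω i j * u j + d i) ^ 2 ≤ ρ} ⊆
      {ω | ε ≤ ∏ i ∈ I, f (∑ j, H ω i j * u j + d i)} := by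
    intro ω hω
    simp only [Set.mem_ofPred_eq] at hω ⊢
    simp only [hfdef]
    rw [← ENNReal.ofReal_prod_of_nonneg fun i _ => (Real.exp_pos _).le, ← Real.exp_sum, hε]
    refine ENNReal.ofReal_le_ofReal (Real.exp_le_exp.2 ?_)
    rw [← Finset.mul_sum, neg_mul, neg_le_neg_iff, hvv]
    calc W / s ^ 2 / 2 * ∑ i ∈ I, (∑ j, H ω i j * u j + d i) ^ 2 ≤ W / s ^ 2 / 2 * ρ := by gcongr
      _ = W * ρ / (2 * s ^ 2) := by field_simp
  refine (measure_mono hsub).trans (hmk.trans ?_)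
  refine (ENNReal.div_le_div_right hmain _).trans (le_of_eq ?_)
  rw [hε, ← ENNReal.ofReal_pow hq0, ← ENNReal.ofReal_div_of_pos (Real.exp_pos _), Real.exp_neg,
    div_inv_eq_mul, mul_comm]

end

/-! ### Lattice nets -/

open Classical in
/-- The integer vectors in the Euclidean ball of squared radius `R`. -/
noncomputable def latticeBall (ι : Type*) [Fintype ι] (R : ℝ) : Finset (ι → ℤ) :=
  (Fintype.piFinset fun _ => Finset.Icc (-⌈R⌉) ⌈R⌉).filter fun k => ∑ i, (k i : ℝ) ^ 2 ≤ R

lemma mem_latticeBall {ι : Type*} [Fintype ι] {R : ℝ} {k : ι → ℤ} :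
    k ∈ latticeBall ι R ↔ ∑ i, (k i : ℝ) ^ 2 ≤ R := by
  classical
  simp only [latticeBall, Finset.mem_filter, Fintype.mem_piFinset, Finset.mem_Icc,
    and_iff_right_iff_imp]
  intro h i
  have h1 : (k i : ℝ) ^ 2 ≤ R :=
    (Finset.single_le_sum (f := fun i => (k i : ℝ) ^ 2) (fun _ _ => sq_nonneg _)
      (Finset.mem_univ i)).trans h
  have h2 : (((k i) ^ 2 : ℤ) : ℝ) ≤ (⌈R⌉ : ℤ) := by push_cast; exact h1.trans (Int.le_ceil R)
  have h3 : (k i) ^ 2 ≤ ⌈R⌉ := by exact_mod_cast h2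
  have h4 := Int.natAbs_le_self_sq (k i)
  omega

lemma card_latticeBall_le {ι : Type*} [Fintype ι] {t z R n₀ : ℝ} (ht : 0 < t) (hz : 0 < z)
    (hz1 : z ≤ 1) (S : Finset (ι → ℤ)) (hS : S ⊆ latticeBall ι R)
    (hsupp : ∀ k ∈ S, ((Finset.univ.filter fun i => k i ≠ 0).card : ℝ) ≤ n₀) :
    (S.card : ℝ) ≤ z ^ (-n₀) * Real.exp (t * √(n₀ * R)) * (1 + 2 * z / t) ^ Fintype.card ι := by
  classical
  refine card_lattice_le ht hz hz1 n₀ _ S hsupp fun k hk => ?_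
  refine Real.le_sqrt_of_sq_le ?_
  have e : ∑ i, |(k i : ℝ)| = ∑ i ∈ Finset.univ.filter fun i => k i ≠ 0, |(k i : ℝ)| := by
    rw [Finset.sum_filter]
    refine Finset.sum_congr rfl fun i _ => ?_
    by_cases h : k i = 0 <;> simp [h]
  have hball := mem_latticeBall.1 (hS hk)
  have hn₀ : 0 ≤ n₀ := (Nat.cast_nonneg _).trans (hsupp k hk)
  rw [e]
  refine sq_sum_le_card_mul_sum_sq.trans (mul_le_mul (hsupp k hk) ?_ ?_ hn₀)
  · refine le_trans ?_ hball
    simp_rw [sq_abs]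
    exact Finset.sum_le_sum_of_subset_of_nonneg (Finset.subset_univ _) fun _ _ _ => sq_nonneg _
  · exact Finset.sum_nonneg fun _ _ => sq_nonneg _

/-- Rounding each coordinate towards zero to a multiple of `t / √w`. -/
lemma exists_lattice_approx {ι : Type*} [Fintype ι] {t w : ℝ} (ht : 0 < t) (hw : 0 < w)
    (u : ι → ℝ) (hu : ∑ i, u i ^ 2 ≤ 1) :
    ∃ k ∈ latticeBall ι (w / t ^ 2), (∀ i, |u i - t / √w * k i| ≤ t / √w) ∧
      (∀ i, |t / √w * k i| ≤ |u i|) ∧ ∑ i, (u i - t / √w * k i) ^ 2 ≤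
        Fintype.card ι * (t ^ 2 / w) := by
  have hh : 0 < t / √w := by positivity
  choose k hk1 hk2 using fun i => exists_int_trunc hh (u i)
  have hsq : (t / √w) ^ 2 = t ^ 2 / w := by rw [div_pow, Real.sq_sqrt hw.le]
  refine ⟨k, ?_, hk1, hk2, ?_⟩
  · rw [mem_latticeBall]
    have h1 : ∑ i, (t / √w * k i) ^ 2 ≤ 1 :=
      (Finset.sum_le_sum fun i _ => sq_le_sq.2 (hk2 i)).trans hu
    simp_rw [mul_pow, hsq] at h1
    rw [← Finset.mul_sum, div_mul_eq_mul_div, div_le_one hw] at h1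
    rw [le_div_iff₀ (by positivity)]; linarith
  · calc ∑ i, (u i - t / √w * k i) ^ 2 ≤ ∑ _i : ι, t ^ 2 / w := by
          refine Finset.sum_le_sum fun i _ => ?_
          rw [← hsq]
          exact sq_le_sq.2 ((hk1 i).trans (le_abs_self _))
      _ = _ := by simp

/-! ### The operator norm -/

lemma opNorm_le_of_net {E : Type*} [NormedAddCommGroup E] [InnerProductSpace ℝ E] (T : E →L[ℝ] E)
    (S : Set E) (hS : ∀ x : E, ‖x‖ ≤ 1 → ∃ x' ∈ S, ‖x'‖ ≤ 1 ∧ ‖x - x'‖ ≤ 1 / 4) {R : ℝ}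
    (hR : 0 ≤ R) (h : ∀ x ∈ S, ∀ y ∈ S, inner ℝ y (T x) ≤ R) : ‖T‖ ≤ 2 * R := by
  have key : ∀ x y : E, ‖x‖ ≤ 1 → ‖y‖ ≤ 1 → inner ℝ y (T x) ≤ R + ‖T‖ / 2 := by
    intro x y hx hy
    obtain ⟨x', hx'S, hx', hxx'⟩ := hS x hx
    obtain ⟨y', hy'S, hy', hyy'⟩ := hS y hy
    have e : inner ℝ y (T x) = inner ℝ y' (T x') + inner ℝ (y - y') (T x') +
        inner ℝ y (T (x - x')) := by
      simp only [inner_sub_left, map_sub, inner_sub_right]; ring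
    have h1 : inner ℝ (y - y') (T x') ≤ 1 / 4 * ‖T‖ := by
      refine (real_inner_le_norm _ _).trans ?_
      have : ‖T x'‖ ≤ ‖T‖ := (T.le_opNorm x').trans (mul_le_of_le_one_right (norm_nonneg _) hx')
      exact mul_le_mul hyy' this (norm_nonneg _) (by norm_num)
    have h2 : inner ℝ y (T (x - x')) ≤ 1 * (‖T‖ * (1 / 4)) := by
      refine (real_inner_le_norm _ _).trans ?_
      have : ‖T (x - x')‖ ≤ ‖T‖ * (1 / 4) :=
        (T.le_opNorm _).trans (mul_le_mul_of_nonneg_left hxx' (norm_nonneg _))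
      exact mul_le_mul hy this (norm_nonneg _) (by norm_num)
    linarith [h x' hx'S y' hy'S]
  have : ‖T‖ ≤ R + ‖T‖ / 2 := by
    refine T.opNorm_le_of_unit_norm (by positivity) fun x hx => ?_
    rcases eq_or_ne (T x) 0 with h0 | h0
    · rw [h0, norm_zero]; positivity
    · have hpos : 0 < ‖T x‖ := norm_pos_iff.2 h0
      have := key x (‖T x‖⁻¹ • T x) hx.le (by
        rw [norm_smul, norm_inv, norm_norm, inv_mul_cancel₀ hpos.ne'])
      rwa [real_inner_smul_left, real_inner_self_eq_norm_sq, sq, ← mul_assoc,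
        inv_mul_cancel₀ hpos.ne', one_mul] at this
  linarith

lemma sum_sq_mulVec_le_of_lattice {ι : Type*} [Fintype ι] [DecidableEq ι] (M : Matrix ι ι ℝ)
    {t w R : ℝ} (ht : 0 < t) (hw : 0 < w) (hcard : Fintype.card ι * (t ^ 2 / w) ≤ 1 / 16)
    (hR : 0 ≤ R)
    (h : ∀ k ∈ latticeBall ι (w / t ^ 2), ∀ l ∈ latticeBall ι (w / t ^ 2),
      ∑ i, ∑ j, (t / √w * l i) * M i j * (t / √w * k j) ≤ R) (x : ι → ℝ) :
    ∑ i, (∑ j, M i j * x j) ^ 2 ≤ (2 * R) ^ 2 * ∑ i, x i ^ 2 := by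
  set T : EuclideanSpace ℝ ι →L[ℝ] EuclideanSpace ℝ ι :=
    LinearMap.toContinuousLinearMap (Matrix.toEuclideanLin M) with hT
  have hTx : ∀ (y : EuclideanSpace ℝ ι) i, T y i = ∑ j, M i j * y j := by
    intro y i
    simp [hT, Matrix.toLpLin_apply, Matrix.mulVec, dotProduct]
  set S : Set (EuclideanSpace ℝ ι) := {y | ∃ k ∈ latticeBall ι (w / t ^ 2),
    y = WithLp.toLp 2 fun i => t / √w * k i} with hSdef
  have hnorm : ‖T‖ ≤ 2 * R := by
    refine opNorm_le_of_net T S ?_ hR ?_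
    · intro y hy
      have hy2 : ∑ i, y i ^ 2 ≤ 1 := by
        rw [← EuclideanSpace.real_norm_sq_eq]
        exact pow_le_one₀ (norm_nonneg _) hy
      obtain ⟨k, hk, -, hk2, hk3⟩ := exists_lattice_approx ht hw (fun i => y i) hy2
      refine ⟨_, ⟨k, hk, rfl⟩, ?_, ?_⟩
      · refine (sq_le_one_iff₀ (norm_nonneg _)).1 ?_
        rw [EuclideanSpace.real_norm_sq_eq]
        exact (Finset.sum_le_sum fun i _ => sq_le_sq.2 (hk2 i)).trans hy2
      · refine (sq_le_sq₀ (norm_nonneg _) (by norm_num)).1 ?_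
        rw [EuclideanSpace.real_norm_sq_eq]
        exact hk3.trans (hcard.trans (by norm_num))
    · rintro _ ⟨k, hk, rfl⟩ _ ⟨l, hl, rfl⟩
      refine le_trans (le_of_eq ?_) (h k hk l hl)
      rw [PiLp.inner_apply]
      refine Finset.sum_congr rfl fun i _ => ?_
      rw [hTx]
      simp only [RCLike.inner_apply, conj_trivial, Finset.sum_mul]
      exact Finset.sum_congr rfl fun j _ => by ring
  have := (T.le_opNorm (WithLp.toLp 2 x)).trans (mul_le_mul_of_nonneg_right hnorm (norm_nonneg _))
  have := pow_le_pow_left₀ (norm_nonneg _) this 2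
  rw [mul_pow, EuclideanSpace.real_norm_sq_eq, EuclideanSpace.real_norm_sq_eq] at this
  simpa [hTx] using this

lemma exp_le_add_exp_sq (x : ℝ) : Real.exp x ≤ x + Real.exp (x ^ 2) := by
  have h1 := Real.add_one_le_exp (x ^ 2)
  rcases le_or_gt |x| 1 with h | h
  · have := (abs_le.1 (Real.abs_exp_sub_one_sub_id_le h)).2
    linarith
  · rcases lt_abs.1 h with h | h
    · have : Real.exp x ≤ Real.exp (x ^ 2) := Real.exp_le_exp.2 (by nlinarith)
      linarith
    · have : Real.exp x ≤ 1 := Real.exp_le_one_iff.2 (by linarith)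
      nlinarith

lemma hasSubgaussianMGF_of_integral_exp_sq_le {Ω : Type*} [MeasurableSpace Ω] {P : Measure Ω}
    [IsProbabilityMeasure P] {X : Ω → ℝ} (hX : Measurable X) (h0 : ∫ ω, X ω ∂P = 0)
    {a K : ℝ} (ha : 0 < a) (hint : Integrable (fun ω => Real.exp (a * X ω ^ 2)) P)
    (hK : ∫ ω, Real.exp (a * X ω ^ 2) ∂P ≤ K) :
    HasSubgaussianMGF X (2 * K / a).toNNReal P := by
  have hK1 : 1 ≤ K := by
    refine le_trans ?_ hK
    have := integral_mono (integrable_const (1 : ℝ)) hint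
      (fun ω => Real.one_le_exp (by positivity))
    simpa using this
  have hamgm : ∀ θ ω, θ * X ω ≤ θ ^ 2 / a / 2 + a * X ω ^ 2 := by
    intro θ ω
    have h1 : θ ^ 2 / a / 2 + a * X ω ^ 2 - θ * X ω =
        ((θ - a * X ω) ^ 2 + (a * X ω) ^ 2) / (2 * a) := by field_simp; ring
    have h2 : 0 ≤ ((θ - a * X ω) ^ 2 + (a * X ω) ^ 2) / (2 * a) := by positivity
    linarith
  have hptw : ∀ θ ω, Real.exp (θ * X ω) ≤
      Real.exp (θ ^ 2 / a / 2) * Real.exp (a * X ω ^ 2) := by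
    intro θ ω
    rw [← Real.exp_add]; exact Real.exp_le_exp.2 (hamgm θ ω)
  have hexpint : ∀ θ, Integrable (fun ω => Real.exp (θ * X ω)) P := fun θ =>
    (hint.const_mul _).mono' (by fun_prop) (ae_of_all _ fun ω => by
      rw [Real.norm_of_nonneg (Real.exp_pos _).le]; exact hptw θ ω)
  have hX1 : Integrable X P := by
    refine (hint.const_mul (1 / a + 1)).mono' hX.aestronglyMeasurable (ae_of_all _ fun ω => ?_)
    have h1 := Real.add_one_le_exp (a * X ω ^ 2)
    have h2 : |X ω| ≤ 1 + X ω ^ 2 := by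
      nlinarith [sq_nonneg (|X ω| - 1), sq_abs (X ω)]
    have h3 : X ω ^ 2 = 1 / a * (a * X ω ^ 2) := by field_simp
    have h4 : 1 / a * (a * X ω ^ 2) ≤ 1 / a * Real.exp (a * X ω ^ 2) := by gcongr; linarith
    have h5 : 1 ≤ Real.exp (a * X ω ^ 2) := Real.one_le_exp (by positivity)
    rw [Real.norm_eq_abs]; linarith
  refine ⟨hexpint, fun θ => ?_⟩
  rw [Real.coe_toNNReal _ (by positivity), mgf]
  set s := θ ^ 2 / a with hs
  have hs0 : 0 ≤ s := by positivity
  have e : 2 * K / a * θ ^ 2 / 2 = s * K := by rw [hs]; field_simp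
  rw [e]
  rcases le_or_gt s 1 with h | h
  · have hpt : ∀ ω, Real.exp (θ * X ω) ≤ θ * X ω + (1 - s + s * Real.exp (a * X ω ^ 2)) := by
      intro ω
      refine (exp_le_add_exp_sq _).trans (add_le_add le_rfl ?_)
      have hc := convexOn_exp.2 (Set.mem_univ 0) (Set.mem_univ (a * X ω ^ 2))
        (by linarith : 0 ≤ 1 - s) hs0 (by ring)
      simp only [smul_eq_mul, mul_zero, zero_add, Real.exp_zero, mul_one] at hc
      rwa [show s * (a * X ω ^ 2) = (θ * X ω) ^ 2 by rw [hs]; field_simp] at hc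
    have hint2 : Integrable (fun ω => 1 - s + s * Real.exp (a * X ω ^ 2)) P :=
      (integrable_const _).add (hint.const_mul _)
    have := integral_mono (hexpint θ) ((hX1.const_mul θ).add hint2) hpt
    simp only [Pi.add_apply] at this
    rw [integral_add (hX1.const_mul θ) hint2, integral_const_mul, h0, mul_zero, zero_add,
      integral_add (integrable_const _) (hint.const_mul _), integral_const_mul] at this
    simp only [integral_const, probReal_univ, one_smul] at this
    have h2 := mul_le_mul_of_nonneg_left hK hs0
    have h3 := Real.add_one_le_exp (s * K)
    linarith
  · have := integral_mono (hexpint θ) (hint.const_mul _) (hptw θ)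
    rw [integral_const_mul] at this
    have h2 : K ≤ Real.exp (K - 1) := by linarith [Real.add_one_le_exp (K - 1)]
    refine this.trans ((mul_le_mul_of_nonneg_left (hK.trans h2) (Real.exp_pos _).le).trans ?_)
    rw [← Real.exp_add]
    exact Real.exp_le_exp.2 (by nlinarith)

lemma _root_.ProbabilityTheory.HasSubgaussianMGF.mono {Ω : Type*} [MeasurableSpace Ω]
    {P : Measure Ω} {X : Ω → ℝ} {c c' : NNReal} (h : HasSubgaussianMGF X c P) (hc : c ≤ c') :
    HasSubgaussianMGF X c' P :=
  ⟨h.integrable_exp_mul, fun t => (h.mgf_le t).trans (Real.exp_le_exp.2 (by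
    have : (c : ℝ) ≤ c' := hc
    gcongr))⟩

section

variable {Ω : Type*} [MeasurableSpace Ω] {P : Measure Ω} [IsProbabilityMeasure P] {p W : ℕ}
  {c₀ C₀ δ K : ℝ} {H : Ω → Matrix (Fin (2 * p * W)) (Fin (2 * p * W)) ℝ}

lemma IsBandMatrix.measure_bilinear_ge_le (hH : IsBandMatrix P p W c₀ C₀ δ K H) (hW : 0 < W)
    (hδ : 0 < δ) (hK : 0 ≤ K) {x y : Fin (2 * p * W) → ℝ} (hx : ∑ i, x i ^ 2 ≤ 1)
    (hy : ∑ i, y i ^ 2 ≤ 1) {R : ℝ} (hR : 0 ≤ R) :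
    P {ω | R ≤ ∑ i, ∑ j, y i * H ω i j * x j} ≤
      ENNReal.ofReal (Real.exp (-(R ^ 2 * δ * W / (8 * K)))) := by
  have hW' : (0 : ℝ) < W := by exact_mod_cast hW
  set a : {x : Fin (2 * p * W) × Fin (2 * p * W) // x.1 ≤ x.2} → ℝ :=
    fun k => ∑ i, ∑ j, if sortedPair i j = k then y i * x j else 0 with ha
  have hlin : ∀ ω, ∑ k, a k * H ω k.1.1 k.1.2 = ∑ i, ∑ j, y i * H ω i j * x j := by
    intro ω
    simp only [ha, Finset.sum_mul]
    rw [Finset.sum_comm]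
    refine Finset.sum_congr rfl fun i _ => ?_
    rw [Finset.sum_comm]
    refine Finset.sum_congr rfl fun j _ => ?_
    simp only [ite_mul, zero_mul, Finset.sum_ite_eq, Finset.mem_univ, if_true,
      hH.apply_sortedPair]
    ring
  have hasq : ∀ k, a k ^ 2 ≤ 2 * ∑ i, ∑ j, if sortedPair i j = k then y i ^ 2 * x j ^ 2 else 0 := by
    rintro ⟨⟨i₀, j₀⟩, hij⟩
    -- at most the two pairs `(i₀, j₀)` and `(j₀, i₀)` contribute
    have hs : ∀ i j, sortedPair i j = ⟨(i₀, j₀), hij⟩ ↔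
        (i, j) ∈ ({(i₀, j₀), (j₀, i₀)} : Finset _) := by
      intro i j
      have : (⟨(i₀, j₀), hij⟩ : {x : Fin (2 * p * W) × Fin (2 * p * W) // x.1 ≤ x.2}) =
          sortedPair i₀ j₀ := by
        have : i₀ ≤ j₀ := hij
        simp [sortedPair, this]
      rw [this, sortedPair_eq_iff]
      simp
    have e : ∀ F : Fin (2 * p * W) → Fin (2 * p * W) → ℝ,
        (∑ i, ∑ j, if sortedPair i j = ⟨(i₀, j₀), hij⟩ then F i j else 0) =
        ∑ q ∈ ({(i₀, j₀), (j₀, i₀)} : Finset _), F q.1 q.2 := by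
      intro F
      rw [← Finset.sum_product', Finset.univ_product_univ]
      simp_rw [hs]
      rw [← Finset.sum_filter]
      refine Finset.sum_congr ?_ fun _ _ => rfl
      ext q; simp
    simp only [ha]
    rw [e, e fun i j => y i ^ 2 * x j ^ 2]
    refine sq_sum_le_card_mul_sum_sq.trans ?_
    simp_rw [mul_pow]
    refine mul_le_mul_of_nonneg_right ?_ (Finset.sum_nonneg fun _ _ => by positivity)
    exact_mod_cast Finset.card_le_two
  have hasum : ∑ k, a k ^ 2 ≤ 2 := by
    calc ∑ k, a k ^ 2
        ≤ ∑ k, 2 * ∑ i, ∑ j, (if sortedPair i j = k then y i ^ 2 * x j ^ 2 else 0) :=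
          Finset.sum_le_sum fun k _ => hasq k
      _ = 2 * ((∑ i, y i ^ 2) * ∑ j, x j ^ 2) := by
          rw [← Finset.mul_sum, Finset.sum_comm, Finset.sum_mul_sum]
          congr 1
          refine Finset.sum_congr rfl fun i _ => ?_
          rw [Finset.sum_comm]
          refine Finset.sum_congr rfl fun j _ => ?_
          simp
      _ ≤ 2 * (1 * 1) := by
          gcongr
      _ = 2 := by norm_num
  have hsub := HasSubgaussianMGF.sum_of_iIndepFun
    (X := fun (k : {x : Fin (2 * p * W) × Fin (2 * p * W) // x.1 ≤ x.2}) ω =>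
      a k * H ω k.1.1 k.1.2)
    (hH.indep.comp (fun k z => a k * z) (fun k => measurable_const_mul _)) (s := Finset.univ)
    fun k _ => (hasSubgaussianMGF_of_integral_exp_sq_le (hH.measurable _ _)
      (hH.centered k.1.1 k.1.2) (mul_pos hδ hW') (hH.subgaussian _ _).1
      (hH.subgaussian _ _).2).const_mul (a k)
  have hB : HasSubgaussianMGF (fun ω => ∑ i, ∑ j, y i * H ω i j * x j)
      (4 * K / (δ * W)).toNNReal P := by
    simp_rw [hlin] at hsub
    refine hsub.mono ?_
    rw [← NNReal.coe_le_coe, Real.coe_toNNReal _ (by positivity)]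
    rw [NNReal.coe_sum]
    have e : ∀ k, a k ^ 2 * ((2 * K / (δ * W)).toNNReal : ℝ) = a k ^ 2 * (2 * K / (δ * W)) :=
      fun k => by rw [Real.coe_toNNReal _ (by positivity)]
    refine (Finset.sum_congr rfl fun k _ => e k).trans_le ?_
    rw [← Finset.sum_mul]
    calc (∑ k, a k ^ 2) * (2 * K / (δ * W)) ≤ 2 * (2 * K / (δ * W)) := by gcongr
      _ = 4 * K / (δ * W) := by ring
  have := hB.measure_ge_le hR
  rw [Real.coe_toNNReal _ (by positivity)] at this
  rw [← ofReal_measureReal]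
  refine ENNReal.ofReal_le_ofReal (this.trans (le_of_eq ?_))
  congr 1
  rw [neg_div]
  congr 1
  rw [show 2 * (4 * K / (δ * W)) = 8 * K / (δ * W) by ring, div_div_eq_mul_div, mul_assoc]

/-- The property `E` of matrices has exponentially small probability in `W`, uniformly over all
random band matrices with the given parameters. -/
def ExpUnlikely.{v} (p : ℕ) (c₀ C₀ δ K : ℝ)
    (E : (W : ℕ) → Matrix (Fin (2 * p * W)) (Fin (2 * p * W)) ℝ → Prop) : Prop :=
  ∃ A c : ℝ, 0 ≤ A ∧ 0 < c ∧ ∃ W₀ : ℕ, ∀ W : ℕ, W₀ ≤ W → 0 < W →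
    ∀ (Ω : Type v) [MeasurableSpace Ω] (P : Measure Ω) [IsProbabilityMeasure P]
      (H : Ω → Matrix (Fin (2 * p * W)) (Fin (2 * p * W)) ℝ),
      IsBandMatrix P p W c₀ C₀ δ K H →
        P {ω | E W (H ω)} ≤ ENNReal.ofReal (A * Real.exp (-c * W))

lemma ExpUnlikely.mono.{v} {p : ℕ} {c₀ C₀ δ K : ℝ}
    {E E' : (W : ℕ) → Matrix (Fin (2 * p * W)) (Fin (2 * p * W)) ℝ → Prop}
    (h : ExpUnlikely.{v} p c₀ C₀ δ K E') (hE : ∀ W M, 0 < W → E W M → E' W M) :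
    ExpUnlikely.{v} p c₀ C₀ δ K E := by
  obtain ⟨A, c, hA, hc, W₀, h⟩ := h
  refine ⟨A, c, hA, hc, W₀, fun W hW₀ hW Ω _ P _ H hH => ?_⟩
  exact (measure_mono fun ω hω => hE W (H ω) hW hω).trans (h W hW₀ hW Ω P H hH)

lemma ExpUnlikely.or.{v} {p : ℕ} {c₀ C₀ δ K : ℝ}
    {E E' : (W : ℕ) → Matrix (Fin (2 * p * W)) (Fin (2 * p * W)) ℝ → Prop}
    (h : ExpUnlikely.{v} p c₀ C₀ δ K E) (h' : ExpUnlikely.{v} p c₀ C₀ δ K E') :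
    ExpUnlikely.{v} p c₀ C₀ δ K fun W M => E W M ∨ E' W M := by
  obtain ⟨A, c, hA, hc, W₀, h⟩ := h
  obtain ⟨A', c', hA', hc', W₀', h'⟩ := h'
  refine ⟨A + A', min c c', by positivity, lt_min hc hc', max W₀ W₀',
    fun W hW₀ hW Ω _ P _ H hH => ?_⟩
  refine (measure_union_le {ω | E W (H ω)} {ω | E' W (H ω)}).trans ?_
  refine (add_le_add (h W ((le_max_left _ _).trans hW₀) hW Ω P H hH)
    (h' W ((le_max_right _ _).trans hW₀) hW Ω P H hH)).trans ?_
  rw [← ENNReal.ofReal_add (by positivity) (by positivity), add_mul]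
  refine ENNReal.ofReal_le_ofReal ?_
  gcongr
  · exact min_le_left _ _
  · exact min_le_right _ _

/-- The operator norm of a band matrix is bounded with exponentially high probability. -/
lemma exists_opNorm_bound.{v} (p : ℕ) (hp : 1 ≤ p) (c₀ C₀ : ℝ) {δ : ℝ} (hδ : 0 < δ) (K : ℝ) :
    ∃ C₁ : ℝ, 0 < C₁ ∧ ExpUnlikely.{v} p c₀ C₀ δ K fun W M =>
      ¬ ∀ x : Fin (2 * p * W) → ℝ, ∑ i, (∑ j, M i j * x j) ^ 2 ≤ C₁ * ∑ i, x i ^ 2 := by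
  have hp' : (1 : ℝ) ≤ p := by exact_mod_cast hp
  set A : ℝ := 1 + 2 * (2 * p + 32 * p ^ 2) with hA
  set R : ℝ := √(8 * |K| * A / δ) with hR
  refine ⟨(2 * R) ^ 2 + 1, by positivity, 1, 1, zero_le_one, one_pos, 0, ?_⟩
  intro W _ hW Ω _ P _ H hH
  have hW' : (0 : ℝ) < W := by exact_mod_cast hW
  have hN : 0 < 2 * p * W := by positivity
  have hK : 0 < K := by
    have h := hH.subgaussian ⟨0, hN⟩ ⟨0, hN⟩
    have := integral_mono (integrable_const (1 : ℝ)) h.1 (fun ω => Real.one_le_exp (by positivity))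
    simp only [integral_const, probReal_univ, one_smul] at this
    linarith [h.2]
  set t : ℝ := 1 / (8 * p) with ht
  have ht0 : 0 < t := by positivity
  have hcardN : (Fintype.card (Fin (2 * p * W)) : ℝ) = 2 * p * W := by simp
  set B := latticeBall (Fin (2 * p * W)) ((W : ℝ) / t ^ 2) with hB
  have hBcard : (B.card : ℝ) ≤ Real.exp ((2 * p + 32 * p ^ 2) * W) := by
    have h := card_latticeBall_le (n₀ := 2 * p * W) ht0 one_pos le_rfl B subset_rfl (by
      intro k _
      rw [← hcardN]
      exact_mod_cast Finset.card_le_univ _)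
    rw [Real.one_rpow, one_mul] at h
    refine h.trans ?_
    have h1 : t * √(2 * p * W * (W / t ^ 2)) ≤ 2 * p * W := by
      have : √(2 * p * W * (W / t ^ 2)) ≤ 2 * p * W / t := by
        refine Real.sqrt_le_iff.2 ⟨by positivity, ?_⟩
        rw [div_pow (2 * (p : ℝ) * W) t, ← mul_div_assoc]
        refine (div_le_div_iff_of_pos_right (by positivity : 0 < t ^ 2)).2 ?_
        nlinarith [mul_pos hW' hW', mul_nonneg (by linarith : 0 ≤ (p : ℝ) - 1)
          (by positivity : 0 ≤ (p : ℝ) * (W * W))]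
      calc t * √(2 * p * W * (W / t ^ 2)) ≤ t * (2 * p * W / t) := by gcongr
        _ = 2 * p * W := by field_simp
    have h2 : (1 + 2 * 1 / t) ^ Fintype.card (Fin (2 * p * W)) ≤ Real.exp (32 * p ^ 2 * W) := by
      have : 1 + 2 * 1 / t ≤ Real.exp (16 * p) := by
        have h3 := Real.add_one_le_exp (16 * p : ℝ)
        have : 2 * 1 / t = 16 * p := by rw [ht]; field_simp; norm_num
        linarith
      refine (pow_le_pow_left₀ (by positivity) this _).trans (le_of_eq ?_)
      rw [← Real.exp_nat_mul, hcardN]; congr 1; ring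
    calc _ ≤ Real.exp (2 * p * W) * Real.exp (32 * p ^ 2 * W) := by
          refine mul_le_mul (Real.exp_le_exp.2 h1) h2 (by positivity) (Real.exp_pos _).le
      _ = _ := by rw [← Real.exp_add]; congr 1; ring
  have hRsq : R ^ 2 * δ * W / (8 * K) = A * W := by
    rw [hR, Real.sq_sqrt (by positivity), abs_of_pos hK]; field_simp
  have hBnorm : ∀ k ∈ B, ∑ i, (t / √W * k i) ^ 2 ≤ 1 := by
    intro k hk
    have := mem_latticeBall.1 hk
    simp_rw [mul_pow, div_pow, Real.sq_sqrt hW'.le]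
    rw [← Finset.mul_sum]
    calc t ^ 2 / W * ∑ i, (k i : ℝ) ^ 2 ≤ t ^ 2 / W * (W / t ^ 2) := by gcongr
      _ = 1 := by field_simp
  have hsub : {ω | ¬ ∀ x : Fin (2 * p * W) → ℝ,
      ∑ i, (∑ j, H ω i j * x j) ^ 2 ≤ ((2 * R) ^ 2 + 1) * ∑ i, x i ^ 2} ⊆
      ⋃ q ∈ B ×ˢ B, {ω | R ≤ ∑ i, ∑ j, (t / √W * q.2 i) * H ω i j * (t / √W * q.1 j)} := by
    intro ω hω
    by_contra hcon
    refine hω fun x => ?_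
    simp only [Set.mem_iUnion, not_exists, Set.mem_ofPred_eq, not_le] at hcon
    refine (sum_sq_mulVec_le_of_lattice (H ω) ht0 hW' ?_ (Real.sqrt_nonneg _)
      (fun k hk l hl => (hcon (k, l) (Finset.mem_product.2 ⟨hk, hl⟩)).le) x).trans ?_
    · rw [hcardN, ht]
      rw [show 2 * p * W * ((1 / (8 * p)) ^ 2 / W) = (1 / 32) * (1 / p : ℝ) by field_simp; norm_num]
      have : (1 / p : ℝ) ≤ 1 := by rw [div_le_one (by positivity)]; exact hp'
      linarith
    · refine mul_le_mul_of_nonneg_right (by linarith) (Finset.sum_nonneg fun _ _ => sq_nonneg _)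
  refine (measure_mono hsub).trans ((measure_biUnion_finset_le _ _).trans ?_)
  refine (Finset.sum_le_sum fun q hq => hH.measure_bilinear_ge_le hW hδ hK.le
    (hBnorm q.1 (Finset.mem_product.1 hq).1) (hBnorm q.2 (Finset.mem_product.1 hq).2)
    (Real.sqrt_nonneg _)).trans ?_
  rw [Finset.sum_const, nsmul_eq_mul, Finset.card_product, ← ENNReal.ofReal_natCast,
    ← ENNReal.ofReal_mul (by positivity), hRsq]
  refine ENNReal.ofReal_le_ofReal ?_
  push_cast
  calc (B.card : ℝ) * B.card * Real.exp (-(A * W))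
      ≤ Real.exp ((2 * p + 32 * p ^ 2) * W) * Real.exp ((2 * p + 32 * p ^ 2) * W) *
        Real.exp (-(A * W)) := by gcongr
    _ = 1 * Real.exp (-1 * W) := by
        rw [one_mul, ← Real.exp_add, ← Real.exp_add]; congr 1; rw [hA]; ring

end

/-! ### Blocks and levels -/

/-- The `b`-th block of `W` consecutive indices. -/
def block (N W b : ℕ) : Finset (Fin N) :=
  Finset.univ.filter fun i => (i : ℕ) / W = b

lemma mem_block {N W b : ℕ} {i : Fin N} : i ∈ block N W b ↔ (i : ℕ) / W = b := by
  simp [block]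

lemma block_lt {p W : ℕ} (i : Fin (2 * p * W)) : (i : ℕ) / W < 2 * p :=
  Nat.div_lt_of_lt_mul (i.2.trans_eq (mul_comm _ _))

lemma card_block {p W b : ℕ} (hW : 0 < W) (hb : b < 2 * p) :
    (block (2 * p * W) W b).card = W := by
  have hlt : ∀ r : Fin W, b * W + r < 2 * p * W := fun r => by
    have : (b + 1) * W ≤ 2 * p * W := Nat.mul_le_mul_right _ hb
    have := r.2
    nlinarith
  have : block (2 * p * W) W b =
      Finset.univ.image fun r : Fin W => (⟨b * W + r, hlt r⟩ : Fin (2 * p * W)) := by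
    ext i
    simp only [mem_block, Finset.mem_image, Finset.mem_univ, true_and]
    constructor
    · intro h
      refine ⟨⟨i % W, Nat.mod_lt _ hW⟩, Fin.ext ?_⟩
      simp only
      rw [← h, mul_comm, Nat.div_add_mod]
    · rintro ⟨r, rfl⟩
      simp only
      rw [mul_comm, Nat.mul_add_div hW, Nat.div_eq_of_lt r.2, add_zero]
  rw [this, Finset.card_image_of_injective, Finset.card_univ, Fintype.card_fin]
  intro r r' h
  simp only [Fin.mk.injEq, add_right_inj] at h
  exact Fin.ext h

lemma sum_eq_sum_blocks {p W : ℕ} (f : Fin (2 * p * W) → ℝ) :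
    ∑ i, f i = ∑ b ∈ Finset.range (2 * p), ∑ i ∈ block (2 * p * W) W b, f i := by
  rw [← Finset.sum_fiberwise_of_maps_to (s := Finset.univ) (t := Finset.range (2 * p))
    (g := fun i : Fin (2 * p * W) => (i : ℕ) / W) fun i _ => Finset.mem_range.2 (block_lt i)]
  rfl

lemma periodicDist_le {N : ℕ} (i j : Fin N) : periodicDist i j ≤ ((i : ℤ) - (j : ℤ)).natAbs :=
  min_le_left _ _

lemma periodicDist_lt_of_block {N W a b : ℕ} (hW : 0 < W) {i j : Fin N} (hi : i ∈ block N W a)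
    (hj : j ∈ block N W b) (h1 : a ≤ b) (h2 : b ≤ a + 1) : periodicDist i j < 2 * W := by
  refine (periodicDist_le i j).trans_lt ?_
  rw [mem_block] at hi hj
  have hi1 := Nat.div_mul_le_self (i : ℕ) W
  have hi2 := Nat.lt_div_mul_add (a := (i : ℕ)) hW
  have hj1 := Nat.div_mul_le_self (j : ℕ) W
  have hj2 := Nat.lt_div_mul_add (a := (j : ℕ)) hW
  rw [hi] at hi1 hi2
  rw [hj] at hj1 hj2
  have h3 : a * W ≤ b * W := Nat.mul_le_mul_right _ h1
  have h4 : b * W ≤ a * W + W := by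
    have := Nat.mul_le_mul_right W h2
    linarith
  omega

open Classical in
/-- The coordinates of `u` of size at least `t / √W`. -/
noncomputable def largeCoords {N : ℕ} (W : ℕ) (t : ℝ) (u : Fin N → ℝ) : Finset (Fin N) :=
  Finset.univ.filter fun j => t / √W ≤ |u j|

lemma mem_largeCoords {N W : ℕ} {t : ℝ} {u : Fin N → ℝ} {j : Fin N} :
    j ∈ largeCoords W t u ↔ t / √W ≤ |u j| := by
  simp [largeCoords]

lemma largeCoords_anti {N W : ℕ} {t t' : ℝ} (h : t' ≤ t) (u : Fin N → ℝ) :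
    largeCoords W t u ⊆ largeCoords W t' u := by
  intro j hj
  rw [mem_largeCoords] at hj ⊢
  exact le_trans (by gcongr) hj

open Classical in
/-- The blocks in which `u` is spread at level `t`: more than a proportion `η` of the coordinates
have size at least `t / √W`. -/
noncomputable def activeBlocks (p W : ℕ) (η t : ℝ) (u : Fin (2 * p * W) → ℝ) : Finset ℕ :=
  (Finset.range (2 * p)).filter fun b =>
    η * W < ((block (2 * p * W) W b ∩ largeCoords W t u).card : ℝ)

lemma mem_activeBlocks {p W : ℕ} {η t : ℝ} {u : Fin (2 * p * W) → ℝ} {b : ℕ} :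
    b ∈ activeBlocks p W η t u ↔
      b < 2 * p ∧ η * W < ((block (2 * p * W) W b ∩ largeCoords W t u).card : ℝ) := by
  simp [activeBlocks]

lemma activeBlocks_subset_range {p W : ℕ} {η t : ℝ} {u : Fin (2 * p * W) → ℝ} :
    activeBlocks p W η t u ⊆ Finset.range (2 * p) := by
  classical exact Finset.filter_subset _ _

lemma activeBlocks_anti {p W : ℕ} {η t t' : ℝ} (h : t' ≤ t) (u : Fin (2 * p * W) → ℝ) :
    activeBlocks p W η t u ⊆ activeBlocks p W η t' u := by
  intro b hb
  rw [mem_activeBlocks] at hb ⊢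
  refine ⟨hb.1, hb.2.trans_le ?_⟩
  exact_mod_cast Finset.card_le_card (Finset.inter_subset_inter_left (largeCoords_anti h u))

lemma card_largeCoords_le {p W : ℕ} (hW : 0 < W) {η t : ℝ} (hη : 0 ≤ η)
    (u : Fin (2 * p * W) → ℝ) :
    ((largeCoords W t u).card : ℝ) ≤ (activeBlocks p W η t u).card * W + 2 * p * (η * W) := by
  classical
  have e : (largeCoords W t u).card =
      ∑ b ∈ Finset.range (2 * p), (block (2 * p * W) W b ∩ largeCoords W t u).card := by
    rw [Finset.card_eq_sum_card_fiberwise (f := fun i : Fin (2 * p * W) => (i : ℕ) / W)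
      (t := Finset.range (2 * p)) fun i _ => by simpa using block_lt i]
    refine Finset.sum_congr rfl fun b _ => ?_
    congr 1
    ext i
    simp [mem_block, and_comm]
  have h : ∀ b ∈ Finset.range (2 * p),
      ((block (2 * p * W) W b ∩ largeCoords W t u).card : ℝ) ≤
        (if b ∈ activeBlocks p W η t u then (W : ℝ) else 0) + η * W := by
    intro b hb
    split_ifs with hact
    · have h1 : (block (2 * p * W) W b ∩ largeCoords W t u).card ≤ W :=
        (Finset.card_le_card Finset.inter_subset_left).trans
          (card_block hW (Finset.mem_range.1 hb)).le
      have h2 : ((block (2 * p * W) W b ∩ largeCoords W t u).card : ℝ) ≤ W := by exact_mod_cast h1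
      have : 0 ≤ η * W := by positivity
      linarith
    · rw [mem_activeBlocks, not_and, not_lt] at hact
      rw [zero_add]
      exact hact (Finset.mem_range.1 hb)
  rw [e]
  push_cast
  refine (Finset.sum_le_sum h).trans (le_of_eq ?_)
  rw [Finset.sum_add_distrib, ← Finset.sum_filter, Finset.filter_mem_eq_inter,
    Finset.inter_eq_right.2 activeBlocks_subset_range]
  simp

/-- `u` is a unit vector vanishing on the first `k` blocks, and `(M - e) u` is of norm at most `ρ`
on all rows except those of the first `k - 1` blocks. The operator norm of `M` and the number `e`
are bounded in terms of `C₁`. -/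
structure ApproxKernel {N : ℕ} (W k : ℕ) (C₁ ρ : ℝ) (M : Matrix (Fin N) (Fin N) ℝ) (e : ℝ)
    (u : Fin N → ℝ) : Prop where
  opNorm : ∀ x : Fin N → ℝ, ∑ i, (∑ j, M i j * x j) ^ 2 ≤ C₁ * ∑ i, x i ^ 2
  unit : ∑ i, u i ^ 2 = 1
  support : ∀ j : Fin N, (j : ℕ) / W < k → u j = 0
  bound : e ^ 2 ≤ 2 * C₁ + 2
  residual : ∑ i ∈ Finset.univ.filter (fun i : Fin N => k ≤ (i : ℕ) / W + 1),
    (∑ j, M i j * u j + -e * u i) ^ 2 ≤ ρ ^ 2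

lemma ApproxKernel.mono {N W k : ℕ} {C₁ ρ ρ' : ℝ} {M : Matrix (Fin N) (Fin N) ℝ} {e : ℝ}
    {u : Fin N → ℝ} (h : ApproxKernel W k C₁ ρ M e u) (hρ : 0 ≤ ρ) (hρρ' : ρ ≤ ρ') :
    ApproxKernel W k C₁ ρ' M e u :=
  ⟨h.opNorm, h.unit, h.support, h.bound, h.residual.trans (by gcongr)⟩

/-- Passing from an approximate eigenvector to the lattice of mesh `t / √W`, and from the
approximate eigenvalue to the lattice of mesh `t`, costs an error of order `t`. -/
lemma ApproxKernel.exists_lattice {p W k : ℕ} (hW : 0 < W) {C₁ t : ℝ} (hC₁ : 0 ≤ C₁) (ht : 0 < t)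
    {M : Matrix (Fin (2 * p * W)) (Fin (2 * p * W)) ℝ} {e : ℝ} {u : Fin (2 * p * W) → ℝ}
    (h : ApproxKernel W k C₁ t M e u) :
    ∃ l ∈ Finset.Icc (-⌈(2 * C₁ + 3) / t⌉) ⌈(2 * C₁ + 3) / t⌉,
      ∃ z ∈ latticeBall (Fin (2 * p * W)) ((W : ℝ) / t ^ 2),
        (∀ i, |u i - t / √W * z i| ≤ t / √W) ∧ (∀ i, |t / √W * z i| ≤ |u i|) ∧
        ∑ i, (u i - t / √W * z i) ^ 2 ≤ 2 * p * t ^ 2 ∧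
        ∑ i ∈ Finset.univ.filter (fun i : Fin (2 * p * W) => k ≤ (i : ℕ) / W + 1),
          (∑ j, M i j * (t / √W * z j) + -(t * l) * (t / √W * z i)) ^ 2 ≤
          (8 + 8 * p * (3 * C₁ + 2)) * t ^ 2 := by
  have hW' : (0 : ℝ) < W := by exact_mod_cast hW
  obtain ⟨l, hl1, hl2⟩ := exists_int_trunc ht e
  obtain ⟨z, hz, hz1, hz2, hz3⟩ := exists_lattice_approx ht hW' u h.unit.le
  have hz3' : ∑ i, (u i - t / √W * z i) ^ 2 ≤ 2 * p * t ^ 2 := by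
    refine hz3.trans (le_of_eq ?_)
    simp only [Fintype.card_fin]
    push_cast
    field_simp
  refine ⟨l, ?_, z, hz, hz1, hz2, hz3', ?_⟩
  · have he : |e| ≤ 2 * C₁ + 3 := by
      have := h.bound
      rw [← sq_abs] at this
      nlinarith [abs_nonneg e]
    have h1 : |(l : ℝ)| ≤ (2 * C₁ + 3) / t := by
      rw [le_div_iff₀ ht, mul_comm, ← abs_of_pos ht, ← abs_mul]
      exact hl2.trans he
    have h2 := abs_le.1 (h1.trans (Int.le_ceil _))
    rw [Finset.mem_Icc]
    exact ⟨by exact_mod_cast h2.1, by exact_mod_cast h2.2⟩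
  · set R := Finset.univ.filter (fun i : Fin (2 * p * W) => k ≤ (i : ℕ) / W + 1) with hR
    set d : Fin (2 * p * W) → ℝ := fun i => t / √W * z i - u i with hd
    have hdsq : ∑ i, d i ^ 2 ≤ 2 * p * t ^ 2 := by
      refine le_trans (le_of_eq (Finset.sum_congr rfl fun i _ => ?_)) hz3'
      simp only [hd]; ring
    have hpt : ∀ i, (∑ j, M i j * (t / √W * z j) + -(t * l) * (t / √W * z i)) ^ 2 ≤
        4 * ((∑ j, M i j * u j + -e * u i) ^ 2 + (∑ j, M i j * d j) ^ 2 +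
          (2 * C₁ + 2) * d i ^ 2 + t ^ 2 * u i ^ 2) := by
      intro i
      have e1 : ∑ j, M i j * (t / √W * z j) = ∑ j, M i j * u j + ∑ j, M i j * d j := by
        rw [← Finset.sum_add_distrib]
        refine Finset.sum_congr rfl fun j _ => ?_
        simp only [hd]; ring
      have e2 : t / √W * z i = u i + d i := by simp only [hd]; ring
      rw [e1, e2]
      have e3 : ∑ j, M i j * u j + ∑ j, M i j * d j + -(t * l) * (u i + d i) =
          (∑ j, M i j * u j + -e * u i) + ∑ j, M i j * d j + (-(t * l) * d i) +
            (e - t * l) * u i := by ring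
      rw [e3]
      have h1 : (-(t * l) * d i) ^ 2 ≤ (2 * C₁ + 2) * d i ^ 2 := by
        rw [mul_pow, neg_sq]
        exact mul_le_mul_of_nonneg_right ((sq_le_sq.2 hl2).trans h.bound) (sq_nonneg _)
      have h2 : ((e - t * l) * u i) ^ 2 ≤ t ^ 2 * u i ^ 2 := by
        rw [mul_pow]
        exact mul_le_mul_of_nonneg_right (sq_le_sq.2 (hl1.trans (le_abs_self _))) (sq_nonneg _)
      have h3 : ∀ a b c d : ℝ, (a + b + c + d) ^ 2 ≤ 4 * (a ^ 2 + b ^ 2 + c ^ 2 + d ^ 2) := by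
        intro a b c d
        nlinarith [sq_nonneg (a - b), sq_nonneg (a - c), sq_nonneg (a - d), sq_nonneg (b - c),
          sq_nonneg (b - d), sq_nonneg (c - d)]
      refine (h3 _ _ _ _).trans ?_
      linarith
    refine (Finset.sum_le_sum fun i _ => hpt i).trans ?_
    rw [← Finset.mul_sum]
    simp only [Finset.sum_add_distrib]
    have s1 := h.residual
    have hsub : ∀ f : Fin (2 * p * W) → ℝ, (∀ i, 0 ≤ f i) → ∑ i ∈ R, f i ≤ ∑ i, f i :=
      fun f hf => Finset.sum_le_sum_of_subset_of_nonneg (Finset.subset_univ _) fun i _ _ => hf i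
    have s2 : ∑ i ∈ R, (∑ j, M i j * d j) ^ 2 ≤ C₁ * (2 * p * t ^ 2) :=
      (hsub _ fun _ => sq_nonneg _).trans ((h.opNorm d).trans (by gcongr))
    have s3 : ∑ i ∈ R, (2 * C₁ + 2) * d i ^ 2 ≤ (2 * C₁ + 2) * (2 * p * t ^ 2) := by
      rw [← Finset.mul_sum]
      gcongr
      exact (hsub _ fun _ => sq_nonneg _).trans hdsq
    have s4 : ∑ i ∈ R, t ^ 2 * u i ^ 2 ≤ t ^ 2 * 1 := by
      rw [← Finset.mul_sum]
      gcongr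
      exact (hsub _ fun _ => sq_nonneg _).trans h.unit.le
    rw [← hR] at s1
    linarith

/-! ### Sparse vectors -/

lemma measure_biUnion_le_card_mul {Ω α : Type*} [MeasurableSpace Ω] {P : Measure Ω}
    (S : Finset α) (E : α → Set Ω) {B : ℝ} (h : ∀ a ∈ S, P (E a) ≤ ENNReal.ofReal B) :
    P (⋃ a ∈ S, E a) ≤ ENNReal.ofReal (S.card * B) := by
  refine (measure_biUnion_finset_le _ _).trans ((Finset.sum_le_sum h).trans (le_of_eq ?_))
  rw [Finset.sum_const, nsmul_eq_mul, ENNReal.ofReal_mul (by positivity), ENNReal.ofReal_natCast]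

lemma card_Icc_ceil_le {a : ℝ} (ha : 0 ≤ a) :
    ((Finset.Icc (-⌈a⌉) ⌈a⌉).card : ℝ) ≤ 2 * a + 3 := by
  have h0 : 0 ≤ ⌈a⌉ := Int.ceil_nonneg ha
  rw [Int.card_Icc]
  have : (((⌈a⌉ + 1 - -⌈a⌉).toNat : ℤ) : ℝ) = 2 * ⌈a⌉ + 1 := by
    rw [Int.toNat_of_nonneg (by omega)]; push_cast; ring
  have h2 : (((⌈a⌉ + 1 - -⌈a⌉).toNat : ℕ) : ℝ) = 2 * ⌈a⌉ + 1 := by exact_mod_cast this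
  rw [h2]
  linarith [Int.ceil_lt_add_one a]

lemma exists_charFun_radius {c₀ δ : ℝ} (hc₀ : 0 < c₀) (hδ : 0 < δ) (K : ℝ) :
    ∃ κ : ℝ, 0 < κ ∧ κ ^ 2 * K ≤ 2 * δ ∧ 48 * K * κ ≤ c₀ * (δ * √δ) := by
  have hK : 0 < |K| + 1 := by positivity
  set κ := min 1 (min (2 * δ / (|K| + 1)) (c₀ * (δ * √δ) / (48 * (|K| + 1)))) with hκ
  have h0 : 0 < κ := by positivity
  have h1 : κ ≤ 1 := min_le_left _ _
  have h2 : κ * (|K| + 1) ≤ 2 * δ := by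
    rw [← le_div_iff₀ hK]; exact (min_le_right _ _).trans (min_le_left _ _)
  have h3 : κ * (48 * (|K| + 1)) ≤ c₀ * (δ * √δ) := by
    rw [← le_div_iff₀ (by positivity)]; exact (min_le_right _ _).trans (min_le_right _ _)
  have h4 := le_abs_self K
  refine ⟨κ, h0, ?_, ?_⟩
  · calc κ ^ 2 * K ≤ κ ^ 2 * (|K| + 1) := by gcongr; linarith
      _ = κ * (κ * (|K| + 1)) := by ring
      _ ≤ 1 * (κ * (|K| + 1)) := by gcongr
      _ ≤ 2 * δ := by linarith
  · nlinarith

/-- The lattice points that occur as roundings at level `t` are supported on the large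
coordinates. -/
lemma mem_largeCoords_of_lattice {N W : ℕ} (hW : 0 < W) {t : ℝ} (ht : 0 < t) {u : Fin N → ℝ}
    {z : Fin N → ℤ} (hz : ∀ i, |t / √W * z i| ≤ |u i|) {i : Fin N} (hi : z i ≠ 0) :
    i ∈ largeCoords W t u := by
  have hW' : (0 : ℝ) < W := by exact_mod_cast hW
  rw [mem_largeCoords]
  refine le_trans ?_ (hz i)
  rw [abs_mul, abs_of_pos (by positivity)]
  refine le_mul_of_one_le_right (by positivity) ?_
  exact_mod_cast Int.one_le_abs hi

lemma inv_sqrt_one_add_le {x : ℝ} (h0 : 0 ≤ x) (h1 : x ≤ 1) : (√(1 + x))⁻¹ ≤ 1 - x / 4 := by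
  rw [inv_le_comm₀ (by positivity) (by linarith)]
  refine Real.le_sqrt_of_sq_le ?_
  rw [inv_pow, inv_le_comm₀ (by nlinarith) (by positivity), inv_eq_one_div,
    div_le_iff₀ (by positivity)]
  nlinarith [mul_nonneg h0 (sub_nonneg.2 h1), pow_nonneg h0 3]

/-- For a fixed vector with mass at least `1 / 4` supported away from the first `k` blocks, the
residual is small with exponentially small probability: some block carries mass `1 / (8 p)`, and the
rows of the preceding block see it. -/
lemma IsBandMatrix.measure_fixed_residual_le {Ω : Type*} [MeasurableSpace Ω] {P : Measure Ω}
    [IsProbabilityMeasure P] {p W k : ℕ} {c₀ C₀ δ K : ℝ}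
    {H : Ω → Matrix (Fin (2 * p * W)) (Fin (2 * p * W)) ℝ}
    (hH : IsBandMatrix P p W c₀ C₀ δ K H) (hp : 1 ≤ p) (hW : 0 < W) (hk : 1 ≤ k)
    (hδ : 0 < δ) (hc₀ : 0 < c₀) {κ : ℝ} (hκ : 0 < κ) (hκ1 : κ ^ 2 * K ≤ 2 * δ)
    (hκ2 : 48 * K * κ ≤ c₀ * (δ * √δ)) {v : Fin (2 * p * W) → ℝ} (hv1 : ∑ i, v i ^ 2 ≤ 1)
    (hv : 1 / 4 ≤ ∑ i, v i ^ 2) (hvk : ∀ j : Fin (2 * p * W), (j : ℕ) / W < k → v j = 0) (e : ℝ) {s x ρ : ℝ}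
    (hs : 0 < s) (hx : x = c₀ / (16 * p * s ^ 2)) (hx1 : x ≤ 1) (hsx : 64 / (κ ^ 4 * s ^ 4) ≤ x / 8)
    (hρ : ρ / (2 * s ^ 2) ≤ x / 16) :
    P {ω | ∑ i ∈ Finset.univ.filter (fun i : Fin (2 * p * W) => k ≤ (i : ℕ) / W + 1),
      (∑ j, H ω i j * v j + -e * v i) ^ 2 ≤ ρ} ≤ ENNReal.ofReal (Real.exp (-(x / 16) * W)) := by
  have hW' : (0 : ℝ) < W := by exact_mod_cast hW
  have hp' : (1 : ℝ) ≤ p := by exact_mod_cast hp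
  have hx0 : 0 ≤ x := by rw [hx]; positivity
  obtain ⟨b, hb, hbm⟩ : ∃ b ∈ Finset.range (2 * p),
      1 / (8 * p : ℝ) ≤ ∑ i ∈ block (2 * p * W) W b, v i ^ 2 := by
    by_contra hcon
    push Not at hcon
    have := Finset.sum_lt_sum_of_nonempty (s := Finset.range (2 * p))
      (Finset.nonempty_range_iff.2 (by omega)) hcon
    rw [← sum_eq_sum_blocks (fun i => v i ^ 2), Finset.sum_const, Finset.card_range, nsmul_eq_mul]
      at this
    have e1 : ((2 * p : ℕ) : ℝ) * (1 / (8 * p)) = 1 / 4 := by push_cast; field_simp; norm_num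
    rw [e1] at this
    linarith
  have hkb : k ≤ b := by
    by_contra hlt
    rw [Finset.sum_eq_zero] at hbm
    · have : 0 < 1 / (8 * p : ℝ) := by positivity
      linarith
    · intro i hi
      rw [hvk i (by rw [mem_block.1 hi]; omega)]; ring
  have hvle : ∀ j, |v j| ≤ √W / √W := by
    intro j
    rw [div_self (by positivity)]
    refine abs_le_one_iff_mul_self_le_one.2 ?_
    rw [← sq]
    exact (Finset.single_le_sum (f := fun i => v i ^ 2) (fun _ _ => sq_nonneg _)
      (Finset.mem_univ j)).trans hv1
  have hb2 : b < 2 * p := Finset.mem_range.1 hb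
  have hmain := hH.measure_residual_le hW hδ hc₀ hκ hκ1 hκ2 v (fun i => -e * v i)
    (block (2 * p * W) W (b - 1)) (fun _ => block (2 * p * W) W b)
    (by
      intro i _ j hj hj'
      rw [mem_block] at hj hj'
      omega)
    (fun i hi j hj => periodicDist_lt_of_block hW hi hj (by omega) (by omega))
    (T := √W) (m := 1 / (8 * p)) (s := s) (by positivity) hs (by positivity)
    (fun _ _ j _ => hvle j) (fun _ _ => hbm) ρ
  refine (measure_mono fun ω hω => ?_).trans (hmain.trans (ENNReal.ofReal_le_ofReal ?_))
  · rw [Set.mem_ofPred_eq] at hω ⊢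
    refine le_trans (Finset.sum_le_sum_of_subset_of_nonneg ?_ fun _ _ _ => sq_nonneg _) hω
    intro i hi
    rw [mem_block] at hi
    simp only [Finset.mem_filter, Finset.mem_univ, true_and]
    omega
  · rw [card_block hW (by omega)]
    have e1 : c₀ * (1 / (8 * p)) / (2 * s ^ 2) = x := by rw [hx]; field_simp; norm_num
    have e2 : 64 * √(W : ℝ) ^ 4 / (κ ^ 4 * s ^ 4 * W ^ 2) = 64 / (κ ^ 4 * s ^ 4) := by
      rw [show √(W : ℝ) ^ 4 = (√(W : ℝ) ^ 2) ^ 2 by ring, Real.sq_sqrt hW'.le]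
      field_simp
    rw [e1, e2]
    have h1 : (√(1 + x))⁻¹ + 64 / (κ ^ 4 * s ^ 4) ≤ Real.exp (-(x / 8)) := by
      have := Real.add_one_le_exp (-(x / 8))
      linarith [inv_sqrt_one_add_le hx0 hx1]
    calc _ ≤ Real.exp (x / 16 * W) * Real.exp (-(x / 8)) ^ W := by
          refine mul_le_mul (Real.exp_le_exp.2 ?_) (pow_le_pow_left₀ (by positivity) h1 _)
            (by positivity) (Real.exp_pos _).le
          rw [mul_div_assoc, mul_comm]
          gcongr
      _ = Real.exp (-(x / 16) * W) := by
          rw [← Real.exp_nat_mul, ← Real.exp_add]; congr 1; ring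

/-- The choice of constants for sparse vectors: first the scale `s` of the small ball estimate, then
the mesh `t` of the lattice, the weight `z₀` in the counting bound, and last the sparsity `η`. -/
lemma exists_sparse_constants (p : ℕ) (hp : 1 ≤ p) {c₀ κ C₂ : ℝ} (hc₀ : 0 < c₀) (hκ : 0 < κ)
    (hC₂0 : 0 < C₂) :
    ∃ s x t z₀ η : ℝ, 0 < s ∧ x = c₀ / (16 * p * s ^ 2) ∧ 0 < x ∧ x ≤ 1 ∧
      64 / (κ ^ 4 * s ^ 4) ≤ x / 8 ∧ 0 < t ∧ t ≤ 1 / (8 * p) ∧ t ≤ 1 ∧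
      C₂ * t ^ 2 / (2 * s ^ 2) ≤ x / 16 ∧ z₀ = t * x / (256 * p) ∧ 0 < z₀ ∧ z₀ ≤ 1 ∧
      0 < η ∧ η ≤ 1 / (8 * p) ∧ 2 * p * η * -Real.log z₀ ≤ x / 64 ∧ √(2 * p * η) ≤ x / 64 := by
  have hp' : (1 : ℝ) ≤ p := by exact_mod_cast hp
  set s : ℝ := √(c₀ / (16 * p) + 8192 * p / (κ ^ 4 * c₀)) with hs
  have hs0 : 0 < s := by positivity
  have hs2 : s ^ 2 = c₀ / (16 * p) + 8192 * p / (κ ^ 4 * c₀) := Real.sq_sqrt (by positivity)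
  set x : ℝ := c₀ / (16 * p * s ^ 2) with hx
  have hx0 : 0 < x := by positivity
  have hx1 : x ≤ 1 := by
    rw [hx, ← div_div, div_le_one (by positivity), hs2]
    have : 0 ≤ 8192 * p / (κ ^ 4 * c₀) := by positivity
    linarith
  have hsx : 64 / (κ ^ 4 * s ^ 4) ≤ x / 8 := by
    have h1 : 8192 * p / (κ ^ 4 * c₀) ≤ s ^ 2 := by
      rw [hs2]
      have : 0 ≤ c₀ / (16 * p) := by positivity
      linarith
    rw [div_le_iff₀ (by positivity)] at h1
    rw [hx, div_div, div_le_div_iff₀ (by positivity) (by positivity)]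
    have h2 := mul_le_mul_of_nonneg_right h1 (sq_nonneg s)
    nlinarith
  set t : ℝ := min (1 / (8 * p)) (x * s ^ 2 / (8 * C₂)) with ht
  have ht0 : 0 < t := by positivity
  have htp : t ≤ 1 / (8 * p) := min_le_left _ _
  have h8p : 1 / (8 * p : ℝ) ≤ 1 / 8 := by
    rw [div_le_div_iff₀ (by positivity) (by norm_num)]; linarith
  have ht1 : t ≤ 1 := by linarith
  have htC : C₂ * t ^ 2 / (2 * s ^ 2) ≤ x / 16 := by
    have h1 : t ≤ x * s ^ 2 / (8 * C₂) := min_le_right _ _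
    rw [le_div_iff₀ (by positivity)] at h1
    rw [div_le_div_iff₀ (by positivity) (by norm_num)]
    have h2 := mul_le_mul_of_nonneg_right h1 ht0.le
    have h3 : x * s ^ 2 * t ≤ x * s ^ 2 * 1 := by gcongr
    linarith
  set z₀ : ℝ := t * x / (256 * p) with hz₀
  have hz₀0 : 0 < z₀ := by positivity
  have hz₀1 : z₀ ≤ 1 := by
    rw [hz₀, div_le_one (by positivity)]
    nlinarith
  have hlog : 0 ≤ -Real.log z₀ := neg_nonneg.2 (Real.log_nonpos hz₀0.le hz₀1)
  set η : ℝ := min (1 / (8 * p)) (min (x / (128 * p * (1 + -Real.log z₀)))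
    (x ^ 2 / (8192 * p))) with hη
  have hη0 : 0 < η := by positivity
  have hη1 : η ≤ 1 / (8 * p) := min_le_left _ _
  have hη2 : 2 * p * η * -Real.log z₀ ≤ x / 64 := by
    have : η ≤ x / (128 * p * (1 + -Real.log z₀)) := (min_le_right _ _).trans (min_le_left _ _)
    rw [le_div_iff₀ (by positivity)] at this
    nlinarith [mul_pos hη0 (by linarith : (0 : ℝ) < p)]
  have hη3 : √(2 * p * η) ≤ x / 64 := by
    have : η ≤ x ^ 2 / (8192 * p) := (min_le_right _ _).trans (min_le_right _ _)
    rw [le_div_iff₀ (by positivity)] at this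
    refine Real.sqrt_le_iff.2 ⟨by positivity, ?_⟩
    rw [div_pow]; linarith
  exact ⟨s, x, t, z₀, η, hs0, hx, hx0, hx1, hsx, ht0, htp, ht1, htC, hz₀, hz₀0, hz₀1, hη0, hη1,
    hη2, hη3⟩

lemma sum_sq_lattice_le_one {ι : Type*} [Fintype ι] {t w : ℝ} (ht : 0 < t) (hw : 0 < w) {z : ι → ℤ}
    (hz : z ∈ latticeBall ι (w / t ^ 2)) : ∑ i, (t / √w * z i) ^ 2 ≤ 1 := by
  have := mem_latticeBall.1 hz
  simp_rw [mul_pow, div_pow, Real.sq_sqrt hw.le]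
  rw [← Finset.mul_sum]
  calc t ^ 2 / w * ∑ i, (z i : ℝ) ^ 2 ≤ t ^ 2 / w * (w / t ^ 2) := by gcongr
    _ = 1 := by field_simp

lemma sum_sq_le_two_mul {ι : Type*} [Fintype ι] (u v : ι → ℝ) :
    ∑ i, u i ^ 2 ≤ 2 * ∑ i, (u i - v i) ^ 2 + 2 * ∑ i, v i ^ 2 := by
  rw [Finset.mul_sum, Finset.mul_sum, ← Finset.sum_add_distrib]
  refine Finset.sum_le_sum fun i _ => ?_
  linarith [sq_nonneg (u i - v i - v i), sq_nonneg (u i)]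

lemma lattice_eq_zero {N W : ℕ} (hW : 0 < W) {t : ℝ} (ht : 0 < t) {u : Fin N → ℝ}
    {z : Fin N → ℤ} (hz : ∀ i, |t / √W * z i| ≤ |u i|) {i : Fin N} (hi : u i = 0) : z i = 0 := by
  have hW' : (0 : ℝ) < W := by exact_mod_cast hW
  by_contra hne
  have := mem_largeCoords.1 (mem_largeCoords_of_lattice hW ht hz hne)
  rw [hi, abs_zero] at this
  have : 0 < t / √W := by positivity
  linarith

/-- Approximate eigenvectors that are essentially sparse are unlikely: the lattice points needed to
approximate them are few, `exp (o(1) W)` as the sparsity tends to zero, whereas each of them is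
excluded up to a probability `exp (-c W)`. -/
lemma exists_sparse_unlikely.{v} (p : ℕ) (hp : 1 ≤ p) {c₀ δ : ℝ} (C₀ K : ℝ) (hc₀ : 0 < c₀)
    (hδ : 0 < δ) {C₁ : ℝ} (hC₁ : 0 ≤ C₁) {k : ℕ} (hk : 1 ≤ k) :
    ∃ t η : ℝ, 0 < t ∧ t ≤ 1 ∧ 0 < η ∧ η ≤ 1 / (8 * p) ∧
      ExpUnlikely.{v} p c₀ C₀ δ K fun W M => ∃ e u,
        ApproxKernel W k C₁ t M e u ∧ activeBlocks p W η t u = ∅ := by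
  obtain ⟨κ, hκ, hκ1, hκ2⟩ := exists_charFun_radius hc₀ hδ K
  have hp' : (1 : ℝ) ≤ p := by exact_mod_cast hp
  set C₂ : ℝ := 8 + 8 * p * (3 * C₁ + 2) with hC₂
  obtain ⟨s, x, t, z₀, η, hs0, hx, hx0, hx1, hsx, ht0, htp, ht1, htC, hz₀, hz₀0, hz₀1, hη0, hη1,
    hη2, hη3⟩ := exists_sparse_constants p hp hc₀ hκ (C₂ := C₂) (by positivity)
  refine ⟨t, η, ht0, ht1, hη0, hη1, 2 * ((2 * C₁ + 3) / t) + 3, x / 64, by positivity,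
    by positivity, 0, ?_⟩
  intro W _ hW Ω _ P _ H hH
  classical
  have hW' : (0 : ℝ) < W := by exact_mod_cast hW
  set L := Finset.Icc (-⌈(2 * C₁ + 3) / t⌉) ⌈(2 * C₁ + 3) / t⌉ with hL
  set S := (latticeBall (Fin (2 * p * W)) ((W : ℝ) / t ^ 2)).filter fun z =>
    ((Finset.univ.filter fun i => z i ≠ 0).card : ℝ) ≤ 2 * p * (η * W) ∧
    (∀ j : Fin (2 * p * W), (j : ℕ) / W < k → z j = 0) ∧
    1 / 4 ≤ ∑ i, (t / √W * z i) ^ 2 with hS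
  have hScard : (S.card : ℝ) ≤ Real.exp (3 * x / 64 * W) := by
    have h := card_latticeBall_le ht0 hz₀0 hz₀1 S (Finset.filter_subset _ _)
      (n₀ := 2 * p * (η * W)) fun z hz => (Finset.mem_filter.1 hz).2.1
    refine h.trans ?_
    have h1 : z₀ ^ (-(2 * p * (η * W))) ≤ Real.exp (x / 64 * W) := by
      rw [Real.rpow_def_of_pos hz₀0]
      refine Real.exp_le_exp.2 ?_
      nlinarith [mul_le_mul_of_nonneg_right hη2 hW'.le]
    have h2 : Real.exp (t * √(2 * p * (η * W) * (W / t ^ 2))) ≤ Real.exp (x / 64 * W) := by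
      refine Real.exp_le_exp.2 ?_
      have : 2 * p * (η * W) * (W / t ^ 2) = 2 * p * η * (W / t) ^ 2 := by
        rw [div_pow]; ring
      rw [this, Real.sqrt_mul (by positivity), Real.sqrt_sq (by positivity)]
      calc t * (√(2 * p * η) * (W / t)) = √(2 * p * η) * W := by field_simp
        _ ≤ x / 64 * W := by gcongr
    have h3 : (1 + 2 * z₀ / t) ^ Fintype.card (Fin (2 * p * W)) ≤ Real.exp (x / 64 * W) := by
      have e1 : 2 * z₀ / t = x / (128 * p) := by rw [hz₀]; field_simp; norm_num
      rw [e1]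
      have := Real.add_one_le_exp (x / (128 * p))
      calc (1 + x / (128 * p)) ^ Fintype.card (Fin (2 * p * W))
          ≤ Real.exp (x / (128 * p)) ^ Fintype.card (Fin (2 * p * W)) :=
            pow_le_pow_left₀ (by positivity) (by linarith) _
        _ = Real.exp (x / 64 * W) := by
            rw [← Real.exp_nat_mul]
            congr 1
            simp only [Fintype.card_fin]
            push_cast
            field_simp; ring
    calc _ ≤ Real.exp (x / 64 * W) * Real.exp (x / 64 * W) * Real.exp (x / 64 * W) := by
          gcongr
      _ = _ := by rw [← Real.exp_add, ← Real.exp_add]; congr 1; ring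
  have hsub : {ω | ∃ e u, ApproxKernel W k C₁ t (H ω) e u ∧ activeBlocks p W η t u = ∅} ⊆
      ⋃ q ∈ L ×ˢ S, {ω |
        ∑ i ∈ Finset.univ.filter (fun i : Fin (2 * p * W) => k ≤ (i : ℕ) / W + 1),
          (∑ j, H ω i j * (t / √W * q.2 j) + -(t * q.1) * (t / √W * q.2 i)) ^ 2 ≤
            C₂ * t ^ 2} := by
    rintro ω ⟨e, u, hu, hact⟩
    obtain ⟨l, hl, z, hz, -, hz2, hz3, hz4⟩ := hu.exists_lattice hW hC₁ ht0
    simp only [Set.mem_iUnion]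
    refine ⟨(l, z), Finset.mem_product.2 ⟨hl, Finset.mem_filter.2 ⟨hz, ?_, ?_, ?_⟩⟩, hz4⟩
    · have h1 : (Finset.univ.filter fun i => z i ≠ 0).card ≤ (largeCoords W t u).card :=
        Finset.card_le_card fun i hi =>
          mem_largeCoords_of_lattice hW ht0 hz2 (Finset.mem_filter.1 hi).2
      have h2 := card_largeCoords_le hW hη0.le u (t := t)
      rw [hact] at h2
      simp only [Finset.card_empty, Nat.cast_zero, zero_mul, zero_add] at h2
      exact le_trans (by exact_mod_cast h1) h2
    · exact fun j hj => lattice_eq_zero hW ht0 hz2 (hu.support j hj)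
    · have h1 := sum_sq_le_two_mul u fun i => t / √W * z i
      rw [hu.unit] at h1
      have h2 : p * t ^ 2 ≤ 1 / 64 := by
        rw [le_div_iff₀ (by positivity)] at htp
        nlinarith
      linarith
  refine (measure_mono hsub).trans ((measure_biUnion_le_card_mul
    (B := Real.exp (-(x / 16) * W)) _ _ fun q hq => ?_).trans ?_)
  · obtain ⟨-, hq⟩ := Finset.mem_product.1 hq
    have hq' := (Finset.mem_filter.1 hq).2
    exact hH.measure_fixed_residual_le hp hW hk hδ hc₀ hκ hκ1 hκ2 
      (sum_sq_lattice_le_one ht0 hW' (Finset.mem_filter.1 hq).1) hq'.2.2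
      (fun j hj => by rw [hq'.2.1 j hj]; simp) _ hs0 hx hx1 hsx htC
  · refine ENNReal.ofReal_le_ofReal ?_
    rw [Finset.card_product]
    push_cast
    calc (L.card : ℝ) * S.card * Real.exp (-(x / 16) * W)
        ≤ (2 * ((2 * C₁ + 3) / t) + 3) * Real.exp (3 * x / 64 * W) *
          Real.exp (-(x / 16) * W) := by
          gcongr
          exact card_Icc_ceil_le (by positivity)
      _ = _ := by
          rw [mul_assoc, ← Real.exp_add]; congr 2; ring

/-! ### Spread vectors -/

/-- In a block with many large coordinates, one can select `⌈η W / 2⌉` coordinates of size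
comparable to `1 / √W`: at most `η W / 2` coordinates of a unit vector exceed `√(2 / η) / √W`. -/
lemma exists_spread_subset {N W b : ℕ} (hW : 0 < W) {η t : ℝ} (hη : 0 < η) {v : Fin N → ℝ}
    (hv : ∑ i, v i ^ 2 ≤ 1)
    (hb : η * W < ((block N W b ∩ largeCoords W t v).card : ℝ)) :
    ∃ J ⊆ block N W b, J.card = ⌈η * W / 2⌉₊ ∧
      ∀ j ∈ J, t / √W ≤ |v j| ∧ |v j| ≤ √(2 / η) / √W := by
  classical
  have hW' : (0 : ℝ) < W := by exact_mod_cast hW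
  set B := block N W b ∩ largeCoords W t v with hB
  set big := B.filter fun j => √(2 / η) / √W < |v j| with hbig
  have hcard : (big.card : ℝ) ≤ η * W / 2 := by
    have h1 : (big.card : ℝ) * (2 / η / W) ≤ 1 := by
      rw [← nsmul_eq_mul]
      refine le_trans ?_ ((Finset.sum_le_sum_of_subset_of_nonneg (Finset.subset_univ big)
        fun _ _ _ => sq_nonneg _).trans hv)
      refine Finset.card_nsmul_le_sum _ _ _ fun j hj => ?_
      have h2 := pow_le_pow_left₀ (by positivity) (Finset.mem_filter.1 hj).2.le 2
      rwa [div_pow, Real.sq_sqrt (by positivity), Real.sq_sqrt hW'.le, sq_abs] at h2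
    rw [div_div, ← mul_div_assoc, div_le_one (by positivity)] at h1
    linarith
  have hsplit : (big.card : ℝ) + ((B.filter fun j => ¬ √(2 / η) / √W < |v j|).card : ℝ) =
      B.card := by
    exact_mod_cast Finset.card_filter_add_card_filter_not (s := B) _
  have hle : ⌈η * W / 2⌉₊ ≤ (B.filter fun j => ¬ √(2 / η) / √W < |v j|).card :=
    Nat.ceil_le.2 (by linarith)
  obtain ⟨J, hJ, hJc⟩ := Finset.exists_subset_card_eq hle
  refine ⟨J, fun j hj => ?_, hJc, fun j hj => ?_⟩
  · exact (Finset.mem_inter.1 (Finset.mem_filter.1 (hJ hj)).1).1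
  · have := Finset.mem_filter.1 (hJ hj)
    exact ⟨mem_largeCoords.1 (Finset.mem_inter.1 this.1).2, not_lt.1 this.2⟩

lemma card_filter_block_mem {p W : ℕ} (hW : 0 < W) {R : Finset ℕ} (hR : R ⊆ Finset.range (2 * p)) :
    (Finset.univ.filter fun i : Fin (2 * p * W) => (i : ℕ) / W ∈ R).card = R.card * W := by
  rw [Finset.card_eq_sum_card_fiberwise (f := fun i : Fin (2 * p * W) => (i : ℕ) / W) (t := R)
    fun i hi => by simpa using hi]
  rw [Finset.sum_const_nat (m := W)]
  intro b hb
  refine Eq.trans ?_ (card_block hW (Finset.mem_range.1 (hR hb)))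
  refine congrArg Finset.card (Finset.ext fun i => ?_)
  simp only [Finset.mem_filter, Finset.mem_univ, true_and, mem_block, and_iff_right_iff_imp]
  rintro rfl
  exact hb

/-- Small ball estimate for a fixed vector that is spread over the blocks in `A`. The rows in the
blocks of `A` and in the block preceding `min A` are all sensitive to these coordinates, so that the
number `n` of independent rows exceeds the number `|A| W` of coordinates by almost `W`. -/
lemma IsBandMatrix.measure_spread_residual_le {Ω : Type*} [MeasurableSpace Ω] {P : Measure Ω}
    [IsProbabilityMeasure P] {p W k : ℕ} {c₀ C₀ δ K : ℝ}
    {H : Ω → Matrix (Fin (2 * p * W)) (Fin (2 * p * W)) ℝ}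
    (hH : IsBandMatrix P p W c₀ C₀ δ K H) (hp : 1 ≤ p) (hW : 0 < W) (hWp : 16 * p ≤ W) (hk : 1 ≤ k)
    (hδ : 0 < δ) (hc₀ : 0 < c₀) {κ : ℝ} (hκ : 0 < κ) (hκ1 : κ ^ 2 * K ≤ 2 * δ)
    (hκ2 : 48 * K * κ ≤ c₀ * (δ * √δ)) {η t : ℝ} (hη : 0 < η) (hη1 : η ≤ 1 / (8 * p)) (ht : 0 < t)
    {A : Finset ℕ} (hA : A ⊆ Finset.range (2 * p)) (hne : A.Nonempty) (hAk : ∀ b ∈ A, k ≤ b)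
    {v : Fin (2 * p * W) → ℝ} (hv1 : ∑ i, v i ^ 2 ≤ 1)
    (hv : ∀ b ∈ A, η * W < ((block (2 * p * W) W b ∩ largeCoords W t v).card : ℝ))
    (e ρ : ℝ) {s : ℝ} (hs : 0 < s) :
    ∃ n : ℕ, n ≤ 2 * p * W ∧ A.card * W + 2 * p * (η * W) + W / 2 ≤ (n : ℝ) ∧
      P {ω | ∑ i ∈ Finset.univ.filter (fun i : Fin (2 * p * W) => k ≤ (i : ℕ) / W + 1),
        (∑ j, H ω i j * v j + -e * v i) ^ 2 ≤ ρ} ≤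
      ENNReal.ofReal (Real.exp (W * ρ / (2 * s ^ 2)) *
        ((√(1 + c₀ * (η * t ^ 2 / 2) / (2 * s ^ 2)))⁻¹ +
          64 * √(2 / η) ^ 4 / (κ ^ 4 * s ^ 4 * W ^ 2)) ^ n) := by
  classical
  have hW' : (0 : ℝ) < W := by exact_mod_cast hW
  have hp' : (1 : ℝ) ≤ p := by exact_mod_cast hp
  choose! J hJb hJc hJv using fun b hb => exists_spread_subset hW hη hv1 (hv b hb)
  set m := A.min' hne with hm
  have hmA : m ∈ A := A.min'_mem hne
  have hmk : k ≤ m := hAk m hmA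
  set R := insert (m - 1) A with hR
  have hm1 : m - 1 ∉ A := fun h => by
    have := A.min'_le _ h
    omega
  have hRr : R ⊆ Finset.range (2 * p) := by
    intro b hb
    rcases Finset.mem_insert.1 hb with rfl | hb
    · have := Finset.mem_range.1 (hA hmA)
      exact Finset.mem_range.2 (by omega)
    · exact hA hb
  have hRk : ∀ a ∈ R, k ≤ a + 1 := by
    intro a ha
    rcases Finset.mem_insert.1 ha with rfl | ha
    · omega
    · exact (hAk a ha).trans (Nat.le_succ a)
  set U := A.biUnion J with hU
  set I := (Finset.univ.filter fun i : Fin (2 * p * W) => (i : ℕ) / W ∈ R) \ U with hI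
  -- the active block used by a row
  set β : Fin (2 * p * W) → ℕ := fun i => if (i : ℕ) / W ∈ A then (i : ℕ) / W else (i : ℕ) / W + 1
    with hβ
  have hβA : ∀ i ∈ I, β i ∈ A := by
    intro i hi
    simp only [hβ]
    split_ifs with h
    · exact h
    · have h1 := (Finset.mem_filter.1 (Finset.mem_sdiff.1 hi).1).2
      rcases Finset.mem_insert.1 h1 with h1 | h1
      · rw [h1, Nat.sub_add_cancel (by omega)]; exact hmA
      · exact absurd h1 h
  have hUcard : (U.card : ℝ) ≤ p * (η * W) + 2 * p := by
    have h1 : U.card ≤ A.card * ⌈η * W / 2⌉₊ :=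
      Finset.card_biUnion_le_card_mul _ _ _ fun b hb => (hJc b hb).le
    have h2 : A.card ≤ 2 * p := by simpa using Finset.card_le_card hA
    have h3 : (⌈η * W / 2⌉₊ : ℝ) ≤ η * W / 2 + 1 := (Nat.ceil_lt_add_one (by positivity)).le
    have h4 : (U.card : ℝ) ≤ A.card * ⌈η * W / 2⌉₊ := by exact_mod_cast h1
    have h5 : (A.card : ℝ) ≤ 2 * p := by exact_mod_cast h2
    calc (U.card : ℝ) ≤ A.card * ⌈η * W / 2⌉₊ := h4
      _ ≤ 2 * p * (η * W / 2 + 1) := by gcongr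
      _ = _ := by ring
  have hIcard : (A.card : ℝ) * W + W ≤ I.card + U.card := by
    have h1 := Finset.card_le_card_sdiff_add_card (t := U)
      (s := Finset.univ.filter fun i : Fin (2 * p * W) => (i : ℕ) / W ∈ R)
    rw [card_filter_block_mem hW hRr, hR, Finset.card_insert_of_notMem hm1] at h1
    have h2 : (((A.card + 1) * W : ℕ) : ℝ) ≤ ((I.card + U.card : ℕ) : ℝ) := by exact_mod_cast h1
    push_cast at h2
    linarith
  refine ⟨I.card, by simpa using Finset.card_le_univ I, ?_, ?_⟩
  · have h1 : 3 * p * (η * W) ≤ 3 / 8 * W := by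
      rw [le_div_iff₀ (by positivity)] at hη1
      nlinarith
    have h2 : (16 : ℝ) * p ≤ W := by exact_mod_cast hWp
    linarith
  · have hmain := hH.measure_residual_le hW hδ hc₀ hκ hκ1 hκ2 v (fun i => -e * v i) I
      (fun i => J (β i))
      (fun i hi j hj hjI => (Finset.mem_sdiff.1 hjI).2 (Finset.mem_biUnion.2 ⟨_, hβA i hi, hj⟩))
      (fun i hi j hj => by
        refine periodicDist_lt_of_block hW (mem_block.2 rfl) (hJb _ (hβA i hi) hj) ?_ ?_ <;>
        · simp only [hβ]; split_ifs <;> omega)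
      (T := √(2 / η)) (m := η * t ^ 2 / 2) (s := s) (by positivity) hs (by positivity)
      (fun i hi j hj => (hJv _ (hβA i hi) j hj).2)
      (fun i hi => by
        have h1 : ((J (β i)).card : ℝ) * (t ^ 2 / W) ≤ ∑ j ∈ J (β i), v j ^ 2 := by
          rw [← nsmul_eq_mul]
          refine Finset.card_nsmul_le_sum _ _ _ fun j hj => ?_
          have h2 := pow_le_pow_left₀ (by positivity) (hJv _ (hβA i hi) j hj).1 2
          rwa [div_pow, Real.sq_sqrt hW'.le, sq_abs] at h2
        refine le_trans ?_ h1
        rw [hJc _ (hβA i hi)]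
        calc η * t ^ 2 / 2 = η * W / 2 * (t ^ 2 / W) := by field_simp
          _ ≤ _ := by gcongr; exact Nat.le_ceil _) ρ
    refine (measure_mono fun ω hω => ?_).trans hmain
    rw [Set.mem_ofPred_eq] at hω ⊢
    refine le_trans (Finset.sum_le_sum_of_subset_of_nonneg ?_ fun _ _ _ => sq_nonneg _) hω
    intro i hi
    simp only [Finset.mem_filter, Finset.mem_univ, true_and]
    exact hRk _ (Finset.mem_filter.1 (Finset.mem_sdiff.1 hi).1).2

/-- The choice of the next, much finer mesh `t'`: it beats all exponential costs that do not depend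
on `t'`, namely the constants in the lattice count and in the small ball estimate. -/
lemma exists_next_mesh (p : ℕ) {c₀ C₂ κ η t : ℝ} (hc₀ : 0 < c₀) (hκ : 0 < κ) (hη : 0 < η)
    (ht : 0 < t) (ht1 : t ≤ 1) :
    ∃ (t' Q : ℝ) (W₀ : ℕ), 0 < t' ∧ t' ≤ t / 2 ∧ t' ≤ 1 ∧ 1 ≤ Q ∧
      t' ≤ Real.exp (-(2 * (1 + C₂ / 2 + 4 * p + 2 * p * Real.log 3 + 2 * p * Real.log Q))) ∧
      ∀ W : ℕ, W₀ ≤ W → 0 < W →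
        (√(1 + c₀ * (η * (t / 2) ^ 2 / 2) / (2 * t' ^ 2)))⁻¹ +
          64 * √(2 / η) ^ 4 / (κ ^ 4 * t' ^ 4 * W ^ 2) ≤ t' * Q := by
  set m : ℝ := c₀ * (η * (t / 2) ^ 2 / 2) / 2 with hm
  have hm0 : 0 < m := by positivity
  set Q : ℝ := (√m)⁻¹ + 1 with hQ
  have hQ1 : 1 ≤ Q := by
    have : 0 < (√m)⁻¹ := by positivity
    linarith
  set t' : ℝ := min (t / 2)
    (Real.exp (-(2 * (1 + C₂ / 2 + 4 * p + 2 * p * Real.log 3 + 2 * p * Real.log Q)))) with ht'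
  have ht'0 : 0 < t' := lt_min (by positivity) (Real.exp_pos _)
  have ht't : t' ≤ t / 2 := min_le_left _ _
  refine ⟨t', Q, ⌈256 / (η ^ 2 * κ ^ 4 * t' ^ 5)⌉₊, ht'0, ht't, by linarith, hQ1,
    min_le_right _ _, fun W hW₀ hW => ?_⟩
  have hW1 : (1 : ℝ) ≤ W := by exact_mod_cast hW
  have h1 : (√(1 + c₀ * (η * (t / 2) ^ 2 / 2) / (2 * t' ^ 2)))⁻¹ ≤ t' * (√m)⁻¹ := by
    have e : t' * (√m)⁻¹ = (√(m / t' ^ 2))⁻¹ := by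
      rw [Real.sqrt_div hm0.le, Real.sqrt_sq ht'0.le, inv_div, div_eq_mul_inv]
    rw [e]
    refine inv_anti₀ (by positivity) (Real.sqrt_le_sqrt ?_)
    have : c₀ * (η * (t / 2) ^ 2 / 2) / (2 * t' ^ 2) = m / t' ^ 2 := by rw [hm]; field_simp
    linarith
  have h2 : 64 * √(2 / η) ^ 4 / (κ ^ 4 * t' ^ 4 * W ^ 2) ≤ t' := by
    have e : √(2 / η) ^ 4 = 4 / η ^ 2 := by
      rw [show √(2 / η) ^ 4 = (√(2 / η) ^ 2) ^ 2 by ring, Real.sq_sqrt (by positivity), div_pow]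
      norm_num
    have h3 : 256 / (η ^ 2 * κ ^ 4 * t' ^ 5) ≤ W := Nat.ceil_le.1 hW₀
    have h4 : (W : ℝ) ≤ W ^ 2 := by nlinarith
    rw [e, div_le_iff₀ (by positivity)]
    rw [div_le_iff₀ (by positivity)] at h3
    have h5 : (256 : ℝ) ≤ W ^ 2 * (η ^ 2 * κ ^ 4 * t' ^ 5) :=
      h3.trans (mul_le_mul_of_nonneg_right h4 (by positivity))
    rw [← mul_div_assoc, div_le_iff₀ (by positivity)]
    nlinarith
  rw [hQ]; linarith

/-- For a given set `A` of active blocks which does not change when the level is refined from `t` to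
`t'`, the union bound over the lattice of mesh `t' / √W` succeeds: the lattice has about
`t' ^ (-|A| W)` relevant points, each of which is excluded up to a probability
`t' ^ ((|A| + 1) W)`. -/
lemma IsBandMatrix.measure_stable_active_le {Ω : Type*} [MeasurableSpace Ω] {P : Measure Ω}
    [IsProbabilityMeasure P] {p W k : ℕ} {c₀ C₀ δ K : ℝ}
    {H : Ω → Matrix (Fin (2 * p * W)) (Fin (2 * p * W)) ℝ}
    (hH : IsBandMatrix P p W c₀ C₀ δ K H) (hp : 1 ≤ p) (hW : 0 < W) (hWp : 16 * p ≤ W) (hk : 1 ≤ k)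
    (hδ : 0 < δ) (hc₀ : 0 < c₀) {κ : ℝ} (hκ : 0 < κ) (hκ1 : κ ^ 2 * K ≤ 2 * δ)
    (hκ2 : 48 * K * κ ≤ c₀ * (δ * √δ)) {C₁ : ℝ} (hC₁ : 0 ≤ C₁) {η t t' Q : ℝ} (hη : 0 < η)
    (hη1 : η ≤ 1 / (8 * p)) (ht'0 : 0 < t') (ht't : t' ≤ t / 2) (ht'1 : t' ≤ 1) (hQ : 1 ≤ Q)
    (hsmall : t' ≤ Real.exp (-(2 * (1 + (8 + 8 * p * (3 * C₁ + 2)) / 2 + 4 * p +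
      2 * p * Real.log 3 + 2 * p * Real.log Q))))
    (hq : (√(1 + c₀ * (η * (t / 2) ^ 2 / 2) / (2 * t' ^ 2)))⁻¹ +
      64 * √(2 / η) ^ 4 / (κ ^ 4 * t' ^ 4 * W ^ 2) ≤ t' * Q)
    (A : Finset ℕ) (hne : A.Nonempty) :
    P {ω | ∃ e u, ApproxKernel W k C₁ t' (H ω) e u ∧ activeBlocks p W η t u = A ∧
      activeBlocks p W η t' u = A} ≤
      ENNReal.ofReal ((2 * ((2 * C₁ + 3) / t') + 3) * Real.exp (-W)) := by
  classical
  by_cases hA : A ⊆ Finset.range (2 * p)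
  swap
  · have : {ω | ∃ e u, ApproxKernel W k C₁ t' (H ω) e u ∧ activeBlocks p W η t u = A ∧
        activeBlocks p W η t' u = A} = ∅ := by
      refine Set.eq_empty_of_forall_notMem fun ω => ?_
      rintro ⟨e, u, -, h, -⟩
      exact hA (h ▸ activeBlocks_subset_range)
    rw [this, measure_empty]; exact zero_le
  have hW' : (0 : ℝ) < W := by exact_mod_cast hW
  have hp' : (1 : ℝ) ≤ p := by exact_mod_cast hp
  have ht : 0 < t := by linarith
  set C₂ : ℝ := 8 + 8 * p * (3 * C₁ + 2) with hC₂
  have hC₂0 : 0 < C₂ := by positivity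
  set n₀ : ℝ := A.card * W + 2 * p * (η * W) with hn₀
  have hn₀0 : 0 ≤ n₀ := by positivity
  have hAc : (A.card : ℝ) ≤ 2 * p := by
    have := Finset.card_le_card hA
    rw [Finset.card_range] at this
    exact_mod_cast this
  have hn₀le : n₀ ≤ 16 * p ^ 2 * W := by
    rw [le_div_iff₀ (by positivity)] at hη1
    have h1 : A.card * W ≤ 2 * p * (W : ℝ) := by gcongr
    have h2 : (p : ℝ) ≤ p ^ 2 := by nlinarith
    have h3 : p * (W : ℝ) ≤ p ^ 2 * W := by gcongr
    have h4 : (W : ℝ) ≤ p * W := le_mul_of_one_le_left hW'.le hp'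
    nlinarith
  set L := Finset.Icc (-⌈(2 * C₁ + 3) / t'⌉) ⌈(2 * C₁ + 3) / t'⌉ with hL
  set S := (latticeBall (Fin (2 * p * W)) ((W : ℝ) / t' ^ 2)).filter fun z =>
    ((Finset.univ.filter fun i => z i ≠ 0).card : ℝ) ≤ n₀ ∧
    ∀ b ∈ A, k ≤ b ∧ η * W <
      ((block (2 * p * W) W b ∩ largeCoords W (t / 2) fun i => t' / √W * z i).card : ℝ) with hS
  have hScard : (S.card : ℝ) ≤ t' ^ (-n₀) * Real.exp ((4 * p + 2 * p * Real.log 3) * W) := by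
    have h := card_latticeBall_le ht'0 ht'0 ht'1 S (Finset.filter_subset _ _)
      (n₀ := n₀) fun z hz => (Finset.mem_filter.1 hz).2.1
    refine h.trans ?_
    have h2 : t' * √(n₀ * (W / t' ^ 2)) ≤ 4 * p * W := by
      have : √(n₀ * (W / t' ^ 2)) ≤ 4 * p * W / t' := by
        refine Real.sqrt_le_iff.2 ⟨by positivity, ?_⟩
        rw [← mul_div_assoc, div_pow (4 * (p : ℝ) * W) t']
        refine (div_le_div_iff_of_pos_right (by positivity : 0 < t' ^ 2)).2 ?_
        nlinarith
      calc t' * √(n₀ * (W / t' ^ 2)) ≤ t' * (4 * p * W / t') := by gcongr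
        _ = 4 * p * W := by field_simp
    have h3 : (1 + 2 * t' / t') ^ Fintype.card (Fin (2 * p * W)) =
        Real.exp (2 * p * Real.log 3 * W) := by
      rw [mul_div_assoc, div_self ht'0.ne', Fintype.card_fin,
        show (1 + 2 * 1 : ℝ) = Real.exp (Real.log 3) by rw [Real.exp_log (by norm_num)]; norm_num,
        ← Real.exp_nat_mul]
      congr 1; push_cast; ring
    rw [h3, mul_assoc, ← Real.exp_add]
    refine mul_le_mul_of_nonneg_left (Real.exp_le_exp.2 ?_) (by positivity)
    linarith
  have hsub : {ω | ∃ e u, ApproxKernel W k C₁ t' (H ω) e u ∧ activeBlocks p W η t u = A ∧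
      activeBlocks p W η t' u = A} ⊆
      ⋃ q ∈ L ×ˢ S, {ω |
        ∑ i ∈ Finset.univ.filter (fun i : Fin (2 * p * W) => k ≤ (i : ℕ) / W + 1),
          (∑ j, H ω i j * (t' / √W * q.2 j) + -(t' * q.1) * (t' / √W * q.2 i)) ^ 2 ≤
            C₂ * t' ^ 2} := by
    rintro ω ⟨e, u, hu, hact, hact'⟩
    obtain ⟨l, hl, z, hz, hz1, hz2, -, hz4⟩ := hu.exists_lattice hW hC₁ ht'0
    simp only [Set.mem_iUnion]
    refine ⟨(l, z), Finset.mem_product.2 ⟨hl, Finset.mem_filter.2 ⟨hz, ?_, ?_⟩⟩, hz4⟩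
    · have h1 : (Finset.univ.filter fun i => z i ≠ 0).card ≤ (largeCoords W t' u).card :=
        Finset.card_le_card fun i hi =>
          mem_largeCoords_of_lattice hW ht'0 hz2 (Finset.mem_filter.1 hi).2
      have h2 := card_largeCoords_le hW hη.le u (t := t')
      rw [hact'] at h2
      exact le_trans (by exact_mod_cast h1) h2
    · intro b hb
      rw [← hact, mem_activeBlocks] at hb
      refine ⟨?_, hb.2.trans_le ?_⟩
      · by_contra hlt
        have h0 : (0 : ℝ) < ((block (2 * p * W) W b ∩ largeCoords W t u).card : ℝ) :=
          lt_of_le_of_lt (by positivity) hb.2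
        obtain ⟨j, hj⟩ := Finset.card_pos.1 (by exact_mod_cast h0)
        rw [Finset.mem_inter, mem_block, mem_largeCoords] at hj
        have := hj.2
        rw [hu.support j (by rw [hj.1]; omega), abs_zero] at this
        have : 0 < t / √W := by positivity
        linarith
      · have : block (2 * p * W) W b ∩ largeCoords W t u ⊆
            block (2 * p * W) W b ∩ largeCoords W (t / 2) fun i => t' / √W * z i := by
          refine Finset.inter_subset_inter_left fun j hj => ?_
          rw [mem_largeCoords] at hj ⊢
          have h1 := abs_sub_abs_le_abs_sub (u j) (t' / √W * z j)
          have h2 : t' / √W ≤ t / 2 / √W := by gcongr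
          have h3 : t / √W = t / 2 / √W + t / 2 / √W := by ring
          linarith [hz1 j]
        exact_mod_cast Finset.card_le_card this
  refine (measure_mono hsub).trans ((measure_biUnion_le_card_mul
    (B := t' ^ n₀ * Real.exp (-(1 + 4 * p + 2 * p * Real.log 3) * W)) _ _ fun q hq' => ?_).trans ?_)
  · obtain ⟨-, hqS⟩ := Finset.mem_product.1 hq'
    have hqS' := (Finset.mem_filter.1 hqS).2
    obtain ⟨n, hn1, hn2, hn3⟩ := hH.measure_spread_residual_le hp hW hWp hk hδ hc₀ hκ hκ1 hκ2 hη
      hη1 (by positivity : 0 < t / 2) hA hne (fun b hb => (hqS'.2 b hb).1)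
      (sum_sq_lattice_le_one ht'0 hW' (Finset.mem_filter.1 hqS).1)
      (fun b hb => (hqS'.2 b hb).2) (t' * q.1) (C₂ * t' ^ 2) ht'0
    refine hn3.trans (ENNReal.ofReal_le_ofReal ?_)
    have e1 : W * (C₂ * t' ^ 2) / (2 * t' ^ 2) = C₂ / 2 * W := by field_simp
    rw [e1]
    have h1 : Q ^ n ≤ Real.exp (2 * p * Real.log Q * W) := by
      refine (pow_le_pow_right₀ hQ hn1).trans (le_of_eq ?_)
      nth_rewrite 1 [← Real.exp_log (by linarith : 0 < Q)]
      rw [← Real.exp_nat_mul]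
      congr 1; push_cast; ring
    have h2 : t' ^ n ≤ t' ^ n₀ * Real.exp (-(1 + C₂ / 2 + 4 * p + 2 * p * Real.log 3 +
        2 * p * Real.log Q) * W) := by
      rw [← Real.rpow_natCast]
      refine (Real.rpow_le_rpow_of_exponent_ge ht'0 ht'1 hn2).trans ?_
      rw [Real.rpow_add ht'0]
      refine mul_le_mul_of_nonneg_left ?_ (by positivity)
      refine (Real.rpow_le_rpow ht'0.le hsmall (by positivity)).trans (le_of_eq ?_)
      rw [← Real.exp_mul]
      congr 1; ring
    calc _ ≤ Real.exp (C₂ / 2 * W) * (t' * Q) ^ n := by gcongr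
      _ = Real.exp (C₂ / 2 * W) * (t' ^ n * Q ^ n) := by rw [mul_pow]
      _ ≤ Real.exp (C₂ / 2 * W) * (t' ^ n₀ * Real.exp (-(1 + C₂ / 2 + 4 * p +
          2 * p * Real.log 3 + 2 * p * Real.log Q) * W) * Real.exp (2 * p * Real.log Q * W)) := by
          gcongr
      _ = t' ^ n₀ * (Real.exp (C₂ / 2 * W) * Real.exp (-(1 + C₂ / 2 + 4 * p +
          2 * p * Real.log 3 + 2 * p * Real.log Q) * W) * Real.exp (2 * p * Real.log Q * W)) := by
          ring
      _ = _ := by rw [← Real.exp_add, ← Real.exp_add]; congr 2; ring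
  · refine ENNReal.ofReal_le_ofReal ?_
    rw [Finset.card_product]
    push_cast
    calc (L.card : ℝ) * S.card * (t' ^ n₀ * Real.exp (-(1 + 4 * p + 2 * p * Real.log 3) * W))
        ≤ (2 * ((2 * C₁ + 3) / t') + 3) *
          (t' ^ (-n₀) * Real.exp ((4 * p + 2 * p * Real.log 3) * W)) *
          (t' ^ n₀ * Real.exp (-(1 + 4 * p + 2 * p * Real.log 3) * W)) := by
          gcongr
          exact card_Icc_ceil_le (by positivity)
      _ = (2 * ((2 * C₁ + 3) / t') + 3) * ((t' ^ (-n₀) * t' ^ n₀) *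
          (Real.exp ((4 * p + 2 * p * Real.log 3) * W) *
            Real.exp (-(1 + 4 * p + 2 * p * Real.log 3) * W))) := by ring
      _ = _ := by
          rw [← Real.rpow_add ht'0, neg_add_cancel, Real.rpow_zero, one_mul, ← Real.exp_add]
          congr 2; ring

/-! ### Refining the level -/

lemma exists_stable_unlikely.{v} (p : ℕ) (hp : 1 ≤ p) {c₀ δ : ℝ} (C₀ K : ℝ) (hc₀ : 0 < c₀)
    (hδ : 0 < δ) {C₁ : ℝ} (hC₁ : 0 ≤ C₁) {k : ℕ} (hk : 1 ≤ k) {η t : ℝ} (hη : 0 < η)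
    (hη1 : η ≤ 1 / (8 * p)) (ht : 0 < t) (ht1 : t ≤ 1) :
    ∃ t' : ℝ, 0 < t' ∧ t' ≤ t / 2 ∧ ExpUnlikely.{v} p c₀ C₀ δ K fun W M => ∃ e u,
      ApproxKernel W k C₁ t' M e u ∧ (activeBlocks p W η t u).Nonempty ∧
        activeBlocks p W η t' u = activeBlocks p W η t u := by
  obtain ⟨κ, hκ, hκ1, hκ2⟩ := exists_charFun_radius hc₀ hδ K
  obtain ⟨t', Q, W₀, ht'0, ht't, ht'1, hQ, hsmall, hq⟩ := exists_next_mesh p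
    (C₂ := 8 + 8 * p * (3 * C₁ + 2)) hc₀ hκ hη ht ht1
  refine ⟨t', ht'0, ht't, 2 ^ (2 * p) * (2 * ((2 * C₁ + 3) / t') + 3), 1, by positivity, one_pos,
    max W₀ (16 * p), fun W hW₀ hW Ω _ P _ H hH => ?_⟩
  have hsub : {ω | ∃ e u, ApproxKernel W k C₁ t' (H ω) e u ∧
      (activeBlocks p W η t u).Nonempty ∧ activeBlocks p W η t' u = activeBlocks p W η t u} ⊆
      ⋃ A ∈ (Finset.range (2 * p)).powerset.filter Finset.Nonempty,
        {ω | ∃ e u, ApproxKernel W k C₁ t' (H ω) e u ∧ activeBlocks p W η t u = A ∧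
          activeBlocks p W η t' u = A} := by
    rintro ω ⟨e, u, hu, hne, hact⟩
    simp only [Set.mem_iUnion]
    exact ⟨activeBlocks p W η t u, Finset.mem_filter.2
      ⟨Finset.mem_powerset.2 activeBlocks_subset_range, hne⟩, e, u, hu, rfl, hact⟩
  refine (measure_mono hsub).trans ((measure_biUnion_le_card_mul
    (B := (2 * ((2 * C₁ + 3) / t') + 3) * Real.exp (-W)) _ _ fun A hA => ?_).trans ?_)
  · exact hH.measure_stable_active_le hp hW ((le_max_right _ _).trans hW₀) hk hδ hc₀ hκ hκ1 hκ2
      hC₁ hη hη1 ht'0 ht't ht'1 hQ hsmall (hq W ((le_max_left _ _).trans hW₀) hW) A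
      (Finset.mem_filter.1 hA).2
  · refine ENNReal.ofReal_le_ofReal ?_
    have h1 : (((Finset.range (2 * p)).powerset.filter Finset.Nonempty).card : ℝ) ≤
        2 ^ (2 * p) := by
      have := Finset.card_filter_le (Finset.range (2 * p)).powerset Finset.Nonempty
      rw [Finset.card_powerset, Finset.card_range] at this
      exact_mod_cast this
    rw [mul_assoc, neg_one_mul]
    gcongr

/-- Vectors that are spread over some block: refining the level either leaves the set of active
blocks unchanged or enlarges it, and the latter can happen at most `2 p` times. -/
lemma exists_active_unlikely.{v} (p : ℕ) (hp : 1 ≤ p) {c₀ δ : ℝ} (C₀ K : ℝ) (hc₀ : 0 < c₀)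
    (hδ : 0 < δ) {C₁ : ℝ} (hC₁ : 0 ≤ C₁) {k : ℕ} (hk : 1 ≤ k) {η : ℝ} (hη : 0 < η)
    (hη1 : η ≤ 1 / (8 * p)) (n : ℕ) : ∀ t : ℝ, 0 < t → t ≤ 1 →
    ∃ t' : ℝ, 0 < t' ∧ t' ≤ t ∧ ExpUnlikely.{v} p c₀ C₀ δ K fun W M => ∃ e u,
      ApproxKernel W k C₁ t' M e u ∧ (activeBlocks p W η t u).Nonempty ∧
        2 * p ≤ (activeBlocks p W η t u).card + n := by
  induction n with
  | zero =>
    intro t ht ht1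
    obtain ⟨t', ht'0, ht't, h⟩ :=
      exists_stable_unlikely.{v} p hp C₀ K hc₀ hδ hC₁ hk hη hη1 ht ht1
    refine ⟨t', ht'0, by linarith, h.mono fun W M _ => ?_⟩
    rintro ⟨e, u, hu, hne, hcard⟩
    refine ⟨e, u, hu, hne, ?_⟩
    have h1 : activeBlocks p W η t u = Finset.range (2 * p) :=
      Finset.eq_of_subset_of_card_le activeBlocks_subset_range (by simpa using hcard)
    refine subset_antisymm (h1 ▸ activeBlocks_subset_range) (activeBlocks_anti (by linarith) u)
  | succ n ih =>
    intro t ht ht1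
    obtain ⟨t', ht'0, ht't, h⟩ :=
      exists_stable_unlikely.{v} p hp C₀ K hc₀ hδ hC₁ hk hη hη1 ht ht1
    obtain ⟨t'', ht''0, ht''t', h'⟩ := ih t' ht'0 (by linarith)
    refine ⟨t'', ht''0, by linarith, (h.or h').mono fun W M _ => ?_⟩
    rintro ⟨e, u, hu, hne, hcard⟩
    have hsub := activeBlocks_anti (p := p) (W := W) (η := η) (by linarith : t' ≤ t) u
    by_cases heq : activeBlocks p W η t' u = activeBlocks p W η t u
    · exact Or.inl ⟨e, u, hu.mono ht''0.le ht''t', hne, heq⟩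
    · refine Or.inr ⟨e, u, hu, hne.mono hsub, ?_⟩
      have := Finset.card_lt_card (hsub.ssubset_of_ne (Ne.symm heq))
      omega

/-! ### Uniform lower bound for the residual -/

/-- Some nonzero vector vanishing on the first `k` blocks is an approximate eigenvector of `M`, up
to the rows of the first `k - 1` blocks. -/
def HasApproxEigenvector {N : ℕ} (W k : ℕ) (ρ : ℝ) (M : Matrix (Fin N) (Fin N) ℝ) : Prop :=
  ∃ (e : ℝ) (w : Fin N → ℝ), 0 < ∑ i, w i ^ 2 ∧ (∀ j : Fin N, (j : ℕ) / W < k → w j = 0) ∧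
    ∑ i ∈ Finset.univ.filter (fun i : Fin N => k ≤ (i : ℕ) / W + 1),
      (∑ j, M i j * w j + -e * w i) ^ 2 ≤ ρ ^ 2 * ∑ i, w i ^ 2

lemma HasApproxEigenvector.mono {N W k : ℕ} {ρ ρ' : ℝ} {M : Matrix (Fin N) (Fin N) ℝ}
    (h : HasApproxEigenvector W k ρ M) (hρ : 0 ≤ ρ) (hρρ' : ρ ≤ ρ') :
    HasApproxEigenvector W k ρ' M := by
  obtain ⟨e, w, hw, hs, hr⟩ := h
  exact ⟨e, w, hw, hs, hr.trans (by gcongr)⟩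

lemma HasApproxEigenvector.exists_approxKernel {N W k : ℕ} {C₁ ρ : ℝ}
    {M : Matrix (Fin N) (Fin N) ℝ} (h : HasApproxEigenvector W k ρ M) (hρ0 : 0 ≤ ρ) (hρ : ρ ≤ 1)
    (hop : ∀ x : Fin N → ℝ, ∑ i, (∑ j, M i j * x j) ^ 2 ≤ C₁ * ∑ i, x i ^ 2) :
    ∃ e u, ApproxKernel W k C₁ ρ M e u := by
  obtain ⟨e, w, hw, hs, hr⟩ := h
  set R := Finset.univ.filter (fun i : Fin N => k ≤ (i : ℕ) / W + 1) with hR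
  set n := ∑ i, w i ^ 2 with hn
  have hsq : (√n)⁻¹ ^ 2 = n⁻¹ := by rw [inv_pow, Real.sq_sqrt hw.le]
  refine ⟨e, fun i => (√n)⁻¹ * w i, hop, ?_, ?_, ?_, ?_⟩
  · simp_rw [mul_pow, hsq]
    rw [← Finset.mul_sum, inv_mul_cancel₀ hw.ne']
  · intro j hj
    rw [hs j hj, mul_zero]
  · have h1 : e ^ 2 * n = ∑ i ∈ R, (e * w i) ^ 2 := by
      rw [hn, Finset.mul_sum]
      simp_rw [mul_pow]
      symm
      refine Finset.sum_subset (Finset.subset_univ _) fun i _ hi => ?_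
      have : (i : ℕ) / W < k := by
        by_contra hlt
        exact hi (Finset.mem_filter.2 ⟨Finset.mem_univ _, by omega⟩)
      rw [hs i this]; ring
    have h2 : ∑ i ∈ R, (e * w i) ^ 2 ≤ 2 * ∑ i ∈ R, (∑ j, M i j * w j + -e * w i) ^ 2 +
        2 * ∑ i ∈ R, (∑ j, M i j * w j) ^ 2 := by
      rw [Finset.mul_sum, Finset.mul_sum, ← Finset.sum_add_distrib]
      refine Finset.sum_le_sum fun i _ => ?_
      linarith [sq_nonneg (∑ j, M i j * w j + -e * w i + ∑ j, M i j * w j)]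
    have h3 : ∑ i ∈ R, (∑ j, M i j * w j) ^ 2 ≤ C₁ * n :=
      (Finset.sum_le_sum_of_subset_of_nonneg (Finset.subset_univ _)
        fun _ _ _ => sq_nonneg _).trans (hop w)
    have h4 : ρ ^ 2 * n ≤ 1 * n := by
      gcongr
      exact pow_le_one₀ hρ0 hρ
    have h5 : e ^ 2 * n ≤ (2 * C₁ + 2) * n := by linarith
    exact le_of_mul_le_mul_right h5 hw
  · have e1 : ∀ i, (∑ j, M i j * ((√n)⁻¹ * w j) + -e * ((√n)⁻¹ * w i)) ^ 2 =
        n⁻¹ * (∑ j, M i j * w j + -e * w i) ^ 2 := by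
      intro i
      rw [← hsq, ← mul_pow, mul_add, Finset.mul_sum]
      congr 2
      · exact Finset.sum_congr rfl fun j _ => by ring
      · ring
    simp_rw [e1]
    rw [← Finset.mul_sum, inv_mul_eq_div, div_le_iff₀ hw]
    exact hr

/-- Rectangular pieces of a band matrix with an extra block of rows have no small singular values,
uniformly in the spectral parameter. -/
lemma exists_approxEigenvector_unlikely.{v} (p : ℕ) (hp : 1 ≤ p) {c₀ δ : ℝ} (C₀ K : ℝ)
    (hc₀ : 0 < c₀) (hδ : 0 < δ) {C₁ : ℝ} (hC₁ : 0 ≤ C₁) {k : ℕ} (hk : 1 ≤ k) :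
    ∃ ρ : ℝ, 0 < ρ ∧ ρ ≤ 1 ∧ ExpUnlikely.{v} p c₀ C₀ δ K fun W M =>
      (∀ x : Fin (2 * p * W) → ℝ, ∑ i, (∑ j, M i j * x j) ^ 2 ≤ C₁ * ∑ i, x i ^ 2) ∧
        HasApproxEigenvector W k ρ M := by
  obtain ⟨t, η, ht0, ht1, hη0, hη1, h⟩ :=
    exists_sparse_unlikely.{v} p hp C₀ K hc₀ hδ hC₁ hk
  obtain ⟨t', ht'0, ht't, h'⟩ :=
    exists_active_unlikely.{v} p hp C₀ K hc₀ hδ hC₁ hk hη0 hη1 (2 * p) t ht0 ht1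
  refine ⟨t', ht'0, ht't.trans ht1, (h.or h').mono fun W M _ => ?_⟩
  rintro ⟨hop, hM⟩
  obtain ⟨e, u, hu⟩ := hM.exists_approxKernel ht'0.le (ht't.trans ht1) hop
  rcases Finset.eq_empty_or_nonempty (activeBlocks p W η t u) with hem | hne
  · exact Or.inl ⟨e, u, hu.mono ht'0.le ht't, hem⟩
  · exact Or.inr ⟨e, u, hu, hne, by omega⟩

/-! ### The blocks `B` and `D` -/

/-- Extension by zero of a vector on the last `N - W` coordinates. -/
def extendTail {N W : ℕ} (x : Tail N W → ℝ) (j : Fin N) : ℝ :=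
  if h : W ≤ (j : ℕ) then x ⟨j, h⟩ else 0

lemma extendTail_coe {N W : ℕ} (x : Tail N W → ℝ) (j : Tail N W) : extendTail x j.1 = x j := by
  rw [extendTail, dif_pos j.2]

lemma extendTail_of_lt {N W : ℕ} (x : Tail N W → ℝ) {j : Fin N} (hj : (j : ℕ) < W) :
    extendTail x j = 0 := by
  rw [extendTail, dif_neg (by omega)]

lemma sum_filter_eq_sum_tail {N W : ℕ} (f : Fin N → ℝ) :
    ∑ i ∈ Finset.univ.filter (fun i : Fin N => W ≤ (i : ℕ)), f i = ∑ i : Tail N W, f i.1 :=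
  Finset.sum_subtype _ (by simp) f

lemma sum_eq_head_add_tail {N W : ℕ} (f : Fin N → ℝ) :
    ∑ i, f i = ∑ i : Head N W, f i.1 + ∑ i : Tail N W, f i.1 := by
  rw [← Finset.sum_filter_add_sum_filter_not Finset.univ (fun i : Fin N => (i : ℕ) < W)]
  congr 1
  · exact Finset.sum_subtype _ (by simp) f
  · exact Finset.sum_subtype _ (by simp) f

lemma sum_mul_extendTail {N W : ℕ} (a : Fin N → ℝ) (x : Tail N W → ℝ) :
    ∑ j, a j * extendTail x j = ∑ j : Tail N W, a j.1 * x j := by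
  rw [sum_eq_head_add_tail (W := W), Finset.sum_eq_zero, zero_add]
  · exact Finset.sum_congr rfl fun j _ => by rw [extendTail_coe]
  · intro j _
    rw [extendTail_of_lt x j.2, mul_zero]

lemma sum_sq_extendTail {N W : ℕ} (x : Tail N W → ℝ) :
    ∑ j, extendTail x j ^ 2 = ∑ j, x j ^ 2 := by
  simp_rw [sq, sum_mul_extendTail, extendTail_coe]

lemma shiftedD_mulVec {N W : ℕ} (M : Matrix (Fin N) (Fin N) ℝ) (g : Fin N → ℝ) (e : ℝ)
    (x : Tail N W → ℝ) (i : Tail N W) :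
    (shiftedD W M g e *ᵥ x) i =
      ∑ j, M i.1 j * extendTail x j + -e * extendTail x i.1 - g i.1 * extendTail x i.1 := by
  rw [sum_mul_extendTail, extendTail_coe]
  simp only [shiftedD, blockD, perturb, Matrix.mulVec, dotProduct, Matrix.sub_apply,
    Matrix.smul_apply, Matrix.toSquareBlockProp_def, Matrix.of_apply, Matrix.diagonal_apply,
    Matrix.one_apply, smul_eq_mul, sub_mul, Finset.sum_sub_distrib, ite_mul, zero_mul, mul_ite,
    mul_one, mul_zero, Subtype.coe_inj, Finset.sum_ite_eq, Finset.mem_univ, if_true]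
  ring

lemma blockB_transpose_mulVec {N W : ℕ} {M : Matrix (Fin N) (Fin N) ℝ} (hM : M.IsSymm)
    (x : Tail N W → ℝ) (i : Head N W) :
    ((blockB W M)ᵀ *ᵥ x) i = ∑ j, M i.1 j * extendTail x j := by
  rw [sum_mul_extendTail]
  simp only [Matrix.mulVec, dotProduct, Matrix.transpose_apply, blockB, Matrix.toBlock_apply]
  exact Finset.sum_congr rfl fun j _ => by rw [hM.apply]

lemma sum_sq_blockB_mulVec_le {N W : ℕ} {M : Matrix (Fin N) (Fin N) ℝ} {C₁ : ℝ}
    (hop : ∀ x : Fin N → ℝ, ∑ i, (∑ j, M i j * x j) ^ 2 ≤ C₁ * ∑ i, x i ^ 2)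
    (w : Head N W → ℝ) : ∑ i, (blockB W M *ᵥ w) i ^ 2 ≤ C₁ * ∑ i, w i ^ 2 := by
  set y : Fin N → ℝ := fun j => if h : (j : ℕ) < W then w ⟨j, h⟩ else 0 with hy
  have hyh : ∀ j : Head N W, y j.1 = w j := fun j => dif_pos j.2
  have hyt : ∀ j : Tail N W, y j.1 = 0 := fun j => dif_neg (not_lt.2 j.2)
  have h := hop y
  rw [sum_eq_head_add_tail (W := W), sum_eq_head_add_tail (W := W) fun i => y i ^ 2] at h
  simp only [hyh, hyt, ne_eq, OfNat.ofNat_ne_zero, not_false_eq_true, zero_pow,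
    Finset.sum_const_zero, add_zero] at h
  refine le_trans ?_ h
  refine le_add_of_nonneg_of_le (Finset.sum_nonneg fun _ _ => sq_nonneg _) (le_of_eq ?_)
  refine Finset.sum_congr rfl fun i _ => ?_
  rw [sum_eq_head_add_tail (W := W) fun j => M i.1 j * y j]
  simp [hyh, hyt, Matrix.mulVec, dotProduct, blockB, Matrix.toBlock_apply]

lemma norm_sq_toEuclideanLin {m n : Type*} [Fintype m] [Fintype n] [DecidableEq n]
    (A : Matrix m n ℝ) (x : EuclideanSpace ℝ n) :
    ‖Matrix.toEuclideanLin A x‖ ^ 2 = ∑ i, (A *ᵥ x.ofLp) i ^ 2 := by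
  rw [EuclideanSpace.real_norm_sq_eq, Matrix.toLpLin_apply]

/-- The residual of the extension by zero, on the last `N - W` rows, is that of `D^g - e` up to the
perturbation `g`. -/
lemma sum_sq_residual_tail_le {N W : ℕ} (M : Matrix (Fin N) (Fin N) ℝ) {g : Fin N → ℝ} {γ : ℝ}
    (hg : ‖g‖ ≤ γ) (e : ℝ) (x : Tail N W → ℝ) :
    ∑ i : Tail N W, (∑ j, M i.1 j * extendTail x j + -e * extendTail x i.1) ^ 2 ≤
      2 * ∑ i, (shiftedD W M g e *ᵥ x) i ^ 2 + 2 * γ ^ 2 * ∑ i, x i ^ 2 := by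
  rw [Finset.mul_sum, Finset.mul_sum, ← Finset.sum_add_distrib]
  refine Finset.sum_le_sum fun i _ => ?_
  have h1 := shiftedD_mulVec M g e x i
  have h2 : (g i.1 * x i) ^ 2 ≤ γ ^ 2 * x i ^ 2 := by
    rw [mul_pow]
    refine mul_le_mul_of_nonneg_right ?_ (sq_nonneg _)
    rw [← sq_abs (g i.1)]
    exact pow_le_pow_left₀ (abs_nonneg _) ((norm_le_pi_norm g i.1).trans hg) 2
  rw [extendTail_coe x i] at h1 ⊢
  have h3 : ∑ j, M i.1 j * extendTail x j + -e * x i =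
      (shiftedD W M g e *ᵥ x) i + g i.1 * x i := by rw [h1]; ring
  rw [h3]
  nlinarith [sq_nonneg ((shiftedD W M g e *ᵥ x) i - g i.1 * x i)]

/-- Approximate eigenvectors of `D^g` with little mass on the second block. -/
lemma hasApproxEigenvector_two {N W : ℕ} (hW : 0 < W) {M : Matrix (Fin N) (Fin N) ℝ} {C₁ ρ μ : ℝ}
    (hC₁ : 0 ≤ C₁) (hρ0 : 0 < ρ) (hρ1 : ρ ≤ 1) (hμ : μ = ρ / (8 * (2 + C₁)))
    (hop : ∀ x : Fin N → ℝ, ∑ i, (∑ j, M i j * x j) ^ 2 ≤ C₁ * ∑ i, x i ^ 2)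
    {g : Fin N → ℝ} (hg : ‖g‖ ≤ ρ / 8) {e : ℝ} {u : EuclideanSpace ℝ (Tail N W)} (hu : ‖u‖ = 1)
    (hres : ‖Matrix.toEuclideanLin (shiftedD W M g e) u‖ ≤ μ)
    (hmass : ∑ i with (i.1 : ℕ) < 2 * W, |u i| ^ 2 ≤ μ ^ 2) : HasApproxEigenvector W 2 ρ M := by
  have hμ0 : 0 < μ := by rw [hμ]; positivity
  have hρμ : μ * (8 * (2 + C₁)) = ρ := by rw [hμ]; field_simp
  have hres2 : ∑ i, (shiftedD W M g e *ᵥ u.ofLp) i ^ 2 ≤ μ ^ 2 := by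
    rw [← norm_sq_toEuclideanLin]
    exact pow_le_pow_left₀ (norm_nonneg _) hres 2
  have hu2 : ∑ i, u i ^ 2 = 1 := by rw [← EuclideanSpace.real_norm_sq_eq, hu, one_pow]
  set v : Fin N → ℝ := extendTail u.ofLp with hv
  have hv2 : ∑ i, v i ^ 2 = 1 := by rw [hv, sum_sq_extendTail]; exact hu2
  set r : Fin N → ℝ := fun j => if (j : ℕ) < 2 * W then v j else 0 with hr
  have hr2 : ∑ i, r i ^ 2 ≤ μ ^ 2 := by
    refine le_trans (le_of_eq ?_) hmass
    rw [sum_eq_head_add_tail (W := W), Finset.sum_eq_zero, zero_add, Finset.sum_filter]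
    · refine Finset.sum_congr rfl fun j _ => ?_
      simp only [hr, hv, extendTail_coe]
      split_ifs <;> simp
    · intro j _
      simp [hr, hv, extendTail_of_lt _ j.2]
  set w : Fin N → ℝ := fun j => v j - r j with hw
  have hw2 : ∑ i, v i ^ 2 = ∑ i, w i ^ 2 + ∑ i, r i ^ 2 := by
    rw [← Finset.sum_add_distrib]
    refine Finset.sum_congr rfl fun i _ => ?_
    simp only [hw, hr]
    split_ifs <;> ring
  set T := Finset.univ.filter (fun i : Fin N => W ≤ (i : ℕ)) with hT
  have hκ : ∑ i ∈ T, (∑ j, M i j * v j + -e * v i) ^ 2 ≤ 2 * μ ^ 2 + 2 * (ρ / 8) ^ 2 := by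
    rw [hT, sum_filter_eq_sum_tail fun i => (∑ j, M i j * v j + -e * v i) ^ 2]
    have := sum_sq_residual_tail_le M hg e u.ofLp
    rw [hu2] at this
    linarith
  have hsub : ∀ f : Fin N → ℝ, (∀ i, 0 ≤ f i) → ∑ i ∈ T, f i ≤ ∑ i, f i :=
    fun f hf => Finset.sum_le_sum_of_subset_of_nonneg (Finset.subset_univ _) fun i _ _ => hf i
  have he : e ^ 2 ≤ 2 * (2 * μ ^ 2 + 2 * (ρ / 8) ^ 2) + 2 * C₁ := by
    have h1 : e ^ 2 = ∑ i ∈ T, (e * v i) ^ 2 := by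
      rw [← mul_one (e ^ 2), ← hv2, Finset.mul_sum]
      simp_rw [mul_pow]
      symm
      refine Finset.sum_subset (Finset.subset_univ _) fun i _ hi => ?_
      have : (i : ℕ) < W := by
        by_contra hlt
        exact hi (Finset.mem_filter.2 ⟨Finset.mem_univ _, by omega⟩)
      rw [hv, extendTail_of_lt _ this]; ring
    have h2 : ∑ i ∈ T, (e * v i) ^ 2 ≤ 2 * ∑ i ∈ T, (∑ j, M i j * v j + -e * v i) ^ 2 +
        2 * ∑ i ∈ T, (∑ j, M i j * v j) ^ 2 := by
      rw [Finset.mul_sum, Finset.mul_sum, ← Finset.sum_add_distrib]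
      refine Finset.sum_le_sum fun i _ => ?_
      linarith [sq_nonneg (∑ j, M i j * v j + -e * v i + ∑ j, M i j * v j)]
    have h3 : ∑ i ∈ T, (∑ j, M i j * v j) ^ 2 ≤ C₁ * 1 := by
      rw [← hv2]; exact (hsub _ fun _ => sq_nonneg _).trans (hop v)
    linarith
  have hμ2 : μ ^ 2 * (64 * (2 + C₁) ^ 2) = ρ ^ 2 := by rw [← hρμ]; ring
  have hρ2 : ρ ^ 2 ≤ 1 := pow_le_one₀ hρ0.le hρ1
  have hμs : (7 + 3 * C₁) * μ ^ 2 ≤ ρ ^ 2 / 32 := by nlinarith [sq_nonneg μ, mul_nonneg hC₁ hC₁]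
  have hμ4 : μ ^ 2 ≤ 1 / 4 := by nlinarith [mul_nonneg hC₁ (sq_nonneg μ)]
  have hpt : ∀ i, (∑ j, M i j * w j + -e * w i) ^ 2 ≤
      3 * ((∑ j, M i j * v j + -e * v i) ^ 2 + (∑ j, M i j * r j) ^ 2 + e ^ 2 * r i ^ 2) := by
    intro i
    have e1 : ∑ j, M i j * w j = ∑ j, M i j * v j - ∑ j, M i j * r j := by
      rw [← Finset.sum_sub_distrib]
      exact Finset.sum_congr rfl fun j _ => by simp only [hw]; ring
    have e2 : ∑ j, M i j * w j + -e * w i =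
        (∑ j, M i j * v j + -e * v i) + -(∑ j, M i j * r j) + e * r i := by
      rw [e1]; simp only [hw]; ring
    rw [e2, ← mul_pow, ← neg_sq (∑ j, M i j * r j)]
    have h3 : ∀ a b c : ℝ, (a + b + c) ^ 2 ≤ 3 * (a ^ 2 + b ^ 2 + c ^ 2) := by
      intro a b c
      nlinarith [sq_nonneg (a - b), sq_nonneg (a - c), sq_nonneg (b - c)]
    exact h3 _ _ _
  refine ⟨e, w, by linarith, fun j hj => ?_, ?_⟩
  · have : (j : ℕ) < 2 * W := (Nat.div_lt_iff_lt_mul hW).1 hj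
    simp [hw, hr, this]
  · have hTeq : Finset.univ.filter (fun i : Fin N => 2 ≤ (i : ℕ) / W + 1) = T := by
      refine Finset.filter_congr fun i _ => ?_
      rw [show 2 ≤ (i : ℕ) / W + 1 ↔ 1 ≤ (i : ℕ) / W by omega, Nat.one_le_div_iff hW]
    rw [hTeq]
    refine (Finset.sum_le_sum fun i _ => hpt i).trans ?_
    rw [← Finset.mul_sum]
    simp only [Finset.sum_add_distrib]
    have s2 : ∑ i ∈ T, (∑ j, M i j * r j) ^ 2 ≤ C₁ * μ ^ 2 :=
      (hsub _ fun _ => sq_nonneg _).trans ((hop r).trans (by gcongr))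
    have s3 : ∑ i ∈ T, e ^ 2 * r i ^ 2 ≤
        (2 * (2 * μ ^ 2 + 2 * (ρ / 8) ^ 2) + 2 * C₁) * μ ^ 2 := by
      rw [← Finset.mul_sum]
      exact mul_le_mul he ((hsub _ fun _ => sq_nonneg _).trans hr2)
        (Finset.sum_nonneg fun _ _ => sq_nonneg _) (by positivity)
    have s4 : (2 * (2 * μ ^ 2 + 2 * (ρ / 8) ^ 2) + 2 * C₁) * μ ^ 2 ≤ (5 + 2 * C₁) * μ ^ 2 := by
      gcongr; linarith
    nlinarith

/-- A direction `w` in which the quadratic form inequality holds produces the approximate kernel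
vector `(D^g - e)⁻¹ B w`, up to normalization: its image under `[Bᵀ; D^g - e]` is small. -/
lemma hasApproxEigenvector_one {N W : ℕ} {M : Matrix (Fin N) (Fin N) ℝ}
    (hM : M.IsSymm) {C₁ ρ μ : ℝ} (hC₁ : 0 ≤ C₁) (hμ : μ = ρ / (8 * (2 + C₁)))
    (hop : ∀ x : Fin N → ℝ, ∑ i, (∑ j, M i j * x j) ^ 2 ≤ C₁ * ∑ i, x i ^ 2)
    {g : Fin N → ℝ} (hg : ‖g‖ ≤ ρ / 8) {e : ℝ} (hD : IsUnit (shiftedD W M g e))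
    {w : EuclideanSpace ℝ (Head N W)} (hw : ‖w‖ = 1)
    (hineq : ‖Matrix.toEuclideanLin ((blockB W M)ᵀ * (shiftedD W M g e)⁻¹ * blockB W M) w‖ ^ 2 + 1 ≤
      μ ^ 2 * ‖Matrix.toEuclideanLin ((shiftedD W M g e)⁻¹ * blockB W M) w‖ ^ 2) :
    HasApproxEigenvector W 1 ρ M := by
  have hρμ : μ * (8 * (2 + C₁)) = ρ := by rw [hμ]; field_simp
  have hdet : IsUnit (shiftedD W M g e).det := (Matrix.isUnit_iff_isUnit_det _).1 hD
  set x : Tail N W → ℝ := ((shiftedD W M g e)⁻¹ * blockB W M) *ᵥ w.ofLp with hx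
  have hDx : shiftedD W M g e *ᵥ x = blockB W M *ᵥ w.ofLp := by
    rw [hx, Matrix.mulVec_mulVec, ← Matrix.mul_assoc, Matrix.mul_nonsing_inv _ hdet,
      Matrix.one_mul]
  rw [norm_sq_toEuclideanLin, norm_sq_toEuclideanLin, ← hx, Matrix.mul_assoc,
    ← Matrix.mulVec_mulVec, ← hx] at hineq
  have hw2 : ∑ i, w i ^ 2 = 1 := by rw [← EuclideanSpace.real_norm_sq_eq, hw, one_pow]
  have hBw : ∑ i, (shiftedD W M g e *ᵥ x) i ^ 2 ≤ C₁ := by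
    rw [hDx]
    refine (sum_sq_blockB_mulVec_le hop w.ofLp).trans (le_of_eq ?_)
    rw [hw2, mul_one]
  set X := ∑ i, x i ^ 2 with hX
  have hBx0 : 0 ≤ ∑ i, ((blockB W M)ᵀ *ᵥ x) i ^ 2 := Finset.sum_nonneg fun _ _ => sq_nonneg _
  have hX0 : 0 ≤ X := Finset.sum_nonneg fun _ _ => sq_nonneg _
  have hXpos : 0 < X := by
    rcases hX0.lt_or_eq with h | h
    · exact h
    · rw [← h] at hineq; linarith
  refine ⟨e, extendTail x, by rwa [sum_sq_extendTail], fun j hj => ?_, ?_⟩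
  · rcases Nat.eq_zero_or_pos W with rfl | hW
    · exact (hXpos.ne' (by
        have : IsEmpty (Head N 0) := ⟨fun i => absurd i.2 (by omega)⟩
        rw [Finset.univ_eq_empty, Finset.sum_empty] at hw2
        exact absurd hw2 (by norm_num))).elim
    · have : (j : ℕ) < W := by simpa using (Nat.div_lt_iff_lt_mul hW).1 hj
      exact extendTail_of_lt _ this
  · have hall : Finset.univ.filter (fun i : Fin N => 1 ≤ (i : ℕ) / W + 1) = Finset.univ :=
      Finset.filter_true_of_mem fun i _ => Nat.le_add_left 1 _
    rw [hall, sum_eq_head_add_tail (W := W), sum_sq_extendTail]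
    have h1 : ∑ i : Head N W, (∑ j, M i.1 j * extendTail x j + -e * extendTail x i.1) ^ 2 =
        ∑ i, ((blockB W M)ᵀ *ᵥ x) i ^ 2 := by
      refine Finset.sum_congr rfl fun i _ => ?_
      rw [blockB_transpose_mulVec hM, extendTail_of_lt x i.2, mul_zero, add_zero]
    have h2 := sum_sq_residual_tail_le M hg e x
    rw [h1]
    have h3 : C₁ * 1 ≤ C₁ * (μ ^ 2 * X) := by gcongr; linarith
    have h4 : (1 + 2 * C₁) * μ ^ 2 ≤ ρ ^ 2 / 32 := by
      rw [← hρμ]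
      nlinarith [sq_nonneg μ, mul_nonneg hC₁ (sq_nonneg μ),
        mul_nonneg (mul_nonneg hC₁ hC₁) (sq_nonneg μ)]
    have h5 := mul_le_mul_of_nonneg_right h4 hX0
    have h6 : 0 ≤ ρ ^ 2 * X := by positivity
    nlinarith

lemma shiftedD_isSymm {N W : ℕ} {M : Matrix (Fin N) (Fin N) ℝ} (hM : M.IsSymm) (g : Fin N → ℝ)
    (e : ℝ) : (shiftedD W M g e).IsSymm := by
  refine Matrix.IsSymm.ext fun i j => ?_
  simp only [shiftedD, blockD, perturb, Matrix.sub_apply, Matrix.smul_apply,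
    Matrix.toSquareBlockProp_def, Matrix.of_apply, Matrix.diagonal_apply, Matrix.one_apply,
    hM.apply i.1 j.1, Subtype.coe_inj]
  by_cases h : i = j
  · subst h; rfl
  · simp [h, Ne.symm h]

/-- The inequality between quadratic forms, tested against a vector. -/
lemma le_of_posSemidef {N W : ℕ} {M : Matrix (Fin N) (Fin N) ℝ} (hM : M.IsSymm) {μ : ℝ}
    {g : Fin N → ℝ} {e : ℝ}
    (h : ((blockB W M)ᵀ * (μ ^ 2 • (shiftedD W M g e ^ 2)⁻¹) * blockB W M -
      (((blockB W M)ᵀ * (shiftedD W M g e)⁻¹ * blockB W M) ^ 2 + 1)).PosSemidef)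
    {w : EuclideanSpace ℝ (Head N W)} (hw : ‖w‖ = 1) :
    ‖Matrix.toEuclideanLin ((blockB W M)ᵀ * (shiftedD W M g e)⁻¹ * blockB W M) w‖ ^ 2 + 1 ≤
      μ ^ 2 * ‖Matrix.toEuclideanLin ((shiftedD W M g e)⁻¹ * blockB W M) w‖ ^ 2 := by
  set B := blockB W M with hB
  set D := shiftedD W M g e with hD
  have hDs : (D⁻¹)ᵀ = D⁻¹ := by rw [Matrix.transpose_nonsing_inv, (shiftedD_isSymm hM g e).eq]
  have hsq : ∀ {m n : Type} [Fintype m] [Fintype n] (A : Matrix m n ℝ) (x : n → ℝ),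
      x ⬝ᵥ ((Aᵀ * A) *ᵥ x) = ∑ i, (A *ᵥ x) i ^ 2 := by
    intro m n _ _ A x
    rw [← Matrix.mulVec_mulVec, Matrix.dotProduct_mulVec, Matrix.vecMul_transpose, dotProduct]
    exact Finset.sum_congr rfl fun i _ => (sq _).symm
  have e1 : Bᵀ * (μ ^ 2 • (D ^ 2)⁻¹) * B = μ ^ 2 • ((D⁻¹ * B)ᵀ * (D⁻¹ * B)) := by
    rw [Matrix.transpose_mul, hDs, sq D, Matrix.mul_inv_rev, Matrix.mul_smul, Matrix.smul_mul]
    simp only [Matrix.mul_assoc]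
  have e2 : (Bᵀ * D⁻¹ * B) ^ 2 = (Bᵀ * D⁻¹ * B)ᵀ * (Bᵀ * D⁻¹ * B) := by
    rw [Matrix.transpose_mul, Matrix.transpose_mul, hDs, Matrix.transpose_transpose, sq]
    simp only [Matrix.mul_assoc]
  have h1 := h.dotProduct_mulVec_nonneg w.ofLp
  rw [e1, e2, star_trivial, Matrix.sub_mulVec, Matrix.add_mulVec, Matrix.smul_mulVec,
    dotProduct_sub, dotProduct_add, dotProduct_smul, hsq, hsq, Matrix.one_mulVec, smul_eq_mul]
    at h1
  have hw2 : w.ofLp ⬝ᵥ w.ofLp = 1 := by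
    have : ∑ i, w i ^ 2 = 1 := by rw [← EuclideanSpace.real_norm_sq_eq, hw, one_pow]
    rw [← this, dotProduct]
    exact Finset.sum_congr rfl fun i _ => (sq _).symm
  rw [norm_sq_toEuclideanLin, norm_sq_toEuclideanLin]
  linarith

end BandMatrix

theorem proposition3p1 (p : ℕ) (hp : 1 ≤ p) (c₀ C₀ δ K : ℝ) (hc₀ : 0 < c₀) (hδ : 0 < δ) :
    ∃ μ : ℝ, 0 < μ ∧ ∀ c : ℝ, 0 < c → ∀ D : ℝ, 0 < D → ∃ N₀ : ℕ, ∀ W : ℕ, N₀ ≤ 2 * p * W →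
      ∀ (Ω : Type*) [MeasurableSpace Ω] (P : Measure Ω) [IsProbabilityMeasure P]
        (H : Ω → Matrix (Fin (2 * p * W)) (Fin (2 * p * W)) ℝ),
        BandMatrix.IsBandMatrix P p W c₀ C₀ δ K H →
        -- approximate eigenvectors of `D^g` with small mass on their first `W` coordinates
        P {ω | ∃ (e : ℝ) (u : EuclideanSpace ℝ (BandMatrix.Tail (2 * p * W) W))
              (g : Fin (2 * p * W) → ℝ),
            ‖g‖ ≤ ((2 * p * W : ℕ) : ℝ) ^ (-c) ∧ ‖u‖ = 1 ∧
            ‖Matrix.toEuclideanLin (BandMatrix.shiftedD W (H ω) g e) u‖ ≤ μ ∧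
            ∑ i with (i.1 : ℕ) < 2 * W, |u i| ^ 2 ≤ μ ^ 2}
          ≤ ENNReal.ofReal (((2 * p * W : ℕ) : ℝ) ^ (-D)) ∧
        -- the inequality between quadratic forms, in the sense of symmetric matrices
        P {ω | ∃ (e : ℝ) (g : Fin (2 * p * W) → ℝ),
            ‖g‖ ≤ ((2 * p * W : ℕ) : ℝ) ^ (-c) ∧
            IsUnit (BandMatrix.shiftedD W (H ω) g e) ∧
            ((BandMatrix.blockB W (H ω))ᵀ * (μ ^ 2 • (BandMatrix.shiftedD W (H ω) g e ^ 2)⁻¹) *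
                BandMatrix.blockB W (H ω) -
              (((BandMatrix.blockB W (H ω))ᵀ * (BandMatrix.shiftedD W (H ω) g e)⁻¹ *
                BandMatrix.blockB W (H ω)) ^ 2 + 1)).PosSemidef}
          ≤ ENNReal.ofReal (((2 * p * W : ℕ) : ℝ) ^ (-D)) ∧
        -- the same inequality in a single direction `w`
        P {ω | ∃ (e : ℝ) (g : Fin (2 * p * W) → ℝ)
              (w : EuclideanSpace ℝ (BandMatrix.Head (2 * p * W) W)),
            ‖g‖ ≤ ((2 * p * W : ℕ) : ℝ) ^ (-c) ∧
            IsUnit (BandMatrix.shiftedD W (H ω) g e) ∧ ‖w‖ = 1 ∧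
            ‖Matrix.toEuclideanLin ((BandMatrix.blockB W (H ω))ᵀ *
                (BandMatrix.shiftedD W (H ω) g e)⁻¹ * BandMatrix.blockB W (H ω)) w‖ ^ 2 + 1 ≤
              μ ^ 2 * ‖Matrix.toEuclideanLin
                ((BandMatrix.shiftedD W (H ω) g e)⁻¹ * BandMatrix.blockB W (H ω)) w‖ ^ 2}
          ≤ ENNReal.ofReal (((2 * p * W : ℕ) : ℝ) ^ (-D)) := by
  obtain ⟨C₁, hC₁, hop⟩ := BandMatrix.exists_opNorm_bound p hp c₀ C₀ hδ K
  obtain ⟨ρ₁, hρ₁0, hρ₁1, h₁⟩ :=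
    BandMatrix.exists_approxEigenvector_unlikely p hp C₀ K hc₀ hδ hC₁.le (k := 1) le_rfl
  obtain ⟨ρ₂, hρ₂0, hρ₂1, h₂⟩ :=
    BandMatrix.exists_approxEigenvector_unlikely p hp C₀ K hc₀ hδ hC₁.le (k := 2) one_le_two
  set ρ := min ρ₁ ρ₂ with hρ
  have hρ0 : 0 < ρ := lt_min hρ₁0 hρ₂0
  have hρ1 : ρ ≤ 1 := (min_le_left _ _).trans hρ₁1
  refine ⟨ρ / (8 * (2 + C₁)), by positivity, fun c hc D hD => ?_⟩
  obtain ⟨A, a, hA, ha, W₀, hbad⟩ := hop.or (h₁.or h₂)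
  have hp' : (0 : ℝ) < p := by exact_mod_cast hp
  obtain ⟨N₁, hN₁⟩ := Filter.eventually_atTop.1
    (((tendsto_rpow_neg_atTop hc).comp tendsto_natCast_atTop_atTop).eventually_le_const
      (by positivity : 0 < ρ / 8))
  have hdecay := (isLittleO_exp_neg_mul_rpow_atTop (by positivity : 0 < a / (2 * p)) (-D)).comp_tendsto
    tendsto_natCast_atTop_atTop
  obtain ⟨N₂, hN₂⟩ := Filter.eventually_atTop.1
    (hdecay.bound (by positivity : 0 < (A + 1)⁻¹))
  refine ⟨max (max N₁ N₂) (max 1 (2 * p * W₀)), fun W hN Ω _ P _ H hH => ?_⟩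
  have hNW₁ := hN₁ (2 * p * W) ((le_max_left _ _).trans ((le_max_left _ _).trans hN))
  have hNW₂ := hN₂ (2 * p * W) ((le_max_right _ _).trans ((le_max_left _ _).trans hN))
  have hN1 : 1 ≤ 2 * p * W := (le_max_left _ _).trans ((le_max_right _ _).trans hN)
  have hW : 0 < W := Nat.pos_of_ne_zero fun h => by simp [h] at hN1
  have hW₀ : W₀ ≤ W := Nat.le_of_mul_le_mul_left
    ((le_max_right _ _).trans ((le_max_right _ _).trans hN)) (by omega : 0 < 2 * p)
  have hfinal : ENNReal.ofReal (A * Real.exp (-a * W)) ≤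
      ENNReal.ofReal (((2 * p * W : ℕ) : ℝ) ^ (-D)) := by
    refine ENNReal.ofReal_le_ofReal ?_
    simp only [Function.comp] at hNW₂
    rw [Real.norm_of_nonneg (Real.exp_pos _).le, Real.norm_of_nonneg (by positivity)] at hNW₂
    have e1 : -(a / (2 * p)) * ((2 * p * W : ℕ) : ℝ) = -a * W := by push_cast; field_simp
    rw [e1, inv_mul_eq_div, le_div_iff₀ (by positivity)] at hNW₂
    have := Real.exp_pos (-a * W)
    linarith
  have hmain := (hbad W hW₀ hW Ω P H hH).trans hfinal
  have hthird : ∀ ω e g w, ‖g‖ ≤ ((2 * p * W : ℕ) : ℝ) ^ (-c) →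
      IsUnit (BandMatrix.shiftedD W (H ω) g e) → ‖w‖ = 1 →
      ‖Matrix.toEuclideanLin ((BandMatrix.blockB W (H ω))ᵀ *
        (BandMatrix.shiftedD W (H ω) g e)⁻¹ * BandMatrix.blockB W (H ω)) w‖ ^ 2 + 1 ≤
        (ρ / (8 * (2 + C₁))) ^ 2 * ‖Matrix.toEuclideanLin
          ((BandMatrix.shiftedD W (H ω) g e)⁻¹ * BandMatrix.blockB W (H ω)) w‖ ^ 2 →
      (∀ x : Fin (2 * p * W) → ℝ, ∑ i, (∑ j, H ω i j * x j) ^ 2 ≤ C₁ * ∑ i, x i ^ 2) →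
      BandMatrix.HasApproxEigenvector W 1 ρ₁ (H ω) := by
    intro ω e g w hg hu hw hineq hopω
    exact (BandMatrix.hasApproxEigenvector_one (hH.symm ω) hC₁.le rfl hopω (hg.trans hNW₁) hu hw
      hineq).mono hρ0.le (min_le_left _ _)
  refine ⟨(measure_mono ?_).trans hmain, (measure_mono ?_).trans hmain,
    (measure_mono ?_).trans hmain⟩
  · rintro ω ⟨e, u, g, hg, hu, hres, hmass⟩
    by_cases hopω : ∀ x : Fin (2 * p * W) → ℝ,
      ∑ i, (∑ j, H ω i j * x j) ^ 2 ≤ C₁ * ∑ i, x i ^ 2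
    · exact Or.inr (Or.inr ⟨hopω, (BandMatrix.hasApproxEigenvector_two hW hC₁.le hρ0 hρ1 rfl hopω
        (hg.trans hNW₁) hu hres hmass).mono hρ0.le (min_le_right _ _)⟩)
    · exact Or.inl hopω
  · rintro ω ⟨e, g, hg, hu, hpos⟩
    by_cases hopω : ∀ x : Fin (2 * p * W) → ℝ,
      ∑ i, (∑ j, H ω i j * x j) ^ 2 ≤ C₁ * ∑ i, x i ^ 2
    · have hw : ‖EuclideanSpace.single (⟨⟨0, hN1⟩, hW⟩ : BandMatrix.Head (2 * p * W) W) (1 : ℝ)‖ =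
          1 := by simp
      exact Or.inr (Or.inl ⟨hopω, hthird ω e g _ hg hu hw
        (BandMatrix.le_of_posSemidef (hH.symm ω) hpos hw) hopω⟩)
    · exact Or.inl hopω
  · rintro ω ⟨e, g, w, hg, hu, hw, hineq⟩
    by_cases hopω : ∀ x : Fin (2 * p * W) → ℝ,
      ∑ i, (∑ j, H ω i j * x j) ^ 2 ≤ C₁ * ∑ i, x i ^ 2
    · exact Or.inr (Or.inl ⟨hopω, hthird ω e g w hg hu hw hineq hopω⟩)
    · exact Or.inl hopω
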